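/- Let $d\in[0,1)$, $\alpha>-d$. Write $H(w)=-\sum_i w_i\log w_i$, $h(p)=-p\log p-(1-p)\log(1-p)$, $\psi_0=\Gamma'/\Gamma$, $\psi_1=\psi_0'$, and let $\mathrm{PY}(d,\theta)$ (for $\theta>-d$) be the law of the weights $w_i=v_i\prod_{j<i}(1-v_j)$, where $v_i\sim\mathrm{Beta}(1-d,\theta+id)$, $i\ge 1$, are independent. Let $P=\sum_i w_i\delta_{\varphi_i}$, where $w\sim \mathrm{PY}(d,\alpha)$ and the $\varphi_i$ are i.i.d. from a base probability measure without point masses, independent of $w$, and let $x=(x_1,\dots,x_N)$, given $(w,\varphi)$, be i.i.d. from $P$, $N\ge1$. Suppose $x$ has $K$ distinct values, with multiplicities $n_1,\dots,n_K\ge1$, $\sum_k n_k=N$. Let $$(p_1,\dots,p_K,p_*)\sim\mathrm{Dir}(n_1-d,\dots,n_K-d,\alpha+Kd),\qquad \pi\sim\mathrm{PY}(d,\alpha+Kd)$$ be independent, $\mathbf p=(p_1,\dots,p_K)/(1-p_*)$, $\pi_{\rm post}=(p_1,\dots,p_K,p_*\pi_1,p_*\pi_2,\dots)$, $\mathbf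 A=\mathbb E[H(\mathbf p)]$, $\mathbf B=\mathbb E[H(\pi)]$ and $\Omega(p)=(1-p)\mathbf A+p\,\mathbf B+h(p)$. Then all the series defining these entropies converge almost surely, $H(w)$, $H(\pi_{\rm post})$, $H(\mathbf p)$, $H(\pi)$, $\Omega(p_*)$ are square integrable, and almost surely $$\mathrm{Var}[H(w)\mid x]=\mathrm{Var}[H(\pi_{\rm post})]=\mathbb E[(1-p_*)^2]\,\mathrm{Var}[H(\mathbf p)]+\mathbb E[p_*^2]\,\mathrm{Var}[H(\pi)]+\mathrm{Var}[\Omega(p_*)],$$ where $\mathrm{Var}[\Omega(p_*)]=\mathbb E[\Omega(p_*)^2]-\mathbb E[\Omega(p_*)]^2$, $$\mathbb E[\Omega(p_*)]=\mathbb E[1-p_*]\mathbf A+\mathbb E[p_*]\mathbf B+\mathbb E[h(p_*)],$$ $$\mathbb E[\Omega(p_*)^2]=2\mathbb E[p_*h(p_*)](\mathbf B-\mathbf A)+2\mathbf A\mathbb E[h(p_*)]+\mathbb E[h(p_*)^2]+\mathbb E[p_*^2](\mathbf B^2-2\mathbf A\mathbf B)+2\mathbb E[p_*]\mathbf A\mathbf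 B+\mathbb E[(1-p_*)^2]\mathbf A^2.$$ The components are, with $b=\alpha+Kd$ and $c=N-Kd$ (so $b+c=\alpha+N$): $$\mathbb E[p_*]=\tfrac{b}{\alpha+N},\quad \mathbb E[1-p_*]=\tfrac{c}{\alpha+N},\quad \mathbb E[p_*^2]=\tfrac{b(b+1)}{(\alpha+N)(\alpha+N+1)},\quad \mathbb E[(1-p_*)^2]=\tfrac{c(c+1)}{(\alpha+N)(\alpha+N+1)},$$ $$\mathbf A=M_1(n_1-d,\dots,n_K-d),\qquad \mathrm{Var}[H(\mathbf p)]=M_2(n_1-d,\dots,n_K-d)-M_1(n_1-d,\dots,n_K-d)^2,$$ $$\mathbf B=\psi_0(b+1)-\psi_0(1-d),\qquad \mathrm{Var}[H(\pi)]=\tfrac{b+d}{(b+1)^2(1-d)}+\tfrac{1-d}{b+1}\psi_1(2-d)-\psi_1(2+b),$$ $$\mathbb E[h(p_*)]=M_1(b,c),\qquad \mathbb E[h(p_*)^2]=M_2(b,c),$$ $$\mathbb E[p_*h(p_*)]=\tfrac{b(b+1)}{(\alpha+N)(\alpha+N+1)}\bigl(\psi_0(\alpha+N+2)-\psi_0(b+2)\bigr)+\tfrac{bc}{(\alpha+N)(\alpha+N+1)}\bigl(\psi_0(\alpha+N+2)-\psi_0(c+1)\bigr),$$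 where for $a\in(0,\infty)^m$ and $S=\sum_i a_i$ $$M_1(a)=\psi_0(S+1)-\sum_i\tfrac{a_i}{S}\psi_0(a_i+1),$$ $$M_2(a)=\sum_{i\ne k}\tfrac{a_ia_k}{(S+1)S}\bigl[(\psi_0(a_k+1)-\psi_0(S+2))(\psi_0(a_i+1)-\psi_0(S+2))-\psi_1(S+2)\bigr]+\sum_i\tfrac{(a_i+1)a_i}{(S+1)S}\bigl[(\psi_0(a_i+2)-\psi_0(S+2))^2+\psi_1(a_i+2)-\psi_1(S+2)\bigr].$$ -/

import Mathlib

open MeasureTheory ProbabilityTheory Real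

noncomputable section

/-- The (natural-log) entropy `-∑ wᵢ log wᵢ` of a family of weights on a countable alphabet. -/
def entropy {ι : Type*} (w : ι → ℝ) : ℝ :=
  ∑' i, negMulLog (w i)

/-- The digamma function `ψ₀ = Γ' / Γ` on the reals. -/
def psi0 (x : ℝ) : ℝ :=
  logDeriv Real.Gamma x

/-- The trigamma function `ψ₁ = ψ₀'` on the reals. -/
def psi1 (x : ℝ) : ℝ :=
  deriv psi0 x

/-! ### Pitman–Yor weights and Dirichlet vectors -/

/-- Stick breaking: `wᵢ = vᵢ ∏_{j < i} (1 - vⱼ)`. -/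
def stickBreaking (v : ℕ → ℝ) : ℕ → ℝ := fun i =>
  v i * ∏ j ∈ Finset.range i, (1 - v j)

theorem measurable_stickBreaking : Measurable stickBreaking := by
  unfold stickBreaking
  fun_prop

/-- The law `PY(d, α)` of the weights of a Pitman–Yor process: the stick-breaking weights of
independent `vᵢ ∼ Beta(1 - d, α + i d)`, where `i = 1, 2, …` (the index is shifted by one here,
since sequences are indexed from `0`). -/
def pitmanYor (d α : ℝ) : Measure (ℕ → ℝ) :=
  (Measure.infinitePi fun i : ℕ => betaMeasure (1 - d) (α + ((i : ℝ) + 1) * d)).map stickBreaking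

/-- The Dirichlet law `Dir(a₁, …, aₘ)`: the law of `(g₁, …, gₘ) / (g₁ + ⋯ + gₘ)` for independent
`gᵢ ∼ Gamma(aᵢ, 1)`. -/
def dirichlet {m : ℕ} (a : Fin m → ℝ) : Measure (Fin m → ℝ) :=
  (Measure.pi fun i => gammaMeasure (a i) 1).map fun g i => g i / ∑ j, g j

/-! ### Sampling from a Pitman–Yor process -/

/-- The discrete measure `∑ᵢ wᵢ δ_{φᵢ}`. -/
def discreteMeasure {𝒳 : Type*} [MeasurableSpace 𝒳] (w : ℕ → ℝ) (φ : ℕ → 𝒳) : Measure 𝒳 :=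
  Measure.sum fun i => ENNReal.ofReal (w i) • Measure.dirac (φ i)

/-- The Bayesian model: `P = ∑ᵢ wᵢ δ_{φᵢ}` has weights `w ∼ PY(d, α)` and independent atoms
`φᵢ ∼ G` that are independent of the weights; given `(w, φ)`, the observations `x₁, …, x_N` are
independent with common law `P`. -/
structure IsPitmanYorSample {Ω 𝒳 : Type*} [MeasurableSpace Ω] [MeasurableSpace 𝒳]
    (μ : Measure Ω) (G : Measure 𝒳) (d α : ℝ) {N : ℕ}
    (w : Ω → ℕ → ℝ) (φ : Ω → ℕ → 𝒳) (x : Ω → Fin N → 𝒳) : Prop where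
  measurable_w : Measurable w
  measurable_φ : Measurable φ
  measurable_x : Measurable x
  prior : μ.map (fun ω => (w ω, φ ω)) = (pitmanYor d α).prod (Measure.infinitePi fun _ : ℕ => G)
  sampling : ∀ (E : Set ((ℕ → ℝ) × (ℕ → 𝒳))) (B : Fin N → Set 𝒳),
    MeasurableSet E → (∀ j, MeasurableSet (B j)) →
      μ {ω | (w ω, φ ω) ∈ E ∧ ∀ j, x ω j ∈ B j} =
        ∫⁻ ω in {ω | (w ω, φ ω) ∈ E}, ∏ j, discreteMeasure (w ω) (φ ω) (B j) ∂μ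

/-! ### The posterior random vector

The sample space is the set of pairs `z = ((p₁, …, p_K, p_*), (π₁, π₂, …))`. -/

/-- `(p₁, …, p_K, p_*) ∼ Dir(n₁ - d, …, n_K - d, α + K d)` and, independently,
`π ∼ PY(d, α + K d)`. -/
def posteriorLaw (d α : ℝ) {K : ℕ} (n : Fin K → ℕ) : Measure ((Fin (K + 1) → ℝ) × (ℕ → ℝ)) :=
  (dirichlet (Fin.snoc (fun k => (n k : ℝ) - d) (α + K * d) : Fin (K + 1) → ℝ)).prod
    (pitmanYor d (α + K * d))

/-- The mass `p_*` of the unobserved symbols. -/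
def pStar {K : ℕ} (z : (Fin (K + 1) → ℝ) × (ℕ → ℝ)) : ℝ :=
  z.1 (Fin.last K)

/-- The distribution `𝐩` on the observed symbols: `pₖ / (1 - p_*)`, `k = 1, …, K`. -/
def pObs {K : ℕ} (z : (Fin (K + 1) → ℝ) × (ℕ → ℝ)) : Fin K → ℝ := fun k =>
  z.1 k.castSucc / (1 - pStar z)

/-- The posterior vector `π_post = (p₁, …, p_K, p_* π₁, p_* π₂, …)`. -/
def piPost {K : ℕ} (z : (Fin (K + 1) → ℝ) × (ℕ → ℝ)) : Fin K ⊕ ℕ → ℝ :=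
  Sum.elim (fun k => z.1 k.castSucc) (fun i => pStar z * z.2 i)

/-- `Ω(p) = (1 - p) A + p B + h(p)`, with `h` the binary entropy function. -/
def bigOmega (A B p : ℝ) : ℝ :=
  (1 - p) * A + p * B + binEntropy p

/-! ### Closed-form expressions -/

/-- The closed form for the mean entropy under `Dir(a₁, …, aₘ)`. -/
def dirichletEntropyMean {m : ℕ} (a : Fin m → ℝ) : ℝ :=
  psi0 (∑ i, a i + 1) - ∑ i, a i / (∑ j, a j) * psi0 (a i + 1)

/-- The closed form for the second moment of the entropy under `Dir(a₁, …, aₘ)`, with the total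
`S` of the parameters as a separate argument. -/
def dirichletEntropySecondMomentAux {m : ℕ} (a : Fin m → ℝ) (S : ℝ) : ℝ :=
  (∑ i, ∑ k ∈ Finset.univ.erase i, a i * a k / ((S + 1) * S) *
      ((psi0 (a k + 1) - psi0 (S + 2)) * (psi0 (a i + 1) - psi0 (S + 2)) - psi1 (S + 2))) +
    ∑ i, (a i + 1) * a i / ((S + 1) * S) *
      ((psi0 (a i + 2) - psi0 (S + 2)) ^ 2 + psi1 (a i + 2) - psi1 (S + 2))

/-- The closed form for the second moment of the entropy under `Dir(a₁, …, aₘ)`. -/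
def dirichletEntropySecondMoment {m : ℕ} (a : Fin m → ℝ) : ℝ :=
  dirichletEntropySecondMomentAux a (∑ i, a i)

/-- The closed form for the mean entropy under `PY(d, θ)`. -/
def pitmanYorEntropyMean (d θ : ℝ) : ℝ :=
  psi0 (θ + 1) - psi0 (1 - d)

/-- The closed form for the variance of the entropy under `PY(d, θ)`. -/
def pitmanYorEntropyVariance (d θ : ℝ) : ℝ :=
  (θ + d) / ((θ + 1) ^ 2 * (1 - d)) + (1 - d) / (θ + 1) * psi1 (2 - d) - psi1 (2 + θ)

end

/-! ### Gamma and beta laws -/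

/-! Everything rests on size-biased sampling. Entropy is a symmetric function of the weights, and
Pitman–Yor weights in stick-breaking order satisfy `E ∑ wᵢ Fᵢ(w) = E F₀(w)` for every
permutation-equivariant `F ≥ 0` (`lintegral_tsum_pitmanYor`). The first weight `v` is a beta
variable, and the others are `1 - v` times an independent `PY(d, α + d)` sequence. So sums over
picked atoms can be peeled off one stick at a time.

Moments of `H` under `PY`. Writing `H = ∑ wᵢ (-log wᵢ)` gives `E[H g(H)] = E[-log v · g(h(v) + (1 -
v) H')]`, by size-biasing and the chain rule, with `H'` the entropy of the remaining sequence
(`lintegral_eEntropy_mul_pitmanYor`). The choices `g = 1` and `g = id` reduce the mean and the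
second moment to logarithmic moments of a beta law.

Posterior. The atoms are almost surely distinct, so a pattern of ties in the sample is a pattern of
ties among the sampled indices, and the values of the atoms carry no information on the weights.
Hence the law of `H(w)` on a tie pattern with multiplicities `n` is weighted by `∑ ∏ w_{σ k}^{n k}`,
summed over injective `σ` (`lintegral_pattern`). Peeling off the `K` indices, each stick becomes a
beta variable with updated parameters, and these reassemble into the Dirichlet vector followed by
`PY(d, α + K d)` (`exists_lintegral_tupleWeight_eq`). Up to a constant this is the law of
`H(π_post)`, and total mass fixes the constant.

Decomposition. `p_*`, `𝐩` and `π` are independent (`measurePreserving_posteriorLaw`), and the chain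
rule gives `H(π_post) = (1 - p_*) H(𝐩) + p_* H(π) + h(p_*)`. After centring `H(𝐩)` and `H(π)` at `A`
and `B`, the deterministic part given `p_*` is `Ω(p_*)` and the cross terms vanish
(`variance_mixture`).

Closed forms. A Dirichlet vector is a normalised vector of independent gammas, independent of their
total (`gammaSumIndep`). The cumulants of the logarithm of a gamma variable are derivatives of `log
Γ`, and multiplying by a coordinate raises its parameter by one. -/

theorem measurable_gammaPDF (a r : ℝ) : Measurable (gammaPDF a r) :=
  (measurable_gammaPDFReal a r).ennreal_ofReal

theorem measurable_betaPDF (a b : ℝ) : Measurable (betaPDF a b) :=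
  (measurable_betaPDFReal a b).ennreal_ofReal

instance sFinite_betaMeasure (a b : ℝ) : SFinite (betaMeasure a b) := by
  unfold betaMeasure; infer_instance

instance sFinite_gammaMeasure (a r : ℝ) : SFinite (gammaMeasure a r) := by
  unfold gammaMeasure; infer_instance

theorem lintegral_gammaMeasure (a : ℝ) {f : ℝ → ENNReal} (hf : Measurable f) :
    ∫⁻ x, f x ∂gammaMeasure a 1 = ∫⁻ x, gammaPDF a 1 x * f x := by
  rw [gammaMeasure, lintegral_withDensity_eq_lintegral_mul _ (measurable_gammaPDF a 1) hf]
  rfl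

theorem lintegral_betaMeasure (a b : ℝ) {f : ℝ → ENNReal} (hf : Measurable f) :
    ∫⁻ x, f x ∂betaMeasure a b = ∫⁻ x, betaPDF a b x * f x := by
  rw [betaMeasure, lintegral_withDensity_eq_lintegral_mul _ (measurable_betaPDF a b) hf]
  rfl

theorem ae_gammaMeasure_pos (a : ℝ) : ∀ᵐ x ∂gammaMeasure a 1, 0 < x := by
  rw [gammaMeasure, ae_withDensity_iff (measurable_gammaPDF a 1)]
  -- The gamma density is defined by its formula at `0` too, so that point is removed as a null set.
  have h0 : ∀ᵐ x : ℝ, x ≠ 0 := by simp [ae_iff]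
  filter_upwards [h0] with x hx hne
  by_contra hle
  exact hne (gammaPDF_of_neg (lt_of_le_of_ne (not_lt.1 hle) hx))

theorem ae_betaMeasure_mem (a b : ℝ) : ∀ᵐ x ∂betaMeasure a b, 0 < x ∧ x < 1 := by
  rw [betaMeasure, ae_withDensity_iff (measurable_betaPDF a b)]
  refine ae_of_all _ fun x hne => ?_
  by_contra h
  exact hne (by simp [betaPDF_eq, h])

theorem gammaPDFReal_of_pos (a : ℝ) {x : ℝ} (hx : 0 < x) :
    gammaPDFReal a 1 x = x ^ (a - 1) * exp (-x) / Real.Gamma a := by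
  rw [gammaPDFReal, if_pos hx.le, one_rpow, one_mul]
  ring

theorem betaPDFReal_of_mem (a b : ℝ) {x : ℝ} (hx0 : 0 < x) (hx1 : x < 1) :
    betaPDFReal a b x = x ^ (a - 1) * (1 - x) ^ (b - 1) / beta a b := by
  rw [betaPDFReal, if_pos ⟨hx0, hx1⟩]
  ring

/-- Biasing a gamma law by a power gives a gamma law. -/
theorem lintegral_gammaMeasure_rpow_mul {a t : ℝ} (ha : 0 < a) (hat : 0 < a + t)
    {f : ℝ → ENNReal} (hf : Measurable f) :
    ∫⁻ x, ENNReal.ofReal (x ^ t) * f x ∂gammaMeasure a 1 =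
      ENNReal.ofReal (Real.Gamma (a + t) / Real.Gamma a) * ∫⁻ x, f x ∂gammaMeasure (a + t) 1 := by
  have h0 : ∀ᵐ x : ℝ, x ≠ 0 := by simp [ae_iff]
  have hm := measurable_gammaPDF (a + t) 1
  rw [lintegral_gammaMeasure a (by fun_prop), lintegral_gammaMeasure (a + t) hf,
    ← lintegral_const_mul _ (by fun_prop)]
  refine lintegral_congr_ae ?_
  filter_upwards [h0] with x hx
  rcases lt_or_gt_of_ne hx with hneg | hpos
  · simp [gammaPDF_of_neg hneg]
  · rw [← mul_assoc, ← mul_assoc, gammaPDF, gammaPDF, ← ENNReal.ofReal_mul' (by positivity),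
      ← ENNReal.ofReal_mul (div_nonneg (Real.Gamma_pos_of_pos hat).le (Real.Gamma_pos_of_pos ha).le),
      gammaPDFReal_of_pos _ hpos, gammaPDFReal_of_pos _ hpos]
    congr 2
    have h1 := (Real.Gamma_pos_of_pos hat).ne'
    have h2 := (Real.Gamma_pos_of_pos ha).ne'
    rw [show a + t - 1 = (a - 1) + t by ring, rpow_add hpos]
    field_simp

/-- Biasing a gamma law by the identity gives a gamma law. -/
theorem lintegral_gammaMeasure_mul {a : ℝ} (ha : 0 < a) {f : ℝ → ENNReal} (hf : Measurable f) :
    ∫⁻ x, ENNReal.ofReal x * f x ∂gammaMeasure a 1 =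
      ENNReal.ofReal a * ∫⁻ x, f x ∂gammaMeasure (a + 1) 1 := by
  have h := lintegral_gammaMeasure_rpow_mul ha (t := 1) (by linarith) hf
  rwa [Real.Gamma_add_one ha.ne', mul_div_assoc, div_self (Real.Gamma_pos_of_pos ha).ne', mul_one,
    show (fun x : ℝ => ENNReal.ofReal (x ^ (1 : ℝ)) * f x) =
      fun x => ENNReal.ofReal x * f x by simp] at h

/-- Biasing a beta law by a monomial in `x` and `1 - x` gives a beta law. -/
theorem lintegral_betaMeasure_pow_mul {a b : ℝ} (ha : 0 < a) (hb : 0 < b) (m n : ℕ)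
    {f : ℝ → ENNReal} (hf : Measurable f) :
    ∫⁻ x, ENNReal.ofReal (x ^ m * (1 - x) ^ n) * f x ∂betaMeasure a b =
      ENNReal.ofReal (beta (a + m) (b + n) / beta a b) *
        ∫⁻ x, f x ∂betaMeasure (a + m) (b + n) := by
  have hm := measurable_betaPDF (a + m) (b + n)
  have hB := beta_pos ha hb
  have hB' : 0 < beta (a + m) (b + n) := beta_pos (by positivity) (by positivity)
  rw [lintegral_betaMeasure a b (by fun_prop), lintegral_betaMeasure _ _ hf,
    ← lintegral_const_mul _ (by fun_prop)]
  refine lintegral_congr fun x => ?_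
  by_cases hx : 0 < x ∧ x < 1
  · have h1 : 0 < 1 - x := by linarith [hx.2]
    have hx0 := hx.1
    rw [← mul_assoc, ← mul_assoc, betaPDF, betaPDF, ← ENNReal.ofReal_mul' (by positivity),
      ← ENNReal.ofReal_mul (by positivity), betaPDFReal_of_mem _ _ hx.1 hx.2,
      betaPDFReal_of_mem _ _ hx.1 hx.2]
    congr 2
    rw [show a + m - 1 = (a - 1) + m by ring, show b + n - 1 = (b - 1) + n by ring,
      rpow_add hx0, rpow_add h1, rpow_natCast, rpow_natCast]
    field_simp
  · simp [betaPDF_eq, hx]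

theorem lintegral_comp_mul_left {r : ℝ} (hr : 0 < r) {f : ℝ → ENNReal} (hf : Measurable f) :
    ∫⁻ x, f x = ENNReal.ofReal r * ∫⁻ u, f (r * u) := by
  conv_lhs => rw [← Real.smul_map_volume_mul_left hr.ne']
  rw [lintegral_smul_measure, lintegral_map hf (by fun_prop), abs_of_pos hr, smul_eq_mul]

/-- Density form of the substitution `x = r u`, `y = r (1 - u)`, with Jacobian `r`. The endpoints
are excluded because the beta density vanishes there while a gamma density at `0` need not. -/
theorem mul_gammaPDF_mul_gammaPDF {a b : ℝ} (ha : 0 < a) (hb : 0 < b) {r u : ℝ} (hr : 0 < r)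
    (hu0 : u ≠ 0) (hu1 : u ≠ 1) :
    ENNReal.ofReal r * (gammaPDF a 1 (r * u) * gammaPDF b 1 (r - r * u)) =
      gammaPDF (a + b) 1 r * betaPDF a b u := by
  rcases lt_or_gt_of_ne hu0 with hu | hu
  · rw [gammaPDF_of_neg (mul_neg_of_pos_of_neg hr hu), betaPDF_eq_zero_of_nonpos hu.le]
    simp
  rcases lt_or_gt_of_ne hu1 with hu' | hu'
  · have h1 : 0 < 1 - u := by linarith
    have hGa := Real.Gamma_pos_of_pos ha
    have hGb := Real.Gamma_pos_of_pos hb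
    have hGab := Real.Gamma_pos_of_pos (add_pos ha hb)
    have e : r - r * u = r * (1 - u) := by ring
    rw [e]
    simp only [gammaPDF, betaPDF]
    rw [gammaPDFReal_of_pos _ (mul_pos hr hu), gammaPDFReal_of_pos _ (mul_pos hr h1),
      gammaPDFReal_of_pos _ hr, betaPDFReal_of_mem _ _ hu hu', ← ENNReal.ofReal_mul (by positivity),
      ← ENNReal.ofReal_mul (by positivity), ← ENNReal.ofReal_mul (by positivity)]
    congr 1
    rw [mul_rpow hr.le hu.le, mul_rpow hr.le h1.le, beta,
      show a + b - 1 = (a - 1) + (b - 1) + 1 by ring, rpow_add hr, rpow_add hr, rpow_one,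
      show exp (-r) = exp (-(r * u)) * exp (-(r * (1 - u))) by rw [← exp_add]; ring_nf]
    field_simp
  · rw [gammaPDF_of_neg (a := b) (by nlinarith), betaPDF_eq_zero_of_one_le hu'.le]
    simp

/-- If `x ∼ Gamma(a)` and `y ∼ Gamma(b)` are independent, then `x + y ∼ Gamma(a + b)` and
`x / (x + y) ∼ Beta(a, b)` are independent. -/
theorem lintegral_gamma_gamma {a b : ℝ} (ha : 0 < a) (hb : 0 < b) {f : ℝ → ℝ → ENNReal}
    (hf : Measurable (Function.uncurry f)) :
    ∫⁻ x, ∫⁻ y, f (x + y) (x / (x + y)) ∂gammaMeasure b 1 ∂gammaMeasure a 1 =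
      ∫⁻ r, ∫⁻ u, f r u ∂betaMeasure a b ∂gammaMeasure (a + b) 1 := by
  have hga := measurable_gammaPDF a 1
  have hgb := measurable_gammaPDF b 1
  have hgab := measurable_gammaPDF (a + b) 1
  have hbe := measurable_betaPDF a b
  have h0 : ∀ᵐ x : ℝ, x ≠ 0 := by simp [ae_iff]
  have h1 : ∀ᵐ x : ℝ, x ≠ 1 := by simp [ae_iff]
  have hfb : Measurable fun x : ℝ => ∫⁻ y, f (x + y) (x / (x + y)) ∂gammaMeasure b 1 := by
    apply Measurable.lintegral_prod_right'
      (f := fun z : ℝ × ℝ => f (z.1 + z.2) (z.1 / (z.1 + z.2)))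
    fun_prop
  have hfr : Measurable fun r : ℝ => ∫⁻ u, f r u ∂betaMeasure a b := by
    apply Measurable.lintegral_prod_right' (f := fun z : ℝ × ℝ => f z.1 z.2)
    fun_prop
  rw [lintegral_gammaMeasure a hfb, lintegral_gammaMeasure (a + b) hfr]
  calc ∫⁻ x, gammaPDF a 1 x * ∫⁻ y, f (x + y) (x / (x + y)) ∂gammaMeasure b 1
      = ∫⁻ x, ∫⁻ r, gammaPDF a 1 x * (gammaPDF b 1 (r - x) * f r (x / r)) := by
        -- Translation `y = r - x`, which makes the total the integration variable.
        refine lintegral_congr fun x => ?_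
        rw [lintegral_gammaMeasure b (by fun_prop),
          ← lintegral_const_mul _ (by fun_prop),
          ← lintegral_sub_right_eq_self _ x]
        refine lintegral_congr fun r => ?_
        rw [show x + (r - x) = r by ring]
    _ = ∫⁻ r, ∫⁻ x, gammaPDF a 1 x * (gammaPDF b 1 (r - x) * f r (x / r)) := by
        refine lintegral_lintegral_swap (Measurable.aemeasurable ?_)
        fun_prop
    _ = ∫⁻ r, gammaPDF (a + b) 1 r * ∫⁻ u, f r u ∂betaMeasure a b := by
        refine lintegral_congr_ae ?_
        filter_upwards [h0] with r hr
        rcases lt_or_gt_of_ne hr with hneg | hpos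
        -- For `r < 0` one of `x` and `r - x` is negative, so both sides vanish.
        · rw [gammaPDF_of_neg hneg, zero_mul, lintegral_eq_zero_iff' (Measurable.aemeasurable ?_)]
          · refine ae_of_all _ fun x => ?_
            rcases lt_or_ge x 0 with hx | hx
            · simp [gammaPDF_of_neg hx]
            · simp [gammaPDF_of_neg (a := b) (r := 1) (show r - x < 0 by linarith)]
          · fun_prop
        · rw [lintegral_comp_mul_left hpos
              (by fun_prop),
            lintegral_betaMeasure a b (by fun_prop),
            ← lintegral_const_mul _ (by fun_prop),
            ← lintegral_const_mul _ (by fun_prop)]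
          refine lintegral_congr_ae ?_
          filter_upwards [h0, h1] with u hu0 hu1
          rw [mul_div_cancel_left₀ _ hr, ← mul_assoc (gammaPDF (a + b) 1 r),
            ← mul_gammaPDF_mul_gammaPDF ha hb hpos hu0 hu1]
          ring

/-! ### Logarithmic moments of the gamma law -/

/-- For `x > 0` the exponential is `x ^ t`, so power-biasing the gamma law with test function `1`
computes its integral. -/
theorem integrable_exp_mul_log_gammaMeasure {a t : ℝ} (ha : 0 < a) (hat : 0 < a + t) :
    Integrable (fun x => exp (t * log x)) (gammaMeasure a 1) ∧
      mgf log (gammaMeasure a 1) t = Real.Gamma (a + t) / Real.Gamma a := by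
  have := isProbabilityMeasure_gammaMeasure hat one_pos
  have h := lintegral_gammaMeasure_rpow_mul ha hat (f := fun _ => 1) measurable_const
  simp only [mul_one, lintegral_one, measure_univ] at h
  have h' : ∫⁻ x, ENNReal.ofReal (exp (t * log x)) ∂gammaMeasure a 1 =
      ENNReal.ofReal (Real.Gamma (a + t) / Real.Gamma a) := by
    rw [← h]
    refine lintegral_congr_ae ?_
    filter_upwards [ae_gammaMeasure_pos a] with x hx
    rw [rpow_def_of_pos hx, mul_comm]
  have hm : AEStronglyMeasurable (fun x => exp (t * log x)) (gammaMeasure a 1) :=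
    Measurable.aestronglyMeasurable (by fun_prop)
  refine ⟨(lintegral_ofReal_ne_top_iff_integrable hm (ae_of_all _ fun x => (exp_pos _).le)).1
    (by rw [h']; exact ENNReal.ofReal_ne_top), ?_⟩
  rw [mgf, integral_eq_lintegral_of_nonneg_ae (ae_of_all _ fun x => (exp_pos _).le) hm, h',
    ENNReal.toReal_ofReal (div_nonneg (Real.Gamma_pos_of_pos hat).le (Real.Gamma_pos_of_pos ha).le)]

theorem zero_mem_interior_integrableExpSet_log {a : ℝ} (ha : 0 < a) :
    0 ∈ interior (integrableExpSet log (gammaMeasure a 1)) := by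
  refine mem_interior.2 ⟨Set.Ioi (-a), fun t ht => ?_, isOpen_Ioi, by simpa using ha⟩
  exact (integrable_exp_mul_log_gammaMeasure ha (by simp at ht; linarith)).1

theorem memLp_log_gammaMeasure {a : ℝ} (ha : 0 < a) : MemLp log 2 (gammaMeasure a 1) :=
  memLp_of_mem_interior_integrableExpSet (zero_mem_interior_integrableExpSet_log ha) 2

theorem psi0_eq_deriv_log_Gamma {x : ℝ} (hx : 0 < x) :
    psi0 x = deriv (fun y => log (Real.Gamma y)) x := by
  rw [psi0, logDeriv_apply, deriv.log]
  · exact Real.differentiableAt_Gamma fun m => by have := m.cast_nonneg (α := ℝ); linarith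
  · exact (Real.Gamma_pos_of_pos hx).ne'

/-- The first two derivatives at `0` of this cumulant generating function are the mean and the
variance of `log x`; this is how `psi0` and `psi1` enter. -/
theorem cgf_log_gammaMeasure_eventuallyEq {a : ℝ} (ha : 0 < a) {s : ℝ} (hs : 0 < a + s) :
    cgf log (gammaMeasure a 1) =ᶠ[nhds s]
      fun t => log (Real.Gamma (a + t)) - log (Real.Gamma a) := by
  filter_upwards [lt_mem_nhds (show -a < s by linarith)] with t ht
  have hat : 0 < a + t := by linarith
  rw [cgf, (integrable_exp_mul_log_gammaMeasure ha hat).2,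
    log_div (Real.Gamma_pos_of_pos hat).ne' (Real.Gamma_pos_of_pos ha).ne']

theorem deriv_cgf_log_gammaMeasure {a : ℝ} (ha : 0 < a) {s : ℝ} (hs : 0 < a + s) :
    deriv (cgf log (gammaMeasure a 1)) s = psi0 (a + s) := by
  rw [(cgf_log_gammaMeasure_eventuallyEq ha hs).deriv_eq, deriv_sub_const,
    psi0_eq_deriv_log_Gamma hs, deriv_comp_const_add (fun y => log (Real.Gamma y)) a s]

/-- The mean of `log x` under `Gamma(a)`. -/
theorem integral_log_gammaMeasure {a : ℝ} (ha : 0 < a) :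
    ∫ x, log x ∂gammaMeasure a 1 = psi0 a := by
  have := isProbabilityMeasure_gammaMeasure ha one_pos
  have h := deriv_cgf_zero (zero_mem_interior_integrableExpSet_log ha)
  rw [deriv_cgf_log_gammaMeasure ha (by linarith)] at h
  simpa using h.symm

/-- The second moment of `log x` under `Gamma(a)`. -/
theorem integral_log_sq_gammaMeasure {a : ℝ} (ha : 0 < a) :
    ∫ x, log x ^ 2 ∂gammaMeasure a 1 = psi1 a + psi0 a ^ 2 := by
  have := isProbabilityMeasure_gammaMeasure ha one_pos
  have h := iteratedDeriv_two_cgf_eq_integral (zero_mem_interior_integrableExpSet_log ha)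
  have hev : deriv (cgf log (gammaMeasure a 1)) =ᶠ[nhds 0] fun t => psi0 (a + t) := by
    filter_upwards [lt_mem_nhds (show -a < 0 by linarith)] with t ht
    exact deriv_cgf_log_gammaMeasure ha (by linarith)
  have hL := memLp_log_gammaMeasure ha
  have hi := hL.integrable (by norm_num)
  rw [iteratedDeriv_succ, iteratedDeriv_one, hev.deriv_eq, deriv_comp_const_add psi0 a 0,
    deriv_cgf_log_gammaMeasure ha (by linarith), add_zero] at h
  have h2 : ∫ x, (log x - psi0 a) ^ 2 ∂gammaMeasure a 1 =
      ∫ x, log x ^ 2 ∂gammaMeasure a 1 - psi0 a ^ 2 := by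
    have e : ∀ x : ℝ, (log x - psi0 a) ^ 2 = log x ^ 2 - (2 * psi0 a * log x - psi0 a ^ 2) :=
      fun x => by ring
    simp_rw [e]
    rw [integral_sub hL.integrable_sq (by fun_prop),
      integral_sub (by fun_prop) (by fun_prop), integral_const_mul,
      integral_log_gammaMeasure ha]
    simp
    ring
  -- At `0` the exponential tilt in the formula for the second derivative is trivial.
  simp only [zero_mul, exp_zero, mul_one, mgf_zero, div_one] at h
  rw [h2] at h
  rw [psi1]
  linarith

/-- The functional equation of the digamma function. -/
theorem psi0_add_one {x : ℝ} (hx : 0 < x) : psi0 (x + 1) = psi0 x + 1 / x := by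
  rw [psi0_eq_deriv_log_Gamma hx, psi0_eq_deriv_log_Gamma (by linarith),
    ← deriv_comp_add_const (fun y => log (Real.Gamma y)) 1 x]
  have hev : (fun y => log (Real.Gamma (y + 1))) =ᶠ[nhds x]
      fun y => log (Real.Gamma y) + log y := by
    filter_upwards [lt_mem_nhds hx] with y hy
    rw [Real.Gamma_add_one hy.ne', log_mul hy.ne' (Real.Gamma_pos_of_pos hy).ne', add_comm]
  rw [hev.deriv_eq, deriv_fun_add, Real.deriv_log, one_div]
  · exact (Real.differentiableAt_Gamma fun m => by
      have := m.cast_nonneg (α := ℝ); linarith).log (Real.Gamma_pos_of_pos hx).ne'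
  · exact differentiableAt_log hx.ne'

/-! ### Dirichlet laws -/

@[fun_prop]
theorem measurable_insertNth {γ : Type*} [MeasurableSpace γ] {m : ℕ} (i : Fin (m + 1))
    {p : γ → ℝ} {q : γ → Fin m → ℝ} (hp : Measurable p) (hq : Measurable q) :
    Measurable fun z => (i.insertNth (p z) (q z) : Fin (m + 1) → ℝ) :=
  (MeasurableEquiv.piFinSuccAbove (fun _ => ℝ) i).symm.measurable.comp (hp.prodMk hq)

theorem measurable_normalize {m : ℕ} :
    Measurable fun (g : Fin m → ℝ) i => g i / ∑ j, g j := by fun_prop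

theorem lintegral_dirichlet {m : ℕ} (a : Fin m → ℝ) {f : (Fin m → ℝ) → ENNReal}
    (hf : Measurable f) :
    ∫⁻ p, f p ∂dirichlet a =
      ∫⁻ g, f (fun i => g i / ∑ j, g j) ∂Measure.pi fun i => gammaMeasure (a i) 1 := by
  rw [dirichlet, lintegral_map hf measurable_normalize]

theorem isProbabilityMeasure_dirichlet {m : ℕ} {a : Fin m → ℝ} (ha : ∀ i, 0 < a i) :
    IsProbabilityMeasure (dirichlet a) := by
  have := fun i => isProbabilityMeasure_gammaMeasure (ha i) one_pos
  exact Measure.isProbabilityMeasure_map measurable_normalize.aemeasurable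

instance sFinite_dirichlet {m : ℕ} (a : Fin m → ℝ) [∀ i, SigmaFinite (gammaMeasure (a i) 1)] :
    SFinite (dirichlet a) := by
  unfold dirichlet; infer_instance

theorem ae_pi_gammaMeasure_pos {m : ℕ} {a : Fin m → ℝ} (ha : ∀ i, 0 < a i) :
    ∀ᵐ g ∂Measure.pi fun i => gammaMeasure (a i) 1, ∀ i, 0 < g i := by
  have := fun i => isProbabilityMeasure_gammaMeasure (ha i) one_pos
  refine ae_all_iff.2 fun i => ?_
  exact (measurePreserving_eval (fun i => gammaMeasure (a i) 1) i).quasiMeasurePreserving.ae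
    (ae_gammaMeasure_pos (a i))

theorem ae_dirichlet {m : ℕ} {a : Fin m → ℝ} (ha : ∀ i, 0 < a i) :
    ∀ᵐ p ∂dirichlet a, ∀ i, 0 < p i := by
  have hs : MeasurableSet {p : Fin m → ℝ | ∀ i, 0 < p i} := by
    simp only [Set.ofPred_forall]
    exact MeasurableSet.iInter fun i => measurableSet_lt measurable_const (measurable_pi_apply i)
  rw [dirichlet, ae_map_iff measurable_normalize.aemeasurable hs]
  filter_upwards [ae_pi_gammaMeasure_pos ha] with g hg i
  exact div_pos (hg i) (Finset.sum_pos (fun j _ => hg j) ⟨i, Finset.mem_univ i⟩)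

theorem ae_dirichlet_sum {m : ℕ} {a : Fin (m + 1) → ℝ} (ha : ∀ i, 0 < a i) :
    ∀ᵐ p ∂dirichlet a, ∑ i, p i = 1 := by
  have hs : MeasurableSet {p : Fin (m + 1) → ℝ | ∑ i, p i = 1} :=
    measurableSet_eq_fun (by fun_prop) measurable_const
  rw [dirichlet, ae_map_iff measurable_normalize.aemeasurable hs]
  filter_upwards [ae_pi_gammaMeasure_pos ha] with g hg
  rw [← Finset.sum_div]
  exact div_self (Finset.sum_pos (fun j _ => hg j) Finset.univ_nonempty).ne'

/-- Independence of the total and of the proportions of independent gamma variables. -/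
def GammaSumIndep {m : ℕ} (a : Fin m → ℝ) : Prop :=
  ∀ f : ℝ → (Fin m → ℝ) → ENNReal, Measurable (Function.uncurry f) →
    ∫⁻ g, f (∑ i, g i) (fun i => g i / ∑ j, g j) ∂Measure.pi (fun i => gammaMeasure (a i) 1) =
      ∫⁻ r, ∫⁻ p, f r p ∂dirichlet a ∂gammaMeasure (∑ i, a i) 1

/-- With `u` the share of `x` in the total, `1 - u` is the share of the other entries, which keep
their relative proportions. -/
theorem insertNth_div_sum {m : ℕ} (i : Fin (m + 1)) {x : ℝ} (hx : 0 < x) {g : Fin m → ℝ}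
    (hs : 0 < ∑ j, g j) :
    (fun k => (i.insertNth x g : Fin (m + 1) → ℝ) k / (x + ∑ j, g j)) =
      i.insertNth (x / (x + ∑ j, g j))
        ((1 - x / (x + ∑ j, g j)) • fun k => g k / ∑ j, g j) := by
  have h := (add_pos hx hs).ne'
  funext k
  refine Fin.succAboveCases i ?_ (fun j => ?_) k
  · simp
  · simp only [Fin.insertNth_apply_succAbove, Pi.smul_apply, smul_eq_mul]
    field_simp
    ring

/-- By hypothesis the total of the other coordinates is independent of their proportions; the
two-variable gamma identity is then applied to coordinate `i` and that total. The test function sees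
both the total and the proportions, so independence and the stick-breaking formula come out
together. -/
theorem lintegral_gamma_pi_split {m : ℕ} {a : Fin (m + 2) → ℝ} (ha : ∀ i, 0 < a i)
    (i : Fin (m + 2)) (hi : GammaSumIndep fun j => a (i.succAbove j))
    {f : ℝ → (Fin (m + 2) → ℝ) → ENNReal} (hf : Measurable (Function.uncurry f)) :
    ∫⁻ g, f (∑ i, g i) (fun i => g i / ∑ j, g j) ∂Measure.pi (fun i => gammaMeasure (a i) 1) =
      ∫⁻ r, ∫⁻ u, ∫⁻ p, f r (i.insertNth u ((1 - u) • p)) ∂dirichlet (fun j => a (i.succAbove j))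
        ∂betaMeasure (a i) (∑ j, a (i.succAbove j)) ∂gammaMeasure (∑ i, a i) 1 := by
  have hP := fun i => isProbabilityMeasure_gammaMeasure (ha i) one_pos
  have hP' : IsProbabilityMeasure (dirichlet fun j => a (i.succAbove j)) :=
    isProbabilityMeasure_dirichlet fun j => ha _
  have hS : 0 < ∑ j, a (i.succAbove j) :=
    Finset.sum_pos (fun j _ => ha _) Finset.univ_nonempty
  have hmp := (measurePreserving_piFinSuccAbove (fun i => gammaMeasure (a i) 1) i).symm
  rw [← hmp.lintegral_comp (by fun_prop), lintegral_prod _ (by fun_prop), Fin.sum_univ_succAbove a i,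
    ← lintegral_gamma_gamma (ha i) hS]
  · refine lintegral_congr_ae ?_
    filter_upwards [ae_gammaMeasure_pos (a i)] with x hx
    rw [← hi _ (by fun_prop)]
    refine lintegral_congr_ae ?_
    filter_upwards [ae_pi_gammaMeasure_pos fun j => ha (i.succAbove j)] with g hg
    have hs : 0 < ∑ j, g j := Finset.sum_pos (fun j _ => hg j) Finset.univ_nonempty
    simp only [MeasurableEquiv.piFinSuccAbove_symm_apply, Fin.insertNthEquiv_apply]
    rw [Fin.sum_univ_succAbove _ i]
    simp only [Fin.insertNth_apply_same, Fin.insertNth_apply_succAbove]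
    rw [insertNth_div_sum i hx hs]
  · exact Measurable.lintegral_prod_right'
      (f := fun z : (ℝ × ℝ) × (Fin (m + 1) → ℝ) => f z.1.1 (i.insertNth z.1.2 ((1 - z.1.2) • z.2)))
      (by fun_prop)

/-- Independence of the total and the proportions passes to one more coordinate, together with the
stick-breaking representation. -/
theorem lintegral_dirichlet_split_of_indep {m : ℕ} {a : Fin (m + 2) → ℝ} (ha : ∀ i, 0 < a i)
    (i : Fin (m + 2)) (hi : GammaSumIndep fun j => a (i.succAbove j))
    {f : (Fin (m + 2) → ℝ) → ENNReal} (hf : Measurable f) :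
    ∫⁻ p, f p ∂dirichlet a =
      ∫⁻ u, ∫⁻ p, f (i.insertNth u ((1 - u) • p)) ∂dirichlet (fun j => a (i.succAbove j))
        ∂betaMeasure (a i) (∑ j, a (i.succAbove j)) := by
  have hS : 0 < ∑ i, a i := Finset.sum_pos (fun j _ => ha _) Finset.univ_nonempty
  have := isProbabilityMeasure_gammaMeasure hS one_pos
  rw [lintegral_dirichlet a hf, lintegral_gamma_pi_split ha i hi (f := fun _ p => f p) (by fun_prop)]
  simp

theorem dirichlet_one {a : Fin 1 → ℝ} (ha : ∀ i, 0 < a i) :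
    dirichlet a = Measure.dirac fun _ => 1 := by
  have hP := isProbabilityMeasure_dirichlet ha
  have h : (id : (Fin 1 → ℝ) → Fin 1 → ℝ) =ᵐ[dirichlet a] fun _ _ => 1 := by
    filter_upwards [ae_dirichlet_sum ha] with p hp
    funext i
    rw [Subsingleton.elim i 0]
    simpa using hp
  rw [← Measure.map_id (μ := dirichlet a), Measure.map_congr h, Measure.map_const]
  simp

theorem gammaSumIndep_one {a : Fin 1 → ℝ} (ha : ∀ i, 0 < a i) : GammaSumIndep a := by
  intro f hf
  have hP := fun i => isProbabilityMeasure_gammaMeasure (ha i) one_pos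
  have hmp := (measurePreserving_funUnique (gammaMeasure (a 0) 1) (Fin 1))
  have hfm : Measurable fun r : ℝ => f r fun _ => 1 := by fun_prop
  have h2 : ∀ r, ∫⁻ p, f r p ∂Measure.dirac (fun _ : Fin 1 => (1 : ℝ)) = f r fun _ => 1 :=
    fun r => lintegral_dirac' _ (by fun_prop)
  rw [show (fun i => gammaMeasure (a i) 1) = fun _ => gammaMeasure (a 0) 1 from
    funext fun i => by rw [Subsingleton.elim i 0]]
  simp only [dirichlet_one ha, Fin.sum_univ_one, h2]
  rw [← hmp.lintegral_comp hfm]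
  refine lintegral_congr_ae ?_
  filter_upwards [ae_pi_gammaMeasure_pos (a := fun _ : Fin 1 => a 0) fun _ => ha 0] with g hg
  simp only [MeasurableEquiv.funUnique_apply]
  congr 1
  funext i
  rw [Subsingleton.elim i 0]
  exact div_self (hg 0).ne'

/-- Induction on the number of coordinates: splitting off coordinate `0` leaves a stick and a
smaller Dirichlet vector, and the same splitting, applied to functions of the proportions alone,
identifies their joint law with `dirichlet a`. -/
theorem gammaSumIndep {m : ℕ} {a : Fin (m + 1) → ℝ} (ha : ∀ i, 0 < a i) : GammaSumIndep a := by
  induction m with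
  | zero => exact gammaSumIndep_one ha
  | succ m ih =>
    intro f hf
    have hP' := isProbabilityMeasure_dirichlet (a := fun j => a (Fin.succAbove 0 j)) fun j => ha _
    rw [lintegral_gamma_pi_split ha 0 (ih fun j => ha _) hf]
    refine lintegral_congr fun r => ?_
    rw [lintegral_dirichlet_split_of_indep ha 0 (ih fun j => ha _) (by fun_prop)]

/-- The stick-breaking representation of a Dirichlet vector, at an arbitrary coordinate. -/
theorem lintegral_dirichlet_split {m : ℕ} {a : Fin (m + 2) → ℝ} (ha : ∀ i, 0 < a i)
    (i : Fin (m + 2)) {f : (Fin (m + 2) → ℝ) → ENNReal} (hf : Measurable f) :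
    ∫⁻ p, f p ∂dirichlet a =
      ∫⁻ u, ∫⁻ p, f (i.insertNth u ((1 - u) • p)) ∂dirichlet (fun j => a (i.succAbove j))
        ∂betaMeasure (a i) (∑ j, a (i.succAbove j)) :=
  lintegral_dirichlet_split_of_indep ha i (gammaSumIndep fun _ => ha _) hf

theorem update_add_one_pos {m : ℕ} {a : Fin m → ℝ} (ha : ∀ i, 0 < a i) (i k : Fin m) :
    0 < Function.update a i (a i + 1) k := by
  rcases eq_or_ne k i with rfl | h
  · simpa using add_pos (ha k) one_pos
  · simpa [h] using ha k

/-- Biasing a Dirichlet law by a coordinate gives a Dirichlet law. -/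
theorem lintegral_dirichlet_coord_mul {m : ℕ} {a : Fin (m + 1) → ℝ} (ha : ∀ i, 0 < a i)
    (i : Fin (m + 1)) {f : (Fin (m + 1) → ℝ) → ENNReal} (hf : Measurable f) :
    ∫⁻ p, ENNReal.ofReal (p i) * f p ∂dirichlet a =
      ENNReal.ofReal (a i / ∑ j, a j) * ∫⁻ p, f p ∂dirichlet (Function.update a i (a i + 1)) := by
  have hS : 0 < ∑ i, a i := Finset.sum_pos (fun j _ => ha _) Finset.univ_nonempty
  have hP := fun i => isProbabilityMeasure_gammaMeasure (ha i) one_pos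
  have hPS := isProbabilityMeasure_gammaMeasure (add_pos hS one_pos) one_pos
  have hPi := isProbabilityMeasure_gammaMeasure (add_pos (ha i) one_pos) one_pos
  have hD := isProbabilityMeasure_dirichlet ha
  have hmp := (measurePreserving_piFinSuccAbove (fun i => gammaMeasure (a i) 1) i).symm
  have ha' : ∀ k, (Function.update a i (a i + 1)) k = i.insertNth (α := fun _ => ℝ) (a i + 1)
      (fun j => a (i.succAbove j)) k := fun k => by
    refine Fin.succAboveCases i ?_ (fun j => ?_) k <;> simp
  have hP2 : ∀ k, IsProbabilityMeasure (gammaMeasure ((Function.update a i (a i + 1)) k) 1) := fun k => by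
    exact isProbabilityMeasure_gammaMeasure (update_add_one_pos ha i k) one_pos
  have hmp' := (measurePreserving_piFinSuccAbove
    (fun k => gammaMeasure ((Function.update a i (a i + 1)) k) 1) i).symm
  -- The unnormalised weight `g i` only affects one gamma factor, whose parameter it raises by one.
  have h1 : ∫⁻ g, ENNReal.ofReal (g i) * f (fun i => g i / ∑ j, g j)
      ∂Measure.pi (fun i => gammaMeasure (a i) 1) =
      ENNReal.ofReal (a i) * ∫⁻ p, f p ∂dirichlet (Function.update a i (a i + 1)) := by
    rw [lintegral_dirichlet _ hf, ← hmp.lintegral_comp (by fun_prop),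
      ← hmp'.lintegral_comp (by fun_prop), lintegral_prod_symm _ (by fun_prop),
      lintegral_prod_symm _ (by fun_prop), ← lintegral_const_mul _
        (Measurable.lintegral_prod_left' (f := fun z => f fun k =>
          (MeasurableEquiv.piFinSuccAbove (fun _ => ℝ) i).symm z k /
            ∑ j, (MeasurableEquiv.piFinSuccAbove (fun _ => ℝ) i).symm z j) (by fun_prop))]
    simp only [MeasurableEquiv.piFinSuccAbove_symm_apply, Fin.insertNthEquiv_apply, ha',
      Fin.insertNth_apply_same, Fin.insertNth_apply_succAbove]
    refine lintegral_congr fun y => ?_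
    exact lintegral_gammaMeasure_mul (ha i) (by fun_prop)
  -- The same integral through `g i = S · p i`: the total `S` is independent of `p` and has mean `∑
  -- a`. Comparing with `h1` gives the quotient.
  have h2 : ∫⁻ g, ENNReal.ofReal (g i) * f (fun i => g i / ∑ j, g j)
      ∂Measure.pi (fun i => gammaMeasure (a i) 1) =
      ENNReal.ofReal (∑ j, a j) * ∫⁻ p, ENNReal.ofReal (p i) * f p ∂dirichlet a := by
    have h3 := gammaSumIndep ha (fun r p => ENNReal.ofReal r * (ENNReal.ofReal (p i) * f p))
      (by fun_prop)
    have h4 := lintegral_gammaMeasure_mul hS (f := fun _ => 1) measurable_const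
    simp only [mul_one, lintegral_one, measure_univ] at h4
    simp_rw [lintegral_const_mul _ (show Measurable fun p : Fin (m + 1) → ℝ =>
      ENNReal.ofReal (p i) * f p by fun_prop)] at h3
    rw [lintegral_mul_const _ (by fun_prop), h4] at h3
    rw [← h3]
    refine lintegral_congr_ae ?_
    filter_upwards [ae_pi_gammaMeasure_pos ha] with g hg
    have hs : 0 < ∑ j, g j := Finset.sum_pos (fun j _ => hg j) Finset.univ_nonempty
    rw [← mul_assoc, ← ENNReal.ofReal_mul hs.le, mul_div_cancel₀ _ hs.ne']
  rw [h1] at h2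
  have h0 : ENNReal.ofReal (∑ j, a j) ≠ 0 := by simpa using hS
  rw [div_eq_mul_inv, ENNReal.ofReal_mul (ha i).le, mul_right_comm, h2,
    ENNReal.ofReal_inv_of_pos hS, mul_comm, ← mul_assoc, ENNReal.inv_mul_cancel h0
      ENNReal.ofReal_ne_top, one_mul]

/-! ### Logarithmic moments and entropy of Dirichlet laws -/

theorem map_sum_normalize {m : ℕ} {a : Fin (m + 1) → ℝ} (ha : ∀ i, 0 < a i) :
    (Measure.pi fun i => gammaMeasure (a i) 1).map (fun g => (∑ i, g i, fun i => g i / ∑ j, g j)) =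
      (gammaMeasure (∑ i, a i) 1).prod (dirichlet a) := by
  have := isProbabilityMeasure_dirichlet ha
  refine Measure.ext_of_lintegral _ fun f hf => ?_
  rw [lintegral_map hf (by fun_prop), lintegral_prod _ hf.aemeasurable]
  exact gammaSumIndep ha (fun r p => f (r, p)) hf

theorem memLp_log_coord_pi {m : ℕ} {a : Fin m → ℝ} (ha : ∀ i, 0 < a i) (i : Fin m) :
    MemLp (fun g : Fin m → ℝ => log (g i)) 2 (Measure.pi fun i => gammaMeasure (a i) 1) := by
  have := fun i => isProbabilityMeasure_gammaMeasure (ha i) one_pos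
  exact (memLp_log_gammaMeasure (ha i)).comp_measurePreserving
    (measurePreserving_eval (fun i => gammaMeasure (a i) 1) i)

theorem measurePreserving_sum_pi {m : ℕ} {a : Fin (m + 1) → ℝ} (ha : ∀ i, 0 < a i) :
    MeasurePreserving (fun g : Fin (m + 1) → ℝ => ∑ i, g i)
      (Measure.pi fun i => gammaMeasure (a i) 1) (gammaMeasure (∑ i, a i) 1) := by
  have := isProbabilityMeasure_dirichlet ha
  refine ⟨by fun_prop, ?_⟩
  have h := congrArg Measure.fst (map_sum_normalize ha)
  rwa [Measure.fst_prod, Measure.fst, Measure.map_map measurable_fst (by fun_prop)] at h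

theorem memLp_log_dirichlet {m : ℕ} {a : Fin (m + 1) → ℝ} (ha : ∀ i, 0 < a i) (i : Fin (m + 1)) :
    MemLp (fun p : Fin (m + 1) → ℝ => log (p i)) 2 (dirichlet a) := by
  have hS : 0 < ∑ i, a i := Finset.sum_pos (fun j _ => ha _) Finset.univ_nonempty
  rw [dirichlet, memLp_map_measure_iff (Measurable.aestronglyMeasurable (by fun_prop))
    measurable_normalize.aemeasurable]
  refine MemLp.ae_eq ?_ ((memLp_log_coord_pi ha i).sub
    ((memLp_log_gammaMeasure hS).comp_measurePreserving (measurePreserving_sum_pi ha)))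
  filter_upwards [ae_pi_gammaMeasure_pos ha] with g hg
  have hs : 0 < ∑ j, g j := Finset.sum_pos (fun j _ => hg j) Finset.univ_nonempty
  simp [log_div (hg i).ne' hs.ne']

theorem integral_log_coord_pi {m : ℕ} {a : Fin m → ℝ} (ha : ∀ i, 0 < a i) (i : Fin m) :
    ∫ g, log (g i) ∂Measure.pi (fun i => gammaMeasure (a i) 1) = psi0 (a i) := by
  have := fun i => isProbabilityMeasure_gammaMeasure (ha i) one_pos
  have hmp := measurePreserving_eval (fun i => gammaMeasure (a i) 1) i
  rw [← integral_log_gammaMeasure (ha i), ← hmp.map_eq,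
    integral_map (measurable_pi_apply i).aemeasurable (Measurable.aestronglyMeasurable (by fun_prop))]

theorem integral_log_sq_coord_pi {m : ℕ} {a : Fin m → ℝ} (ha : ∀ i, 0 < a i) (i : Fin m) :
    ∫ g, log (g i) * log (g i) ∂Measure.pi (fun i => gammaMeasure (a i) 1) =
      psi1 (a i) + psi0 (a i) ^ 2 := by
  have := fun i => isProbabilityMeasure_gammaMeasure (ha i) one_pos
  have hmp := measurePreserving_eval (fun i => gammaMeasure (a i) 1) i
  rw [← integral_log_sq_gammaMeasure (ha i), ← hmp.map_eq,
    integral_map (measurable_pi_apply i).aemeasurable (Measurable.aestronglyMeasurable (by fun_prop))]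
  simp_rw [← pow_two]

theorem integral_log_mul_log_coord_pi {m : ℕ} {a : Fin m → ℝ} (ha : ∀ i, 0 < a i) {i k : Fin m}
    (hik : i ≠ k) :
    ∫ g, log (g i) * log (g k) ∂Measure.pi (fun i => gammaMeasure (a i) 1) =
      psi0 (a i) * psi0 (a k) := by
  have := fun i => isProbabilityMeasure_gammaMeasure (ha i) one_pos
  have hind : iIndepFun (fun i (g : Fin m → ℝ) => log (g i))
      (Measure.pi fun i => gammaMeasure (a i) 1) :=
    iIndepFun_pi (X := fun _ => log) fun i => measurable_log.aemeasurable
  rw [(hind.indepFun hik).integral_fun_mul_eq_mul_integral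
    (Measurable.aestronglyMeasurable (by fun_prop)) (Measurable.aestronglyMeasurable (by fun_prop)),
    integral_log_coord_pi ha, integral_log_coord_pi ha]

theorem integral_log_dirichlet {m : ℕ} {a : Fin (m + 1) → ℝ} (ha : ∀ i, 0 < a i)
    (i : Fin (m + 1)) :
    ∫ p, log (p i) ∂dirichlet a = psi0 (a i) - psi0 (∑ j, a j) := by
  have hS : 0 < ∑ i, a i := Finset.sum_pos (fun j _ => ha _) Finset.univ_nonempty
  have := fun i => isProbabilityMeasure_gammaMeasure (ha i) one_pos
  have hsum := measurePreserving_sum_pi ha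
  have hi : Integrable (fun g : Fin (m + 1) → ℝ => log (∑ j, g j))
      (Measure.pi fun i => gammaMeasure (a i) 1) :=
    ((memLp_log_gammaMeasure hS).comp_measurePreserving hsum).integrable (by norm_num)
  rw [← integral_log_coord_pi ha i, ← integral_log_gammaMeasure hS, ← hsum.map_eq,
    integral_map hsum.measurable.aemeasurable measurable_log.aestronglyMeasurable,
    ← integral_sub ((memLp_log_coord_pi ha i).integrable (by norm_num)) hi,
    dirichlet, integral_map measurable_normalize.aemeasurable
      (Measurable.aestronglyMeasurable (by fun_prop))]
  refine integral_congr_ae ?_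
  filter_upwards [ae_pi_gammaMeasure_pos ha] with g hg
  have hs : 0 < ∑ j, g j := Finset.sum_pos (fun j _ => hg j) Finset.univ_nonempty
  rw [log_div (hg i).ne' hs.ne']

/-- Expand `log g i = log S + log (p i)` with `S` the total, independent of `p`. The gamma side is
known, so the second moments of `log p` can be solved for. -/
theorem integral_log_mul_log_pi_eq {m : ℕ} {a : Fin (m + 1) → ℝ} (ha : ∀ i, 0 < a i)
    (i k : Fin (m + 1)) :
    ∫ g, log (g i) * log (g k) ∂Measure.pi (fun i => gammaMeasure (a i) 1) =
      ∫ p, log (p i) * log (p k) ∂dirichlet a +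
        psi0 (∑ j, a j) * (psi0 (a i) + psi0 (a k) - 2 * psi0 (∑ j, a j)) +
        (psi1 (∑ j, a j) + psi0 (∑ j, a j) ^ 2) := by
  have hS : 0 < ∑ i, a i := Finset.sum_pos (fun j _ => ha _) Finset.univ_nonempty
  have hD := isProbabilityMeasure_dirichlet ha
  have hG := isProbabilityMeasure_gammaMeasure hS one_pos
  have hp := memLp_log_dirichlet ha
  have hs := memLp_log_gammaMeasure hS
  have i1 : Integrable (fun z : ℝ × (Fin (m + 1) → ℝ) => log (z.2 i) * log (z.2 k))
      ((gammaMeasure (∑ i, a i) 1).prod (dirichlet a)) :=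
    ((hp i).integrable_mul (hp k)).comp_snd _
  have i2 : Integrable (fun z : ℝ × (Fin (m + 1) → ℝ) => log z.1 * (log (z.2 i) + log (z.2 k)))
      ((gammaMeasure (∑ i, a i) 1).prod (dirichlet a)) :=
    (hs.integrable (by norm_num)).mul_prod
      (((hp i).integrable (by norm_num)).add ((hp k).integrable (by norm_num)))
  have i3 : Integrable (fun z : ℝ × (Fin (m + 1) → ℝ) => log z.1 ^ 2)
      ((gammaMeasure (∑ i, a i) 1).prod (dirichlet a)) := hs.integrable_sq.comp_fst _
  have e : ∫ g, log (g i) * log (g k) ∂Measure.pi (fun i => gammaMeasure (a i) 1) =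
      ∫ z, (log (z.2 i) * log (z.2 k) + log z.1 * (log (z.2 i) + log (z.2 k)) + log z.1 ^ 2)
        ∂(gammaMeasure (∑ i, a i) 1).prod (dirichlet a) := by
    rw [← map_sum_normalize ha, integral_map (Measurable.aemeasurable (by fun_prop))
      (Measurable.aestronglyMeasurable (by fun_prop))]
    refine integral_congr_ae ?_
    filter_upwards [ae_pi_gammaMeasure_pos ha] with g hg
    have hs : 0 < ∑ j, g j := Finset.sum_pos (fun j _ => hg j) Finset.univ_nonempty
    rw [log_div (hg i).ne' hs.ne', log_div (hg k).ne' hs.ne']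
    ring
  rw [e, integral_add (by fun_prop) i3, integral_add i1 i2,
    integral_fun_snd (fun p : Fin (m + 1) → ℝ => log (p i) * log (p k)),
    integral_fun_fst (fun r => log r ^ 2),
    integral_prod_mul (f := log) (g := fun p : Fin (m + 1) → ℝ => log (p i) + log (p k)),
    integral_add ((hp i).integrable (by norm_num)) ((hp k).integrable (by norm_num)),
    integral_log_dirichlet ha, integral_log_dirichlet ha, integral_log_gammaMeasure hS,
    integral_log_sq_gammaMeasure hS]
  simp only [measureReal_def, measure_univ, ENNReal.toReal_one, one_smul]
  ring

theorem integral_log_mul_log_dirichlet {m : ℕ} {a : Fin (m + 1) → ℝ} (ha : ∀ i, 0 < a i)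
    {i k : Fin (m + 1)} (hik : i ≠ k) :
    ∫ p, log (p i) * log (p k) ∂dirichlet a =
      (psi0 (a i) - psi0 (∑ j, a j)) * (psi0 (a k) - psi0 (∑ j, a j)) - psi1 (∑ j, a j) := by
  have h := integral_log_mul_log_pi_eq ha i k
  rw [integral_log_mul_log_coord_pi ha hik] at h
  linarith

theorem integral_log_sq_dirichlet {m : ℕ} {a : Fin (m + 1) → ℝ} (ha : ∀ i, 0 < a i)
    (i : Fin (m + 1)) :
    ∫ p, log (p i) * log (p i) ∂dirichlet a =
      (psi0 (a i) - psi0 (∑ j, a j)) ^ 2 + psi1 (a i) - psi1 (∑ j, a j) := by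
  have h := integral_log_mul_log_pi_eq ha i i
  rw [integral_log_sq_coord_pi ha] at h
  linarith

/-- No integrability is needed: the biasing is an equality of measures, so it passes to Bochner
integrals of any `f`. -/
theorem integral_dirichlet_coord_mul {m : ℕ} {a : Fin (m + 1) → ℝ} (ha : ∀ i, 0 < a i)
    (i : Fin (m + 1)) (f : (Fin (m + 1) → ℝ) → ℝ) :
    ∫ p, p i * f p ∂dirichlet a =
      a i / (∑ j, a j) * ∫ p, f p ∂dirichlet (Function.update a i (a i + 1)) := by
  have hS : 0 < ∑ i, a i := Finset.sum_pos (fun j _ => ha _) Finset.univ_nonempty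
  have h : (dirichlet a).withDensity (fun p => ENNReal.ofReal (p i)) =
      ENNReal.ofReal (a i / ∑ j, a j) • dirichlet (Function.update a i (a i + 1)) := by
    refine Measure.ext_of_lintegral _ fun f hf => ?_
    rw [lintegral_withDensity_eq_lintegral_mul _ (by fun_prop) hf, lintegral_smul_measure,
      smul_eq_mul, ← lintegral_dirichlet_coord_mul ha i hf]
    rfl
  have h2 := integral_withDensity_eq_integral_toReal_smul (μ := dirichlet a)
    (f := fun p => ENNReal.ofReal (p i)) (by fun_prop) (ae_of_all _ fun p => ENNReal.ofReal_lt_top) f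
  rw [h, integral_smul_measure, ENNReal.toReal_ofReal (div_nonneg (ha i).le hS.le), smul_eq_mul] at h2
  rw [h2]
  refine integral_congr_ae ?_
  filter_upwards [ae_dirichlet ha] with p hp
  rw [ENNReal.toReal_ofReal (hp i).le, smul_eq_mul]

theorem sum_update_add_one {m : ℕ} (a : Fin m → ℝ) (i : Fin m) :
    ∑ j, Function.update a i (a i + 1) j = ∑ j, a j + 1 := by
  rw [Finset.sum_update_of_mem (Finset.mem_univ i), Finset.sdiff_singleton_eq_erase,
    ← Finset.add_sum_erase _ a (Finset.mem_univ i)]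
  ring

/-- Two successive biasings; the second sees the total already raised by one, whence `(S + 1) S`. -/
theorem integral_dirichlet_mul_mul {m : ℕ} {a : Fin (m + 1) → ℝ} (ha : ∀ i, 0 < a i)
    {i k : Fin (m + 1)} (hik : i ≠ k) (f : (Fin (m + 1) → ℝ) → ℝ) :
    ∫ p, p i * (p k * f p) ∂dirichlet a =
      a i * a k / ((∑ j, a j + 1) * ∑ j, a j) * ∫ p, f p ∂dirichlet
        (Function.update (Function.update a i (a i + 1)) k (a k + 1)) := by
  have hS : 0 < ∑ i, a i := Finset.sum_pos (fun j _ => ha _) Finset.univ_nonempty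
  rw [integral_dirichlet_coord_mul ha, integral_dirichlet_coord_mul (update_add_one_pos ha i),
    sum_update_add_one, Function.update_of_ne hik.symm]
  field_simp

theorem integral_dirichlet_sq_mul {m : ℕ} {a : Fin (m + 1) → ℝ} (ha : ∀ i, 0 < a i)
    (i : Fin (m + 1)) (f : (Fin (m + 1) → ℝ) → ℝ) :
    ∫ p, p i * (p i * f p) ∂dirichlet a =
      (a i + 1) * a i / ((∑ j, a j + 1) * ∑ j, a j) * ∫ p, f p ∂dirichlet
        (Function.update a i (a i + 2)) := by
  have hS : 0 < ∑ i, a i := Finset.sum_pos (fun j _ => ha _) Finset.univ_nonempty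
  rw [integral_dirichlet_coord_mul ha, integral_dirichlet_coord_mul (update_add_one_pos ha i),
    sum_update_add_one, Function.update_self, Function.update_idem,
    show a i + 1 + 1 = a i + 2 by ring]
  field_simp

theorem update_add_two_pos {m : ℕ} {a : Fin m → ℝ} (ha : ∀ i, 0 < a i) (i k : Fin m) :
    0 < Function.update a i (a i + 2) k := by
  rcases eq_or_ne k i with rfl | h
  · simpa using add_pos (ha k) two_pos
  · simpa [h] using ha k

theorem sum_update_add_two {m : ℕ} (a : Fin m → ℝ) (i : Fin m) :
    ∑ j, Function.update a i (a i + 2) j = ∑ j, a j + 2 := by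
  rw [Finset.sum_update_of_mem (Finset.mem_univ i), Finset.sdiff_singleton_eq_erase,
    ← Finset.add_sum_erase _ a (Finset.mem_univ i)]
  ring

theorem integral_mul_log_dirichlet {m : ℕ} {a : Fin (m + 1) → ℝ} (ha : ∀ i, 0 < a i)
    (i : Fin (m + 1)) :
    ∫ p, p i * log (p i) ∂dirichlet a =
      a i / (∑ j, a j) * (psi0 (a i + 1) - psi0 (∑ j, a j + 1)) := by
  rw [integral_dirichlet_coord_mul ha i (fun p => log (p i)),
    integral_log_dirichlet (update_add_one_pos ha i), sum_update_add_one, Function.update_self]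

theorem integral_mul_mul_log_dirichlet {m : ℕ} {a : Fin (m + 1) → ℝ} (ha : ∀ i, 0 < a i)
    {i k : Fin (m + 1)} (hik : i ≠ k) :
    ∫ p, p i * (p k * log (p k)) ∂dirichlet a =
      a i * a k / ((∑ j, a j + 1) * ∑ j, a j) * (psi0 (a k + 1) - psi0 (∑ j, a j + 2)) := by
  have hu := update_add_one_pos (update_add_one_pos ha i) k
  have hs := sum_update_add_one (Function.update a i (a i + 1)) k
  rw [Function.update_of_ne hik.symm] at hu hs
  rw [integral_dirichlet_mul_mul ha hik (fun p => log (p k)), integral_log_dirichlet hu, hs,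
    sum_update_add_one, Function.update_self, add_assoc, one_add_one_eq_two]

theorem integral_sq_mul_log_dirichlet {m : ℕ} {a : Fin (m + 1) → ℝ} (ha : ∀ i, 0 < a i)
    (i : Fin (m + 1)) :
    ∫ p, p i * (p i * log (p i)) ∂dirichlet a =
      (a i + 1) * a i / ((∑ j, a j + 1) * ∑ j, a j) *
        (psi0 (a i + 2) - psi0 (∑ j, a j + 2)) := by
  rw [integral_dirichlet_sq_mul ha i (fun p => log (p i)),
    integral_log_dirichlet (update_add_two_pos ha i), sum_update_add_two, Function.update_self]

theorem integral_mul_log_mul_mul_log_dirichlet {m : ℕ} {a : Fin (m + 1) → ℝ} (ha : ∀ i, 0 < a i)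
    {i k : Fin (m + 1)} (hik : i ≠ k) :
    ∫ p, p i * (p k * (log (p i) * log (p k))) ∂dirichlet a =
      a i * a k / ((∑ j, a j + 1) * ∑ j, a j) *
        ((psi0 (a k + 1) - psi0 (∑ j, a j + 2)) * (psi0 (a i + 1) - psi0 (∑ j, a j + 2)) -
          psi1 (∑ j, a j + 2)) := by
  have hu := update_add_one_pos (update_add_one_pos ha i) k
  have hs := sum_update_add_one (Function.update a i (a i + 1)) k
  rw [Function.update_of_ne hik.symm] at hu hs
  rw [integral_dirichlet_mul_mul ha hik (fun p => log (p i) * log (p k)),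
    integral_log_mul_log_dirichlet hu hik, hs,
    sum_update_add_one, Function.update_self, Function.update_of_ne hik, Function.update_self,
    add_assoc, one_add_one_eq_two]
  ring

theorem integral_mul_log_sq_dirichlet {m : ℕ} {a : Fin (m + 1) → ℝ} (ha : ∀ i, 0 < a i)
    (i : Fin (m + 1)) :
    ∫ p, p i * (log (p i) * log (p i)) ∂dirichlet a =
      a i / (∑ j, a j) * ((psi0 (a i + 1) - psi0 (∑ j, a j + 1)) ^ 2 + psi1 (a i + 1) -
          psi1 (∑ j, a j + 1)) := by
  rw [integral_dirichlet_coord_mul ha i (fun p => log (p i) * log (p i)),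
    integral_log_sq_dirichlet (update_add_one_pos ha i), sum_update_add_one, Function.update_self]

theorem integral_sq_mul_log_sq_dirichlet {m : ℕ} {a : Fin (m + 1) → ℝ} (ha : ∀ i, 0 < a i)
    (i : Fin (m + 1)) :
    ∫ p, p i * (p i * (log (p i) * log (p i))) ∂dirichlet a =
      (a i + 1) * a i / ((∑ j, a j + 1) * ∑ j, a j) *
        ((psi0 (a i + 2) - psi0 (∑ j, a j + 2)) ^ 2 + psi1 (a i + 2) - psi1 (∑ j, a j + 2)) := by
  rw [integral_dirichlet_sq_mul ha i (fun p => log (p i) * log (p i)),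
    integral_log_sq_dirichlet (update_add_two_pos ha i), sum_update_add_two, Function.update_self]

theorem negMulLog_mem_Icc {x : ℝ} (h0 : 0 ≤ x) (h1 : x ≤ 1) :
    0 ≤ negMulLog x ∧ negMulLog x ≤ 1 :=
  ⟨negMulLog_nonneg h0 h1, (negMulLog_le_one_sub_self h0).trans (by linarith)⟩

theorem ae_dirichlet_mem_Icc {m : ℕ} {a : Fin (m + 1) → ℝ} (ha : ∀ i, 0 < a i) :
    ∀ᵐ p ∂dirichlet a, ∀ i, 0 < p i ∧ p i ≤ 1 := by
  filter_upwards [ae_dirichlet ha, ae_dirichlet_sum ha] with p hp hs i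
  refine ⟨hp i, hs ▸ ?_⟩
  exact Finset.single_le_sum (f := p) (fun j _ => (hp j).le) (Finset.mem_univ i)

theorem memLp_negMulLog_dirichlet {m : ℕ} {a : Fin (m + 1) → ℝ} (ha : ∀ i, 0 < a i)
    (i : Fin (m + 1)) : MemLp (fun p : Fin (m + 1) → ℝ => negMulLog (p i)) 2 (dirichlet a) := by
  have := isProbabilityMeasure_dirichlet ha
  refine MemLp.of_bound (Measurable.aestronglyMeasurable (by fun_prop)) 1 ?_
  filter_upwards [ae_dirichlet_mem_Icc ha] with p hp
  have h := negMulLog_mem_Icc (hp i).1.le (hp i).2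
  rw [norm_eq_abs, abs_of_nonneg h.1]
  exact h.2

theorem memLp_entropy_dirichlet {m : ℕ} {a : Fin (m + 1) → ℝ} (ha : ∀ i, 0 < a i) :
    MemLp (fun p : Fin (m + 1) → ℝ => entropy p) 2 (dirichlet a) := by
  simp only [entropy, tsum_fintype]
  exact memLp_finsetSum _ fun i _ => memLp_negMulLog_dirichlet ha i

/-- The mean of the entropy of a Dirichlet vector. -/
theorem integral_entropy_dirichlet {m : ℕ} {a : Fin (m + 1) → ℝ} (ha : ∀ i, 0 < a i) :
    ∫ p, entropy p ∂dirichlet a = dirichletEntropyMean a := by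
  have := isProbabilityMeasure_dirichlet ha
  have hS : 0 < ∑ i, a i := Finset.sum_pos (fun j _ => ha _) Finset.univ_nonempty
  simp only [entropy, tsum_fintype]
  rw [integral_finsetSum _ fun i _ => (memLp_negMulLog_dirichlet ha i).integrable (by norm_num)]
  simp only [negMulLog_eq_neg, integral_neg, integral_mul_log_dirichlet ha]
  -- The terms with the total collect with weight `∑ aᵢ / S = 1`.
  simp only [mul_sub, neg_sub, Finset.sum_sub_distrib, ← Finset.sum_mul, ← Finset.sum_div]
  rw [div_self hS.ne', one_mul, dirichletEntropyMean]

/-- The second moment of the entropy of a Dirichlet vector. -/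
theorem integral_entropy_sq_dirichlet {m : ℕ} {a : Fin (m + 1) → ℝ} (ha : ∀ i, 0 < a i) :
    ∫ p, entropy p ^ 2 ∂dirichlet a = dirichletEntropySecondMoment a := by
  have hi : ∀ i k, Integrable (fun p : Fin (m + 1) → ℝ => negMulLog (p i) * negMulLog (p k))
      (dirichlet a) := fun i k =>
    (memLp_negMulLog_dirichlet ha i).integrable_mul (memLp_negMulLog_dirichlet ha k)
  simp only [entropy, tsum_fintype, pow_two, Finset.sum_mul_sum]
  rw [integral_finsetSum _ fun i _ => integrable_finsetSum _ fun k _ => hi i k,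
    dirichletEntropySecondMoment, dirichletEntropySecondMomentAux, ← Finset.sum_add_distrib]
  refine Finset.sum_congr rfl fun i _ => ?_
  rw [integral_finsetSum _ fun k _ => hi i k, ← Finset.sum_erase_add _ _ (Finset.mem_univ i)]
  congr 1
  · refine Finset.sum_congr rfl fun k hk => ?_
    rw [← integral_mul_log_mul_mul_log_dirichlet ha (Finset.ne_of_mem_erase hk).symm]
    simp only [negMulLog]
    congr 1
    funext p
    ring
  · rw [← integral_sq_mul_log_sq_dirichlet ha i]
    simp only [negMulLog]
    congr 1
    funext p
    ring

/-! ### Beta laws as Dirichlet laws -/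

/-- Splitting at coordinate `0` leaves a one-point Dirichlet law. Beta integrals thereby become
cases of the Dirichlet formulas, with `1 - u` as second coordinate. -/
theorem map_dirichlet_two {a b : ℝ} (ha : 0 < a) (hb : 0 < b) :
    (dirichlet ![a, b]).map (fun p => p 0) = betaMeasure a b := by
  have hab : ∀ i, 0 < ![a, b] i := by
    intro i; fin_cases i <;> simp [ha, hb]
  refine Measure.ext_of_lintegral _ fun f hf => ?_
  rw [lintegral_map hf (by fun_prop), lintegral_dirichlet_split hab 0 (by fun_prop)]
  have h1 : ∀ i : Fin 1, 0 < (fun j => ![a, b] (Fin.succAbove 0 j)) i := fun i => hab _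
  have := isProbabilityMeasure_dirichlet h1
  simp only [Fin.insertNth_apply_same, lintegral_const, measure_univ, mul_one]
  simp

theorem integral_betaMeasure {a b : ℝ} (ha : 0 < a) (hb : 0 < b) {f : ℝ → ℝ} (hf : Measurable f) :
    ∫ u, f u ∂betaMeasure a b = ∫ p, f (p 0) ∂dirichlet ![a, b] := by
  rw [← map_dirichlet_two ha hb, integral_map (Measurable.aemeasurable (by fun_prop))
    hf.aestronglyMeasurable]

/-! ### The Pitman–Yor law: stick-breaking recursion -/

/-- The sequence with first term `v` and remaining terms `(1 - v) w`. -/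
def stickCons (v : ℝ) (w : ℕ → ℝ) : ℕ → ℝ := fun i => Nat.casesOn i v fun j => (1 - v) * w j

@[simp]
theorem stickCons_zero (v : ℝ) (w : ℕ → ℝ) : stickCons v w 0 = v := rfl

@[simp]
theorem stickCons_succ (v : ℝ) (w : ℕ → ℝ) (i : ℕ) : stickCons v w (i + 1) = (1 - v) * w i := rfl

@[fun_prop]
theorem measurable_stickCons {γ : Type*} [MeasurableSpace γ] {p : γ → ℝ} {q : γ → ℕ → ℝ}
    (hp : Measurable p) (hq : Measurable q) : Measurable fun z => stickCons (p z) (q z) := by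
  refine measurable_pi_iff.2 fun i => ?_
  cases i with
  | zero => simpa using hp
  | succ i => simp only [stickCons_succ]; fun_prop

theorem stickBreaking_cons (v : ℕ → ℝ) :
    stickBreaking v = stickCons (v 0) (stickBreaking fun i => v (i + 1)) := by
  funext i
  cases i with
  | zero => simp [stickBreaking]
  | succ i =>
    rw [stickCons_succ, stickBreaking, stickBreaking, Finset.prod_range_succ']
    ring

/-- Infinite product measures are determined by finite boxes, and on these the first factor splits
off. -/
theorem lintegral_infinitePi_nat (μ : ℕ → Measure ℝ) [∀ i, IsProbabilityMeasure (μ i)]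
    {f : (ℕ → ℝ) → ENNReal} (hf : Measurable f) :
    ∫⁻ x, f x ∂Measure.infinitePi μ =
      ∫⁻ v, ∫⁻ y, f (fun i => Nat.casesOn i v y) ∂Measure.infinitePi (fun i => μ (i + 1)) ∂μ 0 := by
  have hm : Measurable fun (z : ℝ × (ℕ → ℝ)) (i : ℕ) => (Nat.casesOn i z.1 z.2 : ℝ) := by
    refine measurable_pi_iff.2 fun i => ?_
    cases i with
    | zero => exact measurable_fst
    | succ i => exact (measurable_pi_apply i).comp measurable_snd
  have h : ((μ 0).prod (Measure.infinitePi fun i => μ (i + 1))).map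
      (fun (z : ℝ × (ℕ → ℝ)) (i : ℕ) => (Nat.casesOn i z.1 z.2 : ℝ)) = Measure.infinitePi μ := by
    refine Measure.eq_infinitePi μ fun s t ht => ?_
    classical
    obtain ⟨n, hn⟩ := s.exists_nat_subset_range
    have hn' : s ⊆ Finset.range (n + 1) := hn.trans (Finset.range_mono n.le_succ)
    -- A box over an arbitrary finite set is padded with `univ` to a box over an initial segment,
    -- which contains the index `0`.
    set t' : ℕ → Set ℝ := fun i => if i ∈ s then t i else Set.univ with ht'
    have ht'm : ∀ i, MeasurableSet (t' i) := fun i => by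
      by_cases hi : i ∈ s <;> simp [ht', hi, ht]
    have hpi : (s : Set ℕ).pi t = (Finset.range (n + 1) : Set ℕ).pi t' := by
      ext x
      simp only [Set.mem_pi, Finset.mem_coe, ht']
      constructor
      · intro h i _
        by_cases hi : i ∈ s
        · simpa [hi] using h i hi
        · simp [hi]
      · intro h i hi
        simpa [hi] using h i (hn' hi)
    have hprod : ∏ i ∈ s, μ i (t i) = ∏ i ∈ Finset.range (n + 1), μ i (t' i) := by
      rw [← Finset.prod_subset hn' (fun i _ hi => by simp [ht', hi])]
      exact Finset.prod_congr rfl fun i hi => by simp [ht', hi]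
    have hpre : (fun (z : ℝ × (ℕ → ℝ)) (i : ℕ) => (Nat.casesOn i z.1 z.2 : ℝ)) ⁻¹'
        ((Finset.range (n + 1) : Set ℕ).pi t') =
        t' 0 ×ˢ (Finset.range n : Set ℕ).pi (fun i => t' (i + 1)) := by
      ext z
      simp only [Set.mem_preimage, Set.mem_pi, Finset.mem_coe, Finset.mem_range, Set.mem_prod]
      constructor
      · intro h
        exact ⟨h 0 (by omega), fun i hi => h (i + 1) (by omega)⟩
      · rintro ⟨h0, h1⟩ i hi
        cases i with
        | zero => exact h0
        | succ i => exact h1 i (by omega)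
    rw [hpi, hprod, Measure.map_apply hm (MeasurableSet.pi (Finset.countable_toSet _)
      fun i _ => ht'm i), hpre, Measure.prod_prod,
      Measure.infinitePi_pi _ (fun i _ => ht'm _), Finset.prod_range_succ', mul_comm]
  rw [← h, lintegral_map hf hm]
  exact lintegral_prod _ (hf.comp hm).aemeasurable

theorem isProbabilityMeasure_beta_stick {d α : ℝ} (hd0 : 0 ≤ d) (hd1 : d < 1) (hα : -d < α)
    (i : ℕ) : IsProbabilityMeasure (betaMeasure (1 - d) (α + ((i : ℝ) + 1) * d)) := by
  have : 0 ≤ (i : ℝ) * d := by positivity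
  exact isProbabilityMeasureBeta (by linarith) (by linarith)

theorem isProbabilityMeasure_pitmanYor {d α : ℝ} (hd0 : 0 ≤ d) (hd1 : d < 1) (hα : -d < α) :
    IsProbabilityMeasure (pitmanYor d α) := by
  have := isProbabilityMeasure_beta_stick hd0 hd1 hα
  exact Measure.isProbabilityMeasure_map measurable_stickBreaking.aemeasurable

/-- The stick-breaking recursion of the Pitman–Yor law. -/
theorem lintegral_pitmanYor {d α : ℝ} (hd0 : 0 ≤ d) (hd1 : d < 1) (hα : -d < α)
    {f : (ℕ → ℝ) → ENNReal} (hf : Measurable f) :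
    ∫⁻ w, f w ∂pitmanYor d α =
      ∫⁻ v, ∫⁻ w, f (stickCons v w) ∂pitmanYor d (α + d) ∂betaMeasure (1 - d) (α + d) := by
  have hm := measurable_stickBreaking
  have := isProbabilityMeasure_beta_stick hd0 hd1 hα
  rw [pitmanYor, lintegral_map hf hm, lintegral_infinitePi_nat _ (by fun_prop)]
  simp only [stickBreaking_cons (fun i => Nat.casesOn i _ _), Nat.cast_zero, zero_add, one_mul]
  refine lintegral_congr fun v => ?_
  rw [pitmanYor, lintegral_map (by fun_prop) hm]
  -- The stick of index `i + 1` has second parameter `α + (i + 2) d = (α + d) + (i + 1) d`.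
  congr 3
  funext i
  push_cast
  ring_nf

theorem stickBreaking_pos {v : ℕ → ℝ} (hv : ∀ i, 0 < v i ∧ v i < 1) (i : ℕ) :
    0 < stickBreaking v i :=
  mul_pos (hv i).1 (Finset.prod_pos fun j _ => by linarith [(hv j).2])

theorem sum_range_stickBreaking (v : ℕ → ℝ) (n : ℕ) :
    ∑ i ∈ Finset.range n, stickBreaking v i = 1 - ∏ j ∈ Finset.range n, (1 - v j) := by
  induction n with
  | zero => simp
  | succ n ih => rw [Finset.sum_range_succ, ih, Finset.prod_range_succ, stickBreaking]; ring

/-- The partial sums are `1 - ∏ (1 - vⱼ)`. Only `≤ 1` is obtained here; that no mass is lost follows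
from size-biased sampling, in `ae_pitmanYor`. -/
theorem ae_pitmanYor_pos_le {d α : ℝ} (hd0 : 0 ≤ d) (hd1 : d < 1) (hα : -d < α) :
    ∀ᵐ w ∂pitmanYor d α, (∀ i, 0 < w i) ∧ ∑' i, ENNReal.ofReal (w i) ≤ 1 := by
  have hP := isProbabilityMeasure_beta_stick hd0 hd1 hα
  have hs : MeasurableSet {w : ℕ → ℝ | (∀ i, 0 < w i) ∧ ∑' i, ENNReal.ofReal (w i) ≤ 1} := by
    have h : MeasurableSet {w : ℕ → ℝ | ∀ i, 0 < w i} := by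
      simp only [Set.ofPred_forall]
      exact MeasurableSet.iInter fun i => measurableSet_lt measurable_const (measurable_pi_apply i)
    have h2 : MeasurableSet {w : ℕ → ℝ | ∑' i, ENNReal.ofReal (w i) ≤ 1} :=
      measurableSet_le (Measurable.tsum fun i => by fun_prop) measurable_const
    exact h.inter h2
  rw [pitmanYor, ae_map_iff measurable_stickBreaking.aemeasurable hs]
  have hv : ∀ᵐ v ∂Measure.infinitePi fun i : ℕ => betaMeasure (1 - d) (α + ((i : ℝ) + 1) * d),
      ∀ i, 0 < v i ∧ v i < 1 := by
    refine ae_all_iff.2 fun i => ?_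
    exact (measurePreserving_eval_infinitePi
      (fun i : ℕ => betaMeasure (1 - d) (α + ((i : ℝ) + 1) * d)) i).quasiMeasurePreserving.ae
      (ae_betaMeasure_mem _ _)
  filter_upwards [hv] with v hv
  refine ⟨stickBreaking_pos hv, ENNReal.tsum_le_of_sum_range_le fun n => ?_⟩
  rw [← ENNReal.ofReal_sum_of_nonneg fun i _ => (stickBreaking_pos hv i).le,
    sum_range_stickBreaking]
  have : 0 ≤ ∏ j ∈ Finset.range n, (1 - v j) :=
    Finset.prod_nonneg fun j _ => by linarith [(hv j).2]
  exact ENNReal.ofReal_le_one.2 (by linarith)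

/-! ### Size-biased sampling from the Pitman–Yor law -/

theorem lintegral_dirichlet_two {a : Fin 2 → ℝ} (ha : ∀ i, 0 < a i) {f : (Fin 2 → ℝ) → ENNReal}
    (hf : Measurable f) :
    ∫⁻ p, f p ∂dirichlet a = ∫⁻ u, f ![u, 1 - u] ∂betaMeasure (a 0) (a 1) := by
  have h1 : ∀ i : Fin 1, 0 < (fun j => a (Fin.succAbove 0 j)) i := fun i => ha _
  rw [lintegral_dirichlet_split ha 0 hf]
  have hm : ∀ u : ℝ, Measurable fun p : Fin 1 → ℝ => f (Fin.insertNth 0 u ((1 - u) • p)) :=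
    fun u => by fun_prop
  simp only [dirichlet_one h1, lintegral_dirac' _ (hm _)]
  have hv : ∀ u : ℝ, (Fin.insertNth 0 u ((1 - u) • fun _ => 1) : Fin 2 → ℝ) = ![u, 1 - u] := by
    intro u
    funext i
    fin_cases i <;> simp
  simp only [hv]
  simp

/-- The first two sticks of `PY(d, α)`, biased by `1 - w₀`, are exchangeable. -/
theorem lintegral_beta_beta_swap {d α : ℝ} (hd0 : 0 ≤ d) (hd1 : d < 1) (hα : -d < α)
    {Φ : ℝ → ℝ → ℝ → ENNReal} (hΦ : Measurable fun z : ℝ × ℝ × ℝ => Φ z.1 z.2.1 z.2.2) :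
    ∫⁻ v, ENNReal.ofReal (1 - v) * ∫⁻ u, Φ ((1 - v) * u) v ((1 - v) * (1 - u))
        ∂betaMeasure (1 - d) (α + d + d) ∂betaMeasure (1 - d) (α + d) =
      ∫⁻ v, ENNReal.ofReal (1 - v) * ∫⁻ u, Φ v ((1 - v) * u) ((1 - v) * (1 - u))
        ∂betaMeasure (1 - d) (α + d + d) ∂betaMeasure (1 - d) (α + d) := by
  have ha : ∀ i, 0 < ![1 - d, 1 - d, α + d + d] i := by
    intro i
    fin_cases i
    · simp [hd1]
    · simp [hd1]
    · simp; linarith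
  have hΦ' : Measurable fun p : Fin 3 → ℝ => Φ (p 0) (p 1) (p 2) :=
    hΦ.comp (g := fun z : ℝ × ℝ × ℝ => Φ z.1 z.2.1 z.2.2)
      (f := fun p : Fin 3 → ℝ => (p 0, p 1, p 2)) (by fun_prop)
  have m1 : Measurable fun v => ∫⁻ u, Φ ((1 - v) * u) v ((1 - v) * (1 - u))
      ∂betaMeasure (1 - d) (α + d + d) :=
    Measurable.lintegral_prod_right' (f := fun z : ℝ × ℝ =>
      Φ ((1 - z.1) * z.2) z.1 ((1 - z.1) * (1 - z.2)))
      (hΦ.comp (g := fun z : ℝ × ℝ × ℝ => Φ z.1 z.2.1 z.2.2)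
        (f := fun z : ℝ × ℝ => ((1 - z.1) * z.2, z.1, (1 - z.1) * (1 - z.2))) (by fun_prop))
  have m2 : Measurable fun v => ∫⁻ u, Φ v ((1 - v) * u) ((1 - v) * (1 - u))
      ∂betaMeasure (1 - d) (α + d + d) :=
    Measurable.lintegral_prod_right' (f := fun z : ℝ × ℝ =>
      Φ z.1 ((1 - z.1) * z.2) ((1 - z.1) * (1 - z.2)))
      (hΦ.comp (g := fun z : ℝ × ℝ × ℝ => Φ z.1 z.2.1 z.2.2)
        (f := fun z : ℝ × ℝ => (z.1, (1 - z.1) * z.2, (1 - z.1) * (1 - z.2))) (by fun_prop))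
  -- The factor `1 - v` raises the second beta parameter to `α + d + 1`. This is `(1 - d) + (α +
  -- 2d)`, exactly what makes the two sticks and the rest a Dirichlet vector.
  have b1 := lintegral_betaMeasure_pow_mul (a := 1 - d) (b := α + d) (by linarith) (by linarith)
    0 1 m1
  have b2 := lintegral_betaMeasure_pow_mul (a := 1 - d) (b := α + d) (by linarith) (by linarith)
    0 1 m2
  simp only [pow_zero, one_mul, pow_one] at b1 b2
  rw [b1, b2]
  congr 1
  -- `Dir(1 - d, 1 - d, α + 2d)` is symmetric in its first two coordinates; splitting it at either
  -- of them yields the two sides.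
  have s0 := lintegral_dirichlet_split ha 0 hΦ'
  have s1 := lintegral_dirichlet_split ha 1 hΦ'
  rw [s0] at s1
  have e : (1 - d) + (α + d + d) = α + d + 1 := by ring
  have h0 : ∀ v : ℝ, ∫⁻ p, Φ ((Fin.insertNth 0 v ((1 - v) • p) : Fin 3 → ℝ) 0)
      ((Fin.insertNth 0 v ((1 - v) • p) : Fin 3 → ℝ) 1)
      ((Fin.insertNth 0 v ((1 - v) • p) : Fin 3 → ℝ) 2)
      ∂dirichlet (fun j : Fin 2 => ![1 - d, 1 - d, α + d + d] (Fin.succAbove 0 j)) =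
      ∫⁻ u, Φ v ((1 - v) * u) ((1 - v) * (1 - u)) ∂betaMeasure (1 - d) (α + d + d) := by
    intro v
    have hm := hΦ'.comp (measurable_insertNth (γ := Fin 2 → ℝ) (m := 2) 0 (p := fun _ => v)
      (q := fun p => (1 - v) • p) measurable_const (by fun_prop))
    exact lintegral_dirichlet_two (fun _ => ha _) hm
  have h1 : ∀ v : ℝ, ∫⁻ p, Φ ((Fin.insertNth 1 v ((1 - v) • p) : Fin 3 → ℝ) 0)
      ((Fin.insertNth 1 v ((1 - v) • p) : Fin 3 → ℝ) 1)
      ((Fin.insertNth 1 v ((1 - v) • p) : Fin 3 → ℝ) 2)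
      ∂dirichlet (fun j : Fin 2 => ![1 - d, 1 - d, α + d + d] (Fin.succAbove 1 j)) =
      ∫⁻ u, Φ ((1 - v) * u) v ((1 - v) * (1 - u)) ∂betaMeasure (1 - d) (α + d + d) := by
    intro v
    have hm := hΦ'.comp (measurable_insertNth (γ := Fin 2 → ℝ) (m := 2) 1 (p := fun _ => v)
      (q := fun p => (1 - v) • p) measurable_const (by fun_prop))
    exact lintegral_dirichlet_two (fun _ => ha _) hm
  simp only [h0, h1] at s1
  have p0 : ∑ j : Fin 2, ![1 - d, 1 - d, α + d + d] (Fin.succAbove 0 j) = α + d + 1 := by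
    rw [Fin.sum_univ_two, ← e]; rfl
  have p1 : ∑ j : Fin 2, ![1 - d, 1 - d, α + d + d] (Fin.succAbove 1 j) = α + d + 1 := by
    rw [Fin.sum_univ_two, ← e]; rfl
  rw [p0, p1] at s1
  simp only [Nat.cast_zero, add_zero, Nat.cast_one]
  exact s1.symm

/-- Functions of an index and of a sequence that commute with permutations of the indices. -/
def PermEquivariant (F : ℕ → (ℕ → ℝ) → ENNReal) : Prop :=
  ∀ (τ : Equiv.Perm ℕ) (i : ℕ) (w : ℕ → ℝ), F (τ i) w = F i (w ∘ τ)

/-- The permutation that fixes `0` and acts as `τ` on the successors. -/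
def permSucc (τ : Equiv.Perm ℕ) : Equiv.Perm ℕ where
  toFun i := Nat.casesOn i 0 fun j => τ j + 1
  invFun i := Nat.casesOn i 0 fun j => τ.symm j + 1
  left_inv i := by cases i <;> simp
  right_inv i := by cases i <;> simp

@[simp]
theorem permSucc_zero (τ : Equiv.Perm ℕ) : permSucc τ 0 = 0 := rfl

@[simp]
theorem permSucc_succ (τ : Equiv.Perm ℕ) (i : ℕ) : permSucc τ (i + 1) = τ i + 1 := rfl

theorem stickCons_comp_permSucc (v : ℝ) (w : ℕ → ℝ) (τ : Equiv.Perm ℕ) :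
    stickCons v w ∘ permSucc τ = stickCons v (w ∘ τ) := by
  funext i
  cases i <;> simp

theorem PermEquivariant.stickCons {F : ℕ → (ℕ → ℝ) → ENNReal} (hF : PermEquivariant F) (v : ℝ) :
    PermEquivariant fun j w => F (j + 1) (stickCons v w) := fun τ i w => by
  simp only [← permSucc_succ]
  rw [hF, stickCons_comp_permSucc]

theorem lintegral_betaMeasure_one_sub {d α : ℝ} (hd1 : d < 1) (hα : -d < α) :
    ∫⁻ v, ENNReal.ofReal (1 - v) ∂betaMeasure (1 - d) (α + d) =
      ENNReal.ofReal ((α + d) / (α + 1)) := by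
  have ha : 0 < 1 - d := by linarith
  have hb : 0 < α + d := by linarith
  have := isProbabilityMeasureBeta ha (add_pos hb one_pos)
  have h := lintegral_betaMeasure_pow_mul ha hb 0 1 (f := fun _ => 1) measurable_const
  simp only [pow_zero, one_mul, pow_one, mul_one, lintegral_one, Nat.cast_zero, add_zero,
    Nat.cast_one, measure_univ] at h
  rw [h]
  congr 1
  have h1 := Real.Gamma_add_one (show 1 - d + (α + d) ≠ 0 by linarith)
  rw [beta, beta, ← add_assoc, h1, Real.Gamma_add_one hb.ne',
    show 1 - d + (α + d) = α + 1 by ring]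
  have g1 := (Real.Gamma_pos_of_pos ha).ne'
  have g2 := (Real.Gamma_pos_of_pos hb).ne'
  have g3 := (Real.Gamma_pos_of_pos (show 0 < α + 1 by linarith)).ne'
  have g4 : α + 1 ≠ 0 := by linarith
  field_simp

/-- Equivariance turns `F 1` into `F 0` with the first two weights exchanged. With the normalised
tail integrated out, what remains is a function of the first two weights and of the mass left, to
which `lintegral_beta_beta_swap` applies. -/
theorem lintegral_pitmanYor_swap {d α : ℝ} (hd0 : 0 ≤ d) (hd1 : d < 1) (hα : -d < α)
    {F : ℕ → (ℕ → ℝ) → ENNReal} (hF : PermEquivariant F) (hm : ∀ i, Measurable (F i)) :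
    ∫⁻ v, ENNReal.ofReal (1 - v) * ∫⁻ w, F 1 (stickCons v w) ∂pitmanYor d (α + d)
        ∂betaMeasure (1 - d) (α + d) =
      ∫⁻ v, ENNReal.ofReal (1 - v) * ∫⁻ w, F 0 (stickCons v w) ∂pitmanYor d (α + d)
        ∂betaMeasure (1 - d) (α + d) := by
  have hα' : -d < α + d := by linarith
  have := isProbabilityMeasure_pitmanYor hd0 hd1 hα'
  have := isProbabilityMeasure_pitmanYor hd0 hd1 (show -d < α + d + d by linarith)
  set c : ℝ × ℝ × ℝ → (ℕ → ℝ) → ℕ → ℝ := fun z w i =>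
    Nat.casesOn i z.1 fun j => Nat.casesOn j z.2.1 fun k => z.2.2 * w k with hc
  have hcm : Measurable fun z : (ℝ × ℝ × ℝ) × (ℕ → ℝ) => c z.1 z.2 := by
    refine measurable_pi_iff.2 fun i => ?_
    rcases i with _ | _ | i
    · exact measurable_fst.fst
    · exact measurable_fst.snd.fst
    · exact measurable_fst.snd.snd.mul ((measurable_pi_apply i).comp measurable_snd)
  have e0 : ∀ v u w, stickCons v (stickCons u w) = c (v, (1 - v) * u, (1 - v) * (1 - u)) w := by
    intro v u w
    funext i
    rcases i with _ | _ | i <;> simp [hc, mul_assoc]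
  have e1 : ∀ v u w, stickCons v (stickCons u w) ∘ Equiv.swap 0 1 =
      c ((1 - v) * u, v, (1 - v) * (1 - u)) w := by
    intro v u w
    funext i
    rcases i with _ | _ | i
    · simp [hc]
    · simp [hc]
    · have h : Equiv.swap 0 1 (i + 1 + 1) = i + 1 + 1 :=
        Equiv.swap_apply_of_ne_of_ne (by omega) (by omega)
      simp [hc, h, mul_assoc]
  have hΦ : Measurable fun z : ℝ × ℝ × ℝ => ∫⁻ w, F 0 (c z w) ∂pitmanYor d (α + d + d) :=
    Measurable.lintegral_prod_right' (f := fun z : (ℝ × ℝ × ℝ) × (ℕ → ℝ) => F 0 (c z.1 z.2))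
      ((hm 0).comp hcm)
  have h := lintegral_beta_beta_swap hd0 hd1 hα
    (Φ := fun x y z => ∫⁻ w, F 0 (c (x, y, z) w) ∂pitmanYor d (α + d + d)) hΦ
  have hs : ∀ w, F 1 w = F 0 (w ∘ Equiv.swap 0 1) := fun w => by
    have := hF (Equiv.swap 0 1) 0 w
    rwa [Equiv.swap_apply_left] at this
  have m0 := hm 0
  have m1 := hm 1
  have l1 : ∀ v, ∫⁻ w, F 1 (stickCons v w) ∂pitmanYor d (α + d) =
      ∫⁻ u, ∫⁻ w, F 0 (c ((1 - v) * u, v, (1 - v) * (1 - u)) w) ∂pitmanYor d (α + d + d)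
        ∂betaMeasure (1 - d) (α + d + d) := fun v => by
    rw [lintegral_pitmanYor hd0 hd1 hα' (by fun_prop)]
    simp only [hs, e1]
  have l0 : ∀ v, ∫⁻ w, F 0 (stickCons v w) ∂pitmanYor d (α + d) =
      ∫⁻ u, ∫⁻ w, F 0 (c (v, (1 - v) * u, (1 - v) * (1 - u)) w) ∂pitmanYor d (α + d + d)
        ∂betaMeasure (1 - d) (α + d + d) := fun v => by
    rw [lintegral_pitmanYor hd0 hd1 hα' (by fun_prop)]
    simp only [e0]
  simp only [l0, l1]
  exact h

/-- The expected mass of the sticks after the first `m`. -/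
noncomputable def stickRemainder (d α : ℝ) (m : ℕ) : ENNReal :=
  ∏ i ∈ Finset.range m, ENNReal.ofReal ((α + ((i : ℝ) + 1) * d) / (α + i * d + 1))

theorem stickRemainder_succ (d α : ℝ) (m : ℕ) :
    stickRemainder d α (m + 1) =
      ENNReal.ofReal ((α + d) / (α + 1)) * stickRemainder d (α + d) m := by
  rw [stickRemainder, stickRemainder, Finset.prod_range_succ', mul_comm]
  congr 1
  · simp
  · refine Finset.prod_congr rfl fun i _ => ?_
    congr 2 <;> push_cast <;> ring

/-- Each factor is `1 - (1 - d) / (α + i d + 1)`, at most `exp (-(1 - d) / (α + 1 + i))` because `i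
d ≤ i`; the harmonic series diverges. -/
theorem tendsto_stickRemainder {d α : ℝ} (hd0 : 0 ≤ d) (hd1 : d < 1) (hα : -d < α) :
    Filter.Tendsto (stickRemainder d α) Filter.atTop (nhds 0) := by
  have hα1 : 0 < α + 1 := by linarith
  have hid : ∀ i : ℕ, 0 ≤ (i : ℝ) * d := fun i => by positivity
  have hidi : ∀ i : ℕ, (i : ℝ) * d ≤ i := fun i =>
    mul_le_of_le_one_right (Nat.cast_nonneg i) hd1.le
  set f : ℕ → ℝ := fun i => (1 - d) / (α + 1 + i) with hf
  have hfpos : ∀ i, 0 ≤ f i := fun i => div_nonneg (by linarith) (by positivity)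
  have hb : ∀ m, stickRemainder d α m ≤
      ENNReal.ofReal (exp (-∑ i ∈ Finset.range m, f i)) := fun m => by
    rw [stickRemainder, ← Finset.sum_neg_distrib, exp_sum,
      ENNReal.ofReal_prod_of_nonneg fun i _ => (exp_pos _).le]
    refine Finset.prod_le_prod' fun i _ => ENNReal.ofReal_le_ofReal ?_
    have h1 := hid i
    have h2 := hidi i
    have hp : 0 < α + i * d + 1 := by linarith
    have h3 : (α + ((i : ℝ) + 1) * d) / (α + i * d + 1) = 1 - (1 - d) / (α + i * d + 1) := by
      field_simp
      ring
    have h4 : f i ≤ (1 - d) / (α + i * d + 1) :=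
      div_le_div_of_nonneg_left (by linarith) hp (by linarith)
    have h5 := add_one_le_exp (-f i)
    linarith
  have hdiv : Filter.Tendsto (fun m => ∑ i ∈ Finset.range m, f i) Filter.atTop Filter.atTop := by
    refine (not_summable_iff_tendsto_nat_atTop_of_nonneg hfpos).1 fun hs => ?_
    have hs2 : Summable fun i : ℕ => 1 / |(i : ℝ) + (α + 1)| ^ (1 : ℝ) := by
      refine (hs.mul_left (1 - d)⁻¹).congr fun i => ?_
      have : 0 < (i : ℝ) + (α + 1) := by positivity
      rw [rpow_one, abs_of_pos this, hf]
      have h1 : 1 - d ≠ 0 := by linarith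
      field_simp
      ring
    exact absurd ((Real.summable_one_div_nat_add_rpow (α + 1) 1).1 hs2) (lt_irrefl 1)
  refine tendsto_of_tendsto_of_tendsto_of_le_of_le tendsto_const_nhds ?_ (fun _ => zero_le) hb
  have := ENNReal.tendsto_ofReal
    (tendsto_exp_atBot.comp (Filter.tendsto_neg_atTop_atBot.comp hdiv))
  simpa using this

/-- Size-biased sampling, up to the mass of the sticks after the first `m`. -/
theorem lintegral_tsum_pitmanYor_approx {d : ℝ} (hd0 : 0 ≤ d) (hd1 : d < 1) (m : ℕ) :
    ∀ {α : ℝ}, -d < α → ∀ {F : ℕ → (ℕ → ℝ) → ENNReal}, PermEquivariant F →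
      (∀ i, Measurable (F i)) → (∀ i w, F i w ≤ 1) →
      ∫⁻ w, ∑' i, ENNReal.ofReal (w i) * F i w ∂pitmanYor d α ≤
          ∫⁻ w, F 0 w ∂pitmanYor d α + stickRemainder d α m ∧
        ∫⁻ w, F 0 w ∂pitmanYor d α ≤
          ∫⁻ w, ∑' i, ENNReal.ofReal (w i) * F i w ∂pitmanYor d α + stickRemainder d α m := by
  induction m with
  | zero =>
    intro α hα F _ _ hF1
    have := isProbabilityMeasure_pitmanYor hd0 hd1 hα
    -- With no stick removed the error allowed is `1`, and both integrals are at most `1`.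
    have hone : stickRemainder d α 0 = 1 := by simp [stickRemainder]
    rw [hone]
    constructor
    · refine le_add_left ?_
      calc ∫⁻ w, ∑' i, ENNReal.ofReal (w i) * F i w ∂pitmanYor d α
          ≤ ∫⁻ _, 1 ∂pitmanYor d α := by
            refine lintegral_mono_ae ?_
            filter_upwards [ae_pitmanYor_pos_le hd0 hd1 hα] with w hw
            exact (ENNReal.tsum_le_tsum fun i => mul_le_of_le_one_right' (hF1 i w)).trans hw.2
        _ = 1 := by simp
    · refine le_add_left ((lintegral_mono fun w => hF1 0 w).trans ?_)
      simp
  | succ m ih =>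
    intro α hα F hF hm hF1
    have hα' : -d < α + d := by linarith
    have hP := isProbabilityMeasure_pitmanYor hd0 hd1 hα'
    set ν := betaMeasure (1 - d) (α + d)
    set X := ∫⁻ v, ENNReal.ofReal v * ∫⁻ w, F 0 (stickCons v w) ∂pitmanYor d (α + d) ∂ν
    have m0 := hm 0
    have hmF : ∀ i, Measurable fun v => ∫⁻ w, F i (stickCons v w) ∂pitmanYor d (α + d) :=
      fun i => Measurable.lintegral_prod_right'
        (f := fun z : ℝ × (ℕ → ℝ) => F i (stickCons z.1 z.2)) ((hm i).comp (by fun_prop))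
    have hmT : Measurable fun z : ℝ × (ℕ → ℝ) =>
        ∑' i, ENNReal.ofReal (z.2 i) * F (i + 1) (stickCons z.1 z.2) :=
      Measurable.tsum fun i => Measurable.fun_mul (by fun_prop) ((hm _).comp (by fun_prop))
    have hmT' : Measurable fun v =>
        ∫⁻ w, ∑' i, ENNReal.ofReal (w i) * F (i + 1) (stickCons v w) ∂pitmanYor d (α + d) :=
      Measurable.lintegral_prod_right' hmT
    -- Either the first weight is picked, which gives `X`, or the pick falls in the rescaled tail: a
    -- size-biased sum for `PY(d, α + d)`.
    have hL : ∫⁻ w, ∑' i, ENNReal.ofReal (w i) * F i w ∂pitmanYor d α =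
        X + ∫⁻ v, ENNReal.ofReal (1 - v) *
          ∫⁻ w, ∑' i, ENNReal.ofReal (w i) * F (i + 1) (stickCons v w) ∂pitmanYor d (α + d) ∂ν := by
      rw [lintegral_pitmanYor hd0 hd1 hα
        (Measurable.tsum fun i => Measurable.fun_mul (by fun_prop) (hm i)),
        ← lintegral_add_left (Measurable.fun_mul (by fun_prop) (hmF 0))]
      refine lintegral_congr_ae ?_
      filter_upwards [ae_betaMeasure_mem (1 - d) (α + d)] with v hv
      have hv1 : 0 ≤ 1 - v := by linarith [hv.2]
      rw [← lintegral_const_mul _ (by fun_prop),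
        ← lintegral_const_mul _ (by fun_prop),
        ← lintegral_add_left (by fun_prop)]
      refine lintegral_congr fun w => ?_
      rw [tsum_eq_zero_add' ENNReal.summable, ← ENNReal.tsum_mul_left]
      simp only [stickCons_zero, stickCons_succ, ENNReal.ofReal_mul hv1, mul_assoc]
    -- Write `1 = v + (1 - v)`: the part with `v` is again `X`, and in the part with `1 - v` the
    -- swap replaces `F 0` by `F 1`, the first member of the shifted family.
    have hR : ∫⁻ w, F 0 w ∂pitmanYor d α =
        X + ∫⁻ v, ENNReal.ofReal (1 - v) * ∫⁻ w, F 1 (stickCons v w) ∂pitmanYor d (α + d) ∂ν := by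
      rw [lintegral_pitmanYor_swap hd0 hd1 hα hF hm, lintegral_pitmanYor hd0 hd1 hα m0,
        ← lintegral_add_left (Measurable.fun_mul (by fun_prop) (hmF 0))]
      refine lintegral_congr_ae ?_
      filter_upwards [ae_betaMeasure_mem (1 - d) (α + d)] with v hv
      have hv1 : 0 ≤ 1 - v := by linarith [hv.2]
      rw [← add_mul, ← ENNReal.ofReal_add hv.1.le hv1]
      simp
    have hε : ∫⁻ v, ENNReal.ofReal (1 - v) * stickRemainder d (α + d) m ∂ν =
        stickRemainder d α (m + 1) := by
      rw [lintegral_mul_const _ (by fun_prop), lintegral_betaMeasure_one_sub hd1 hα,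
        stickRemainder_succ]
    -- The shifted family is again equivariant and bounded by `1`; its error, weighted by `1 - v`,
    -- integrates to the next remainder.
    have key := fun v => ih hα' (hF.stickCons v) (fun i => (hm (i + 1)).comp (by fun_prop))
      (fun i w => hF1 _ _)
    rw [hL, hR, ← hε, add_assoc, add_assoc,
      ← lintegral_add_left (Measurable.fun_mul (by fun_prop) (hmF 1)),
      ← lintegral_add_left (Measurable.fun_mul (by fun_prop) hmT')]
    simp only [← mul_add]
    constructor
    · gcongr with v
      exact (key v).1
    · gcongr with v
      exact (key v).2

theorem lintegral_tsum_pitmanYor_of_le_one {d α : ℝ} (hd0 : 0 ≤ d) (hd1 : d < 1) (hα : -d < α)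
    {F : ℕ → (ℕ → ℝ) → ENNReal} (hF : PermEquivariant F) (hm : ∀ i, Measurable (F i))
    (hF1 : ∀ i w, F i w ≤ 1) :
    ∫⁻ w, ∑' i, ENNReal.ofReal (w i) * F i w ∂pitmanYor d α = ∫⁻ w, F 0 w ∂pitmanYor d α := by
  have key := fun m => lintegral_tsum_pitmanYor_approx hd0 hd1 m hα hF hm hF1
  have ht := tendsto_stickRemainder hd0 hd1 hα
  refine le_antisymm ?_ ?_
  · refine ge_of_tendsto' (x := Filter.atTop) ?_ fun m => (key m).1
    simpa using tendsto_const_nhds.add ht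
  · refine ge_of_tendsto' (x := Filter.atTop) ?_ fun m => (key m).2
    simpa using tendsto_const_nhds.add ht

/-- Size-biased sampling: the first weight of a Pitman–Yor sequence is a size-biased pick, jointly
with every permutation-invariant function of the sequence. -/
theorem lintegral_tsum_pitmanYor {d α : ℝ} (hd0 : 0 ≤ d) (hd1 : d < 1) (hα : -d < α)
    {F : ℕ → (ℕ → ℝ) → ENNReal} (hF : PermEquivariant F) (hm : ∀ i, Measurable (F i)) :
    ∫⁻ w, ∑' i, ENNReal.ofReal (w i) * F i w ∂pitmanYor d α = ∫⁻ w, F 0 w ∂pitmanYor d α := by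
  -- Truncation at `n + 1` reduces to bounded `F`; the `+ 1` keeps the bound invertible, so that
  -- dividing by it gives values at most `1`.
  have hsup : ∀ i w, F i w = ⨆ n : ℕ, min (F i w) (n + 1) := fun i w => by
    refine le_antisymm ?_ (iSup_le fun n => min_le_left _ _)
    rcases eq_or_ne (F i w) ⊤ with h | h
    · rw [h]
      simp only [le_top, min_eq_right]
      refine le_of_eq (ENNReal.eq_top_of_forall_nnreal_le fun r => ?_).symm
      obtain ⟨n, hn⟩ := exists_nat_ge r
      refine le_iSup_of_le n (le_trans ?_ le_self_add)
      exact_mod_cast hn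
    · obtain ⟨n, hn⟩ := ENNReal.exists_nat_gt h
      exact le_iSup_of_le n (le_min le_rfl (hn.le.trans le_self_add))
  have hmono : ∀ i w, Monotone fun n : ℕ => min (F i w) ((n : ENNReal) + 1) := fun i w a b hab =>
    min_le_min le_rfl (by gcongr)
  have htrunc : ∀ n : ℕ, ∫⁻ w, ∑' i, ENNReal.ofReal (w i) * min (F i w) (n + 1) ∂pitmanYor d α =
      ∫⁻ w, min (F 0 w) (n + 1) ∂pitmanYor d α := fun n => by
    set c : ENNReal := n + 1 with hc
    have hc0 : c ≠ 0 := by simp [hc]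
    have hct : c ≠ ⊤ := by simp [hc]
    have hmc : ∀ i, Measurable fun w => c⁻¹ * min (F i w) c := fun i =>
      ((hm i).min measurable_const).const_mul _
    have h := lintegral_tsum_pitmanYor_of_le_one hd0 hd1 hα
      (F := fun i w => c⁻¹ * min (F i w) c) (fun τ i w => by simp only [hF τ i w]) hmc
      (fun i w => (mul_le_mul_right (min_le_right _ _) _).trans
        (ENNReal.inv_mul_cancel hc0 hct).le)
    have hcc : ∀ x, c * (c⁻¹ * x) = x := fun x => by
      rw [← mul_assoc, ENNReal.mul_inv_cancel hc0 hct, one_mul]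
    calc ∫⁻ w, ∑' i, ENNReal.ofReal (w i) * min (F i w) c ∂pitmanYor d α
        = c * ∫⁻ w, ∑' i, ENNReal.ofReal (w i) * (c⁻¹ * min (F i w) c) ∂pitmanYor d α := by
          rw [← lintegral_const_mul _ (Measurable.tsum fun i =>
            Measurable.fun_mul (by fun_prop) (hmc i))]
          simp only [← ENNReal.tsum_mul_left, mul_left_comm c (ENNReal.ofReal _), hcc]
      _ = ∫⁻ w, min (F 0 w) c ∂pitmanYor d α := by
          rw [h, ← lintegral_const_mul _ (hmc 0)]
          simp only [hcc]
  have hmn : ∀ i (n : ℕ), Measurable fun w => min (F i w) ((n : ENNReal) + 1) := fun i n =>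
    (hm i).min measurable_const
  -- A series is an integral for the counting measure, so monotone convergence exchanges the
  -- supremum and the sum.
  have e1 : ∀ w : ℕ → ℝ, ∑' i, ENNReal.ofReal (w i) * F i w =
      ⨆ n : ℕ, ∑' i, ENNReal.ofReal (w i) * min (F i w) (n + 1) := fun w => by
    simp only [← lintegral_count]
    rw [← lintegral_iSup
      (f := fun (n : ℕ) i => ENNReal.ofReal (w i) * min (F i w) ((n : ENNReal) + 1))
      (fun n => measurable_of_countable _) fun a b hab i => mul_le_mul_right (hmono i w hab) _]
    simp only [← ENNReal.mul_iSup, ← hsup]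
  simp only [e1]
  rw [lintegral_iSup
    (f := fun (n : ℕ) (w : ℕ → ℝ) => ∑' i, ENNReal.ofReal (w i) * min (F i w) ((n : ENNReal) + 1))
    (fun n => Measurable.tsum fun i => Measurable.fun_mul (by fun_prop) (hmn i n))
    fun a b hab w => ENNReal.tsum_le_tsum fun i => mul_le_mul_right (hmono i w hab) _]
  simp only [htrunc]
  rw [← lintegral_iSup (hmn 0) fun a b hab w => hmono 0 w hab]
  simp only [← hsup]

/-- Size-biased sampling with `F = 1` says that the total mass has mean `1`; being at most `1`, it
equals `1` almost surely. -/
theorem ae_pitmanYor {d α : ℝ} (hd0 : 0 ≤ d) (hd1 : d < 1) (hα : -d < α) :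
    ∀ᵐ w ∂pitmanYor d α, (∀ i, 0 < w i ∧ w i ≤ 1) ∧ ∑' i, ENNReal.ofReal (w i) = 1 := by
  have hP := isProbabilityMeasure_pitmanYor hd0 hd1 hα
  have hm : Measurable fun w : ℕ → ℝ => ∑' i, ENNReal.ofReal (w i) :=
    Measurable.tsum fun i => by fun_prop
  have h := lintegral_tsum_pitmanYor hd0 hd1 hα (F := fun _ _ => 1) (fun _ _ _ => rfl)
    (fun _ => measurable_const)
  simp only [mul_one, lintegral_one, measure_univ] at h
  have hle : (fun w : ℕ → ℝ => ∑' i, ENNReal.ofReal (w i)) ≤ᵐ[pitmanYor d α] fun _ => 1 := by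
    filter_upwards [ae_pitmanYor_pos_le hd0 hd1 hα] with w hw using hw.2
  have heq := ae_eq_of_ae_le_of_lintegral_le hle (by simp [h]) aemeasurable_const (by simp [h])
  filter_upwards [ae_pitmanYor_pos_le hd0 hd1 hα, heq] with w hw h1
  refine ⟨fun i => ⟨hw.1 i, ?_⟩, h1⟩
  exact ENNReal.ofReal_le_one.1 ((ENNReal.le_tsum i).trans hw.2)

/-! ### Entropy as an extended nonnegative real -/

/-- The entropy of a family of weights in `[0, 1]`, as an extended nonnegative real. -/
noncomputable def eEntropy {ι : Type*} (w : ι → ℝ) : ENNReal :=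
  ∑' i, ENNReal.ofReal (negMulLog (w i))

theorem measurable_eEntropy {ι : Type*} [Countable ι] :
    Measurable (eEntropy : (ι → ℝ) → ENNReal) :=
  Measurable.tsum fun i => by fun_prop

/-- This also covers divergent series, for which both sides are `0`. Moments can thus be computed in
`ENNReal` before summability is known. -/
theorem entropy_eq_toReal {ι : Type*} {w : ι → ℝ} (hw : ∀ i, 0 ≤ w i ∧ w i ≤ 1) :
    entropy w = (eEntropy w).toReal := by
  rw [eEntropy, ENNReal.tsum_toReal_eq fun i => ENNReal.ofReal_ne_top, entropy]
  exact tsum_congr fun i =>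
    (ENNReal.toReal_ofReal (negMulLog_nonneg (hw i).1 (hw i).2)).symm

theorem summable_negMulLog_of_eEntropy_ne_top {ι : Type*} {w : ι → ℝ}
    (hw : ∀ i, 0 ≤ w i ∧ w i ≤ 1) (h : eEntropy w ≠ ⊤) : Summable fun i => negMulLog (w i) :=
  (ENNReal.summable_toReal h).congr fun i =>
    ENNReal.toReal_ofReal (negMulLog_nonneg (hw i).1 (hw i).2)

theorem eEntropy_ne_top_of_summable {ι : Type*} {w : ι → ℝ}
    (h : Summable fun i => negMulLog (w i)) : eEntropy w ≠ ⊤ :=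
  h.tsum_ofReal_ne_top

theorem eEntropy_const_mul {ι : Type*} {c : ℝ} (hc0 : 0 ≤ c) (hc1 : c ≤ 1) {w : ι → ℝ}
    (hw : ∀ i, 0 ≤ w i ∧ w i ≤ 1) :
    eEntropy (fun i => c * w i) =
      ENNReal.ofReal (negMulLog c) * ∑' i, ENNReal.ofReal (w i) + ENNReal.ofReal c * eEntropy w := by
  rw [eEntropy, eEntropy, ← ENNReal.tsum_mul_left, ← ENNReal.tsum_mul_left, ← ENNReal.tsum_add]
  refine tsum_congr fun i => ?_
  have h1 := negMulLog_nonneg hc0 hc1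
  have h2 := negMulLog_nonneg (hw i).1 (hw i).2
  rw [negMulLog_mul, ENNReal.ofReal_add (mul_nonneg (hw i).1 h1) (mul_nonneg hc0 h2),
    ENNReal.ofReal_mul (hw i).1, ENNReal.ofReal_mul hc0, mul_comm (ENNReal.ofReal (w i))]

theorem eEntropy_stickCons_eq (v : ℝ) (w : ℕ → ℝ) :
    eEntropy (stickCons v w) =
      ENNReal.ofReal (negMulLog v) + eEntropy (fun i => (1 - v) * w i) := by
  rw [eEntropy, tsum_eq_zero_add' ENNReal.summable]
  rfl

/-- The chain rule for the entropy of a stick-breaking sequence. -/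
theorem eEntropy_stickCons {v : ℝ} (hv0 : 0 ≤ v) (hv1 : v ≤ 1) {w : ℕ → ℝ}
    (hw : ∀ i, 0 ≤ w i ∧ w i ≤ 1) (hs : ∑' i, ENNReal.ofReal (w i) = 1) :
    eEntropy (stickCons v w) =
      ENNReal.ofReal (binEntropy v) + ENNReal.ofReal (1 - v) * eEntropy w := by
  rw [eEntropy_stickCons_eq, eEntropy_const_mul (by linarith) (by linarith) hw, hs, mul_one,
    ← add_assoc, binEntropy_eq_negMulLog_add_negMulLog_one_sub,
    ENNReal.ofReal_add (negMulLog_nonneg hv0 hv1)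
      (negMulLog_nonneg (by linarith) (by linarith))]

theorem eEntropy_comp_equiv {ι κ : Type*} (w : ι → ℝ) (e : κ ≃ ι) :
    eEntropy (w ∘ e) = eEntropy w :=
  e.tsum_eq fun i => ENNReal.ofReal (negMulLog (w i))

/-! ### Logarithmic moments of the beta law -/

theorem pos_vecCons_two {a b : ℝ} (ha : 0 < a) (hb : 0 < b) : ∀ i, 0 < ![a, b] i := by
  intro i; fin_cases i <;> simp [ha, hb]

theorem sum_vecCons_two (a b : ℝ) : ∑ i : Fin (1 + 1), ![a, b] i = a + b := by simp

theorem ae_dirichlet_two {a b : ℝ} (ha : 0 < a) (hb : 0 < b) :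
    ∀ᵐ p ∂dirichlet ![a, b], 0 < p 0 ∧ p 0 < 1 ∧ p 1 = 1 - p 0 := by
  filter_upwards [ae_dirichlet (pos_vecCons_two ha hb),
    ae_dirichlet_sum (pos_vecCons_two ha hb)] with p hp hs
  rw [Fin.sum_univ_two] at hs
  exact ⟨hp 0, by linarith [hp 1], by linarith⟩

theorem memLp_log_betaMeasure {a b : ℝ} (ha : 0 < a) (hb : 0 < b) :
    MemLp log 2 (betaMeasure a b) := by
  rw [← map_dirichlet_two ha hb, memLp_map_measure_iff measurable_log.aestronglyMeasurable
    (Measurable.aemeasurable (by fun_prop))]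
  exact memLp_log_dirichlet (pos_vecCons_two ha hb) 0

theorem binEntropy_mem_Icc {p : ℝ} (h0 : 0 ≤ p) (h1 : p ≤ 1) :
    0 ≤ binEntropy p ∧ binEntropy p ≤ 2 := by
  have h2 := negMulLog_mem_Icc h0 h1
  have h3 := negMulLog_mem_Icc (x := 1 - p) (by linarith) (by linarith)
  rw [binEntropy_eq_negMulLog_add_negMulLog_one_sub]
  constructor <;> linarith

theorem memLp_binEntropy_betaMeasure {a b : ℝ} (ha : 0 < a) (hb : 0 < b) :
    MemLp binEntropy 2 (betaMeasure a b) := by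
  have := isProbabilityMeasureBeta ha hb
  refine MemLp.of_bound binEntropy_continuous.aestronglyMeasurable 2 ?_
  filter_upwards [ae_betaMeasure_mem a b] with p hp
  have h := binEntropy_mem_Icc hp.1.le hp.2.le
  rw [norm_eq_abs, abs_of_nonneg h.1]
  exact h.2

theorem integral_neg_log_betaMeasure {a b : ℝ} (ha : 0 < a) (hb : 0 < b) :
    ∫ v, -log v ∂betaMeasure a b = psi0 (a + b) - psi0 a := by
  rw [integral_betaMeasure ha hb (f := fun v => -log v) (by fun_prop), integral_neg,
    integral_log_dirichlet (pos_vecCons_two ha hb), sum_vecCons_two]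
  simp

/-- The factor `1 - v` is the second Dirichlet coordinate, so it biases `b` to `b + 1`. -/
theorem integral_one_sub_mul_neg_log_betaMeasure {a b : ℝ} (ha : 0 < a) (hb : 0 < b) :
    ∫ v, (1 - v) * -log v ∂betaMeasure a b = b / (a + b) * (psi0 (a + b + 1) - psi0 a) := by
  have hp := pos_vecCons_two ha hb
  rw [integral_betaMeasure ha hb (f := fun v => (1 - v) * -log v) (by fun_prop)]
  have h := integral_dirichlet_coord_mul hp 1 (fun p => log (p 0))
  rw [integral_log_dirichlet (update_add_one_pos hp 1), sum_update_add_one, sum_vecCons_two,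
    Function.update_of_ne (by decide)] at h
  simp only [Matrix.cons_val_one, Matrix.cons_val_zero] at h
  rw [show b / (a + b) * (psi0 (a + b + 1) - psi0 a) =
    -(b / (a + b) * (psi0 a - psi0 (a + b + 1))) by ring, ← h, ← integral_neg]
  refine integral_congr_ae ?_
  filter_upwards [ae_dirichlet_two ha hb] with p hp
  rw [← hp.2.2]
  ring

/-- Split `binEntropy v` into its two terms: the factor `v` biases `a` and the factor `1 - v` biases
`b`, leaving pure second moments of logarithms. -/
theorem integral_neg_log_mul_binEntropy_betaMeasure {a b : ℝ} (ha : 0 < a) (hb : 0 < b) :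
    ∫ v, -log v * binEntropy v ∂betaMeasure a b =
      a / (a + b) * ((psi0 (a + 1) - psi0 (a + b + 1)) ^ 2 + psi1 (a + 1) - psi1 (a + b + 1)) +
      b / (a + b) * ((psi0 a - psi0 (a + b + 1)) * (psi0 (b + 1) - psi0 (a + b + 1)) -
        psi1 (a + b + 1)) := by
  have hp := pos_vecCons_two ha hb
  have hl := memLp_log_dirichlet hp
  have hn := memLp_negMulLog_dirichlet hp
  rw [integral_betaMeasure ha hb (f := fun v => -log v * binEntropy v)
    (measurable_log.neg.mul binEntropy_continuous.measurable)]
  have h0 := integral_mul_log_sq_dirichlet hp 0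
  have h1 := integral_dirichlet_coord_mul hp 1 (fun p => log (p 0) * log (p 1))
  rw [integral_log_mul_log_dirichlet (update_add_one_pos hp 1) (by decide), sum_update_add_one,
    sum_vecCons_two, Function.update_of_ne (by decide), Function.update_self] at h1
  rw [sum_vecCons_two] at h0
  simp only [Matrix.cons_val_one, Matrix.cons_val_zero] at h0 h1
  rw [← h0, ← h1, ← integral_add]
  · refine integral_congr_ae ?_
    filter_upwards [ae_dirichlet_two ha hb] with p hp
    rw [binEntropy_eq_negMulLog_add_negMulLog_one_sub, ← hp.2.2, negMulLog, negMulLog]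
    ring
  · refine ((hl 0).neg.integrable_mul (hn 0)).congr (ae_of_all _ fun p => ?_)
    simp [negMulLog]
    ring
  · refine ((hl 0).neg.integrable_mul (hn 1)).congr (ae_of_all _ fun p => ?_)
    simp [negMulLog]
    ring

/-! ### Moments of the entropy under the Pitman–Yor law -/

theorem permEquivariant_coord_mul (f : ℝ → ENNReal) (g : ENNReal → ENNReal) :
    PermEquivariant fun i w => f (w i) * g (eEntropy w) := fun τ i w => by
  simp only [eEntropy_comp_equiv, Function.comp_apply]

theorem ofReal_mul_ofReal_neg_log {x : ℝ} (hx : 0 ≤ x) :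
    ENNReal.ofReal x * ENNReal.ofReal (-log x) = ENNReal.ofReal (negMulLog x) := by
  rw [← ENNReal.ofReal_mul hx, negMulLog]
  ring_nf

/-- The entropy is `∑ wᵢ (-log wᵢ)`, a size-biased sum, and `g` of the entropy is permutation
invariant. So the sum reduces to the first weight, and the chain rule expresses the whole entropy
through that weight and the tail. -/
theorem lintegral_eEntropy_mul_pitmanYor {d α : ℝ} (hd0 : 0 ≤ d) (hd1 : d < 1) (hα : -d < α)
    {g : ENNReal → ENNReal} (hg : Measurable g) :
    ∫⁻ w, eEntropy w * g (eEntropy w) ∂pitmanYor d α =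
      ∫⁻ v, ∫⁻ w, ENNReal.ofReal (-log v) *
        g (ENNReal.ofReal (binEntropy v) + ENNReal.ofReal (1 - v) * eEntropy w)
        ∂pitmanYor d (α + d) ∂betaMeasure (1 - d) (α + d) := by
  have hm := measurable_eEntropy (ι := ℕ)
  have hF : ∀ i, Measurable fun w : ℕ → ℝ => ENNReal.ofReal (-log (w i)) * g (eEntropy w) :=
    fun i => by fun_prop
  have h := lintegral_tsum_pitmanYor hd0 hd1 hα
    (permEquivariant_coord_mul (fun x => ENNReal.ofReal (-log x)) g) hF
  rw [lintegral_pitmanYor hd0 hd1 hα (hF 0)] at h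
  refine Eq.trans (lintegral_congr_ae ?_) (h.trans (lintegral_congr_ae ?_))
  · filter_upwards [ae_pitmanYor hd0 hd1 hα] with w hw
    simp only [← mul_assoc, ofReal_mul_ofReal_neg_log (hw.1 _).1.le]
    rw [ENNReal.tsum_mul_right]
    rfl
  · filter_upwards [ae_betaMeasure_mem (1 - d) (α + d)] with v hv
    refine lintegral_congr_ae ?_
    filter_upwards [ae_pitmanYor hd0 hd1 (show -d < α + d by linarith)] with w hw
    rw [eEntropy_stickCons hv.1.le hv.2.le (fun i => ⟨(hw.1 i).1.le, (hw.1 i).2⟩) hw.2,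
      stickCons_zero]

theorem lintegral_eEntropy_pitmanYor {d α : ℝ} (hd0 : 0 ≤ d) (hd1 : d < 1) (hα : -d < α) :
    ∫⁻ w, eEntropy w ∂pitmanYor d α = ENNReal.ofReal (pitmanYorEntropyMean d α) := by
  have ha : 0 < 1 - d := by linarith
  have hb : 0 < α + d := by linarith
  have hP := isProbabilityMeasure_pitmanYor hd0 hd1 (show -d < α + d by linarith)
  have := isProbabilityMeasureBeta ha hb
  have h := lintegral_eEntropy_mul_pitmanYor hd0 hd1 hα (g := fun _ => 1) measurable_const
  simp only [mul_one, lintegral_const, measure_univ] at h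
  have hi : Integrable (fun v => -log v) (betaMeasure (1 - d) (α + d)) :=
    ((memLp_log_betaMeasure ha hb).integrable (by norm_num)).neg
  rw [h, ← ofReal_integral_eq_lintegral_ofReal hi, integral_neg_log_betaMeasure ha hb, pitmanYorEntropyMean]
  · congr 3
    ring
  · filter_upwards [ae_betaMeasure_mem (1 - d) (α + d)] with v hv
    simpa using log_nonpos hv.1.le hv.2.le

theorem pitmanYorEntropyMean_nonneg {d α : ℝ} (hd1 : d < 1) (hα : -d < α) :
    0 ≤ pitmanYorEntropyMean d α := by
  have ha : 0 < 1 - d := by linarith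
  have hb : 0 < α + d := by linarith
  rw [pitmanYorEntropyMean, show α + 1 = 1 - d + (α + d) by ring,
    ← integral_neg_log_betaMeasure ha hb]
  refine integral_nonneg_of_ae ?_
  filter_upwards [ae_betaMeasure_mem (1 - d) (α + d)] with v hv
  simpa using log_nonpos hv.1.le hv.2.le

/-- Case `g = id` of the preceding reduction: the tail entropy enters linearly, so only its mean,
for the parameter `α + d`, is required. Nonnegativity is recorded so that `ENNReal.ofReal` loses
nothing. -/
theorem lintegral_eEntropy_sq_pitmanYor {d α : ℝ} (hd0 : 0 ≤ d) (hd1 : d < 1) (hα : -d < α) :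
    0 ≤ pitmanYorEntropyVariance d α + pitmanYorEntropyMean d α ^ 2 ∧
      ∫⁻ w, eEntropy w ^ 2 ∂pitmanYor d α =
        ENNReal.ofReal (pitmanYorEntropyVariance d α + pitmanYorEntropyMean d α ^ 2) := by
  have ha : 0 < 1 - d := by linarith
  have hb : 0 < α + d := by linarith
  have hα' : -d < α + d := by linarith
  have hα1 : 0 < α + 1 := by linarith
  have hP := isProbabilityMeasure_pitmanYor hd0 hd1 hα'
  have := isProbabilityMeasureBeta ha hb
  have hm := measurable_eEntropy (ι := ℕ)
  have hlog := memLp_log_betaMeasure ha hb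
  have hM := pitmanYorEntropyMean_nonneg hd1 hα'
  have i1 : Integrable (fun v => -log v * binEntropy v) (betaMeasure (1 - d) (α + d)) :=
    hlog.neg.integrable_mul (memLp_binEntropy_betaMeasure ha hb)
  have i2 : Integrable (fun v => (1 - v) * -log v) (betaMeasure (1 - d) (α + d)) := by
    refine Integrable.bdd_mul (c := 1) (hlog.integrable (by norm_num)).neg
      (Measurable.aestronglyMeasurable (by fun_prop)) ?_
    filter_upwards [ae_betaMeasure_mem (1 - d) (α + d)] with v hv
    rw [norm_eq_abs, abs_of_nonneg (by linarith)]
    linarith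
  have e : ∀ᵐ v ∂betaMeasure (1 - d) (α + d),
      ∫⁻ w, ENNReal.ofReal (-log v) *
        (ENNReal.ofReal (binEntropy v) + ENNReal.ofReal (1 - v) * eEntropy w)
        ∂pitmanYor d (α + d) = ENNReal.ofReal (-log v * binEntropy v +
          (1 - v) * -log v * pitmanYorEntropyMean d (α + d)) := by
    filter_upwards [ae_betaMeasure_mem (1 - d) (α + d)] with v hv
    have hl : 0 ≤ -log v := by simpa using log_nonpos hv.1.le hv.2.le
    have hh := (binEntropy_mem_Icc hv.1.le hv.2.le).1
    have h1 : 0 ≤ 1 - v := by linarith [hv.2]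
    rw [lintegral_const_mul _ (by fun_prop), lintegral_add_left (by fun_prop),
      lintegral_const_mul _ hm, lintegral_eEntropy_pitmanYor hd0 hd1 hα', lintegral_const,
      measure_univ, mul_one, ← ENNReal.ofReal_mul h1, ← ENNReal.ofReal_add hh (by positivity),
      ← ENNReal.ofReal_mul hl]
    congr 1
    ring
  have hnn : ∀ᵐ v ∂betaMeasure (1 - d) (α + d), 0 ≤ -log v * binEntropy v +
      (1 - v) * -log v * pitmanYorEntropyMean d (α + d) := by
    filter_upwards [ae_betaMeasure_mem (1 - d) (α + d)] with v hv
    have hl : 0 ≤ -log v := by simpa using log_nonpos hv.1.le hv.2.le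
    have hh := (binEntropy_mem_Icc hv.1.le hv.2.le).1
    have h1 : 0 ≤ 1 - v := by linarith [hv.2]
    exact add_nonneg (mul_nonneg hl hh) (mul_nonneg (mul_nonneg h1 hl) hM)
  have hval : ∫ v, (-log v * binEntropy v + (1 - v) * -log v * pitmanYorEntropyMean d (α + d))
      ∂betaMeasure (1 - d) (α + d) =
        pitmanYorEntropyVariance d α + pitmanYorEntropyMean d α ^ 2 := by
    rw [integral_add i1 (i2.mul_const _), integral_mul_const,
      integral_one_sub_mul_neg_log_betaMeasure ha hb,
      integral_neg_log_mul_binEntropy_betaMeasure ha hb,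
      pitmanYorEntropyVariance, pitmanYorEntropyMean, pitmanYorEntropyMean,
      show 1 - d + (α + d) + 1 = α + 1 + 1 by ring, show 1 - d + (α + d) = α + 1 by ring,
      show 2 + α = α + 1 + 1 by ring, show 2 - d = 1 - d + 1 by ring, psi0_add_one ha,
      psi0_add_one hα1]
    -- The functional equation has reduced the digamma values; what is left is a rational identity,
    -- cleared of denominators with `a = 1 - d` as variable.
    have h1 : d = 1 - (1 - d) := by ring
    generalize 1 - d = a at *
    subst h1
    field_simp
    ring
  refine ⟨hval ▸ integral_nonneg_of_ae hnn, ?_⟩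
  have h := lintegral_eEntropy_mul_pitmanYor hd0 hd1 hα measurable_id
  simp only [id, ← pow_two (eEntropy _)] at h
  rw [h, lintegral_congr_ae e,
    ← ofReal_integral_eq_lintegral_ofReal (by fun_prop) hnn, hval]

theorem ae_pitmanYor_eEntropy_ne_top {d α : ℝ} (hd0 : 0 ≤ d) (hd1 : d < 1) (hα : -d < α) :
    ∀ᵐ w ∂pitmanYor d α, eEntropy w ≠ ⊤ := by
  have h := ae_lt_top measurable_eEntropy (μ := pitmanYor d α)
    (by rw [lintegral_eEntropy_pitmanYor hd0 hd1 hα]; exact ENNReal.ofReal_ne_top)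
  filter_upwards [h] with w hw using hw.ne

theorem ae_pitmanYor_summable {d α : ℝ} (hd0 : 0 ≤ d) (hd1 : d < 1) (hα : -d < α) :
    ∀ᵐ w ∂pitmanYor d α, Summable fun i => negMulLog (w i) := by
  filter_upwards [ae_pitmanYor hd0 hd1 hα, ae_pitmanYor_eEntropy_ne_top hd0 hd1 hα] with w hw ht
  exact summable_negMulLog_of_eEntropy_ne_top (fun i => ⟨(hw.1 i).1.le, (hw.1 i).2⟩) ht

theorem entropy_ae_eq_toReal_pitmanYor {d α : ℝ} (hd0 : 0 ≤ d) (hd1 : d < 1) (hα : -d < α) :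
    (fun w : ℕ → ℝ => entropy w) =ᵐ[pitmanYor d α] fun w => (eEntropy w).toReal := by
  filter_upwards [ae_pitmanYor hd0 hd1 hα] with w hw
  exact entropy_eq_toReal fun i => ⟨(hw.1 i).1.le, (hw.1 i).2⟩

theorem memLp_entropy_pitmanYor {d α : ℝ} (hd0 : 0 ≤ d) (hd1 : d < 1) (hα : -d < α) :
    MemLp (fun w : ℕ → ℝ => entropy w) 2 (pitmanYor d α) := by
  have hm : AEStronglyMeasurable (fun w : ℕ → ℝ => (eEntropy w).toReal) (pitmanYor d α) :=
    measurable_eEntropy.ennreal_toReal.aestronglyMeasurable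
  refine MemLp.ae_eq (entropy_ae_eq_toReal_pitmanYor hd0 hd1 hα).symm
    ((memLp_two_iff_integrable_sq hm).2 ?_)
  simp only [← ENNReal.toReal_pow]
  refine integrable_toReal_of_lintegral_ne_top (measurable_eEntropy.pow_const 2).aemeasurable ?_
  rw [(lintegral_eEntropy_sq_pitmanYor hd0 hd1 hα).2]
  exact ENNReal.ofReal_ne_top

/-- The mean of the entropy under the Pitman–Yor law. -/
theorem integral_entropy_pitmanYor {d α : ℝ} (hd0 : 0 ≤ d) (hd1 : d < 1) (hα : -d < α) :
    ∫ w, entropy w ∂pitmanYor d α = pitmanYorEntropyMean d α := by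
  rw [integral_congr_ae (entropy_ae_eq_toReal_pitmanYor hd0 hd1 hα),
    integral_toReal measurable_eEntropy.aemeasurable (by
      filter_upwards [ae_pitmanYor_eEntropy_ne_top hd0 hd1 hα] with w hw using hw.lt_top),
    lintegral_eEntropy_pitmanYor hd0 hd1 hα,
    ENNReal.toReal_ofReal (pitmanYorEntropyMean_nonneg hd1 hα)]

/-- The variance of the entropy under the Pitman–Yor law. -/
theorem variance_entropy_pitmanYor {d α : ℝ} (hd0 : 0 ≤ d) (hd1 : d < 1) (hα : -d < α) :
    Var[fun w : ℕ → ℝ => entropy w; pitmanYor d α] = pitmanYorEntropyVariance d α := by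
  have hP := isProbabilityMeasure_pitmanYor hd0 hd1 hα
  rw [variance_eq_sub (memLp_entropy_pitmanYor hd0 hd1 hα)]
  have h2 : ∫ w, entropy w ^ 2 ∂pitmanYor d α =
      (ENNReal.ofReal (pitmanYorEntropyVariance d α + pitmanYorEntropyMean d α ^ 2)).toReal := by
    rw [← (lintegral_eEntropy_sq_pitmanYor hd0 hd1 hα).2,
      ← integral_toReal (measurable_eEntropy.pow_const 2).aemeasurable (by
        filter_upwards [ae_pitmanYor_eEntropy_ne_top hd0 hd1 hα] with w hw
          using ENNReal.pow_lt_top hw.lt_top)]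
    refine integral_congr_ae ?_
    filter_upwards [entropy_ae_eq_toReal_pitmanYor hd0 hd1 hα] with w hw
    rw [hw, ENNReal.toReal_pow]
  simp only [Pi.pow_apply]
  rw [h2, ENNReal.toReal_ofReal (lintegral_eEntropy_sq_pitmanYor hd0 hd1 hα).1, integral_entropy_pitmanYor hd0 hd1 hα]
  ring

/-! ### The posterior law of the weights -/

/-- The weight `∏ₖ w_{σ k} ^ nₖ` of an injective tuple `σ` of indices. -/
noncomputable def tupleWeight {K : ℕ} (n : Fin K → ℕ) (σ : Fin K → ℕ) (w : ℕ → ℝ) : ENNReal :=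
  {σ : Fin K → ℕ | Function.Injective σ}.indicator (fun σ => ∏ k, ENNReal.ofReal (w (σ k)) ^ n k) σ

theorem tupleWeight_of_injective {K : ℕ} (n : Fin K → ℕ) {σ : Fin K → ℕ}
    (hσ : Function.Injective σ) (w : ℕ → ℝ) :
    tupleWeight n σ w = ∏ k, ENNReal.ofReal (w (σ k)) ^ n k :=
  Set.indicator_of_mem (s := {σ : Fin K → ℕ | Function.Injective σ}) hσ _

theorem tupleWeight_of_not_injective {K : ℕ} (n : Fin K → ℕ) {σ : Fin K → ℕ}
    (hσ : ¬ Function.Injective σ) (w : ℕ → ℝ) : tupleWeight n σ w = 0 :=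
  Set.indicator_of_notMem (s := {σ : Fin K → ℕ | Function.Injective σ}) hσ _

theorem measurable_tupleWeight {K : ℕ} (n : Fin K → ℕ) (σ : Fin K → ℕ) :
    Measurable (tupleWeight n σ) := by
  by_cases hσ : Function.Injective σ
  · rw [funext (tupleWeight_of_injective n hσ)]
    fun_prop
  · rw [funext (tupleWeight_of_not_injective n hσ)]
    exact measurable_const

theorem tupleWeight_perm {K : ℕ} (n : Fin K → ℕ) (σ : Fin K → ℕ) (τ : Equiv.Perm ℕ) (w : ℕ → ℝ) :
    tupleWeight n (τ ∘ σ) w = tupleWeight n σ (w ∘ τ) := by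
  by_cases hσ : Function.Injective σ
  · rw [tupleWeight_of_injective n hσ, tupleWeight_of_injective n (τ.injective.comp hσ)]
    rfl
  · rw [tupleWeight_of_not_injective n hσ, tupleWeight_of_not_injective]
    exact fun h => hσ h.of_comp

theorem tupleWeight_cons {K : ℕ} (m : ℕ) (n : Fin K → ℕ) (i : ℕ) (ρ : Fin K → ℕ) (w : ℕ → ℝ) :
    tupleWeight (Fin.cons (m + 1) n : Fin (K + 1) → ℕ) (Fin.cons i ρ : Fin (K + 1) → ℕ) w =
      ENNReal.ofReal (w i) *
        tupleWeight (Fin.cons m n : Fin (K + 1) → ℕ) (Fin.cons i ρ : Fin (K + 1) → ℕ) w := by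
  by_cases h : Function.Injective (Fin.cons i ρ : Fin (K + 1) → ℕ)
  · simp only [tupleWeight_of_injective _ h, Fin.prod_univ_succ, Fin.cons_zero, Fin.cons_succ,
      pow_succ']
    ring
  · simp only [tupleWeight_of_not_injective _ h, mul_zero]

theorem tupleWeight_cons_stickCons {K : ℕ} (m : ℕ) (n : Fin K → ℕ) (ρ : Fin K → ℕ) {v : ℝ}
    (hv0 : 0 ≤ v) (hv1 : v ≤ 1) (w : ℕ → ℝ) :
    tupleWeight (Fin.cons m n : Fin (K + 1) → ℕ)
        (Fin.cons 0 (fun k => ρ k + 1) : Fin (K + 1) → ℕ) (stickCons v w) =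
      ENNReal.ofReal (v ^ m * (1 - v) ^ ∑ k, n k) * tupleWeight n ρ w := by
  have hv : 0 ≤ 1 - v := by linarith
  have hiff : Function.Injective (Fin.cons 0 (fun k => ρ k + 1) : Fin (K + 1) → ℕ) ↔
      Function.Injective ρ := by
    rw [Fin.cons_injective_iff]
    constructor
    · exact fun h a b hab => h.2 (by simp [hab])
    · exact fun h => ⟨by simp, fun a b hab => h (by simpa using hab)⟩
  by_cases hρ : Function.Injective ρ
  · rw [tupleWeight_of_injective _ hρ, tupleWeight_of_injective _ (hiff.2 hρ),
      Fin.prod_univ_succ, ENNReal.ofReal_mul (by positivity), ENNReal.ofReal_pow hv0,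
      ENNReal.ofReal_pow hv, ← Finset.prod_pow_eq_pow_sum, mul_assoc, ← Finset.prod_mul_distrib]
    simp only [Fin.cons_zero, Fin.cons_succ, stickCons_zero, stickCons_succ,
      ENNReal.ofReal_mul hv, mul_pow]
  · rw [tupleWeight_of_not_injective _ hρ, tupleWeight_of_not_injective _ (hiff.not.2 hρ),
      mul_zero]

theorem tsum_tupleWeight_cons {K : ℕ} (n : Fin (K + 1) → ℕ) (w : ℕ → ℝ) (i : ℕ) (τ : Equiv.Perm ℕ) :
    ∑' ρ : Fin K → ℕ, tupleWeight n (Fin.cons (τ i) ρ : Fin (K + 1) → ℕ) w =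
      ∑' ρ : Fin K → ℕ, tupleWeight n (Fin.cons i ρ : Fin (K + 1) → ℕ) (w ∘ τ) := by
  rw [← (Equiv.arrowCongr (Equiv.refl (Fin K)) τ).tsum_eq]
  refine tsum_congr fun ρ => ?_
  rw [← tupleWeight_perm]
  congr 1
  funext k
  refine Fin.cases ?_ (fun k => ?_) k <;> simp

/-- An injective tuple starting at `0` has its other entries in the successors, hence is a shifted
injective tuple in the tail; each of its weights carries a factor `1 - v`. -/
theorem tsum_tupleWeight_zero {K : ℕ} (m : ℕ) (n : Fin K → ℕ) {v : ℝ}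
    (hv0 : 0 ≤ v) (hv1 : v ≤ 1) (w : ℕ → ℝ) :
    ∑' ρ : Fin K → ℕ, tupleWeight (Fin.cons m n : Fin (K + 1) → ℕ)
        (Fin.cons 0 ρ : Fin (K + 1) → ℕ) (stickCons v w) =
      ENNReal.ofReal (v ^ m * (1 - v) ^ ∑ k, n k) * ∑' ρ, tupleWeight n ρ w := by
  have hinj : Function.Injective fun (ρ : Fin K → ℕ) k => ρ k + 1 := fun a b hab => by
    funext k
    simpa using congrFun hab k
  rw [← hinj.tsum_eq, ← ENNReal.tsum_mul_left]
  · exact tsum_congr fun ρ => tupleWeight_cons_stickCons m n ρ hv0 hv1 w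
  · intro ρ hρ
    have h : Function.Injective (Fin.cons 0 ρ : Fin (K + 1) → ℕ) := by
      by_contra h
      exact hρ (tupleWeight_of_not_injective _ h _)
    have h0 := (Fin.cons_injective_iff.1 h).1
    refine ⟨fun k => ρ k - 1, funext fun k => ?_⟩
    have : ρ k ≠ 0 := fun hk => h0 ⟨k, hk⟩
    simp only
    omega

/-- Size-biased sampling of the first index of an injective tuple. -/
theorem lintegral_tsum_tupleWeight_succ {d α : ℝ} (hd0 : 0 ≤ d) (hd1 : d < 1) (hα : -d < α)
    {K : ℕ} (m : ℕ) (n : Fin K → ℕ) (t : ℝ) {φ : ENNReal → ENNReal} (hφ : Measurable φ) :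
    ∫⁻ w, (∑' σ, tupleWeight (Fin.cons (m + 1) n : Fin (K + 1) → ℕ) σ w) *
        φ (eEntropy fun i => t * w i) ∂pitmanYor d α =
      ∫⁻ v, ENNReal.ofReal (v ^ m * (1 - v) ^ ∑ k, n k) *
        ∫⁻ w, (∑' ρ, tupleWeight n ρ w) *
          φ (ENNReal.ofReal (negMulLog (t * v)) + eEntropy fun i => t * (1 - v) * w i)
          ∂pitmanYor d (α + d) ∂betaMeasure (1 - d) (α + d) := by
  have hE := measurable_eEntropy (ι := ℕ)
  have hW := fun σ => measurable_tupleWeight (Fin.cons m n : Fin (K + 1) → ℕ) σ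
  have hW' := measurable_tupleWeight n
  -- One factor `w i` is the size-biasing weight, which lowers the first exponent from `m + 1` to
  -- `m`; the sum over the other indices keeps `F` equivariant.
  set F : ℕ → (ℕ → ℝ) → ENNReal := fun i w =>
    (∑' ρ : Fin K → ℕ, tupleWeight (Fin.cons m n : Fin (K + 1) → ℕ)
      (Fin.cons i ρ : Fin (K + 1) → ℕ) w) * φ (eEntropy fun i => t * w i) with hF
  have hFm : ∀ i, Measurable (F i) := fun i =>
    (Measurable.tsum fun ρ => hW _).mul (hφ.comp (hE.comp (by fun_prop)))
  have hFe : PermEquivariant F := fun τ i w => by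
    simp only [hF]
    rw [tsum_tupleWeight_cons, ← eEntropy_comp_equiv (fun i => t * w i) τ]
    rfl
  have key := lintegral_tsum_pitmanYor hd0 hd1 hα hFe hFm
  rw [lintegral_pitmanYor hd0 hd1 hα (hFm 0)] at key
  refine Eq.trans (lintegral_congr fun w => ?_) (key.trans (lintegral_congr_ae ?_))
  · rw [← (Fin.consEquiv fun _ : Fin (K + 1) => ℕ).tsum_eq]
    change (∑' c : ℕ × (Fin K → ℕ), tupleWeight (Fin.cons (m + 1) n : Fin (K + 1) → ℕ)
      (Fin.cons c.1 c.2 : Fin (K + 1) → ℕ) w) * _ = _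
    rw [ENNReal.tsum_prod
      (f := fun i (ρ : Fin K → ℕ) => tupleWeight (Fin.cons (m + 1) n : Fin (K + 1) → ℕ)
        (Fin.cons i ρ : Fin (K + 1) → ℕ) w), ← ENNReal.tsum_mul_right]
    refine tsum_congr fun i => ?_
    simp only [tupleWeight_cons, ENNReal.tsum_mul_left, hF, mul_assoc]
  · filter_upwards [ae_betaMeasure_mem (1 - d) (α + d)] with v hv
    rw [← lintegral_const_mul]
    · refine lintegral_congr fun w => ?_
      simp only [hF]
      rw [tsum_tupleWeight_zero m n hv.1.le hv.2.le, mul_assoc,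
        show (fun i => t * stickCons v w i) = fun i => Nat.casesOn i (t * v)
          fun j => t * (1 - v) * w j from funext fun i => by cases i <;> simp [mul_assoc],
        eEntropy, tsum_eq_zero_add' ENNReal.summable]
      rfl
    · exact (Measurable.tsum fun ρ => hW' _).mul
        (hφ.comp (Measurable.const_add (hE.comp (by fun_prop)) _))

theorem eEntropy_sum {K : ℕ} (w : Fin K ⊕ ℕ → ℝ) :
    eEntropy w = ∑ k, ENNReal.ofReal (negMulLog (w (Sum.inl k))) +
      ∑' i, ENNReal.ofReal (negMulLog (w (Sum.inr i))) := by
  rw [eEntropy, ENNReal.summable.tsum_sum ENNReal.summable, tsum_fintype]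

@[fun_prop]
theorem measurable_piPost {K : ℕ} : Measurable (piPost (K := K)) := by
  refine measurable_pi_iff.2 fun i => ?_
  rcases i with k | i
  · change Measurable fun z : (Fin (K + 1) → ℝ) × (ℕ → ℝ) => z.1 k.castSucc
    fun_prop
  · change Measurable fun z : (Fin (K + 1) → ℝ) × (ℕ → ℝ) => z.1 (Fin.last K) * z.2 i
    fun_prop

theorem eEntropy_piPost_insertNth {K : ℕ} (t v : ℝ) (p : Fin (K + 1) → ℝ) (w : ℕ → ℝ) :
    eEntropy (fun i => t * piPost (K := K + 1)
        ((Fin.insertNth 0 v ((1 - v) • p) : Fin (K + 2) → ℝ), w) i) =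
      ENNReal.ofReal (negMulLog (t * v)) + eEntropy fun i => t * (1 - v) * piPost (p, w) i := by
  rw [eEntropy_sum, eEntropy_sum, Fin.sum_univ_succ, add_assoc]
  simp [piPost, pStar, mul_assoc, ← Fin.succ_last]

theorem pos_posteriorParam {d α : ℝ} (hd1 : d < 1) {K : ℕ} (hαK : 0 < α + K * d) {n : Fin K → ℕ}
    (hn : ∀ k, 1 ≤ n k) (i : Fin (K + 1)) :
    0 < (Fin.snoc (fun k => (n k : ℝ) - d) (α + K * d) : Fin (K + 1) → ℝ) i := by
  refine Fin.lastCases ?_ (fun k => ?_) i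
  · simpa using hαK
  · have : (1 : ℝ) ≤ n k := by exact_mod_cast hn k
    simp only [Fin.snoc_castSucc]
    linarith

theorem sum_posteriorParam (d α : ℝ) {K : ℕ} (n : Fin K → ℕ) :
    ∑ i, (Fin.snoc (fun k => (n k : ℝ) - d) (α + K * d) : Fin (K + 1) → ℝ) i =
      α + ∑ k, n k := by
  rw [Fin.sum_univ_castSucc]
  simp only [Fin.snoc_castSucc, Fin.snoc_last, Finset.sum_sub_distrib, Finset.sum_const,
    Finset.card_univ, Fintype.card_fin, nsmul_eq_mul]
  push_cast
  ring

theorem lintegral_posteriorLaw {d α : ℝ} (hd0 : 0 ≤ d) (hd1 : d < 1) {K : ℕ}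
    (hαK : 0 < α + K * d) (n : Fin K → ℕ) {f : (Fin (K + 1) → ℝ) × (ℕ → ℝ) → ENNReal}
    (hf : Measurable f) :
    ∫⁻ z, f z ∂posteriorLaw d α n =
      ∫⁻ p, ∫⁻ w, f (p, w) ∂pitmanYor d (α + K * d)
        ∂dirichlet (Fin.snoc (fun k => (n k : ℝ) - d) (α + K * d) : Fin (K + 1) → ℝ) := by
  have := isProbabilityMeasure_pitmanYor hd0 hd1 (show -d < α + K * d by linarith)
  rw [posteriorLaw, lintegral_prod _ hf.aemeasurable]

/-- The posterior law of the entropy of the weights, given the multiplicities of the sample. -/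
theorem exists_lintegral_tupleWeight_eq {d : ℝ} (hd0 : 0 ≤ d) (hd1 : d < 1) (K : ℕ) :
    ∀ {α : ℝ}, -d < α → 0 < α + K * d → ∀ n : Fin K → ℕ, (∀ k, 1 ≤ n k) →
      ∃ C : ENNReal, ∀ (t : ℝ) (φ : ENNReal → ENNReal), Measurable φ →
        ∫⁻ w, (∑' σ, tupleWeight n σ w) * φ (eEntropy fun i => t * w i) ∂pitmanYor d α =
          C * ∫⁻ z, φ (eEntropy fun i => t * piPost z i) ∂posteriorLaw d α n := by
  have hE := measurable_eEntropy (ι := ℕ)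
  -- The scale `t` and the general `φ` serve the induction: a removed stick `v` changes `t` to `t (1
  -- - v)` and adds `negMulLog (t v)` inside `φ`. Terms are matched one by one, so no range for `t`
  -- is imposed.
  induction K with
  | zero =>
    intro α hα hαK n hn
    have hP := isProbabilityMeasure_pitmanYor hd0 hd1 hα
    refine ⟨1, fun t φ hφ => ?_⟩
    have hE0 := measurable_eEntropy (ι := Fin 0 ⊕ ℕ)
    have hm : Measurable fun z : (Fin 1 → ℝ) × (ℕ → ℝ) =>
        φ (eEntropy fun i => t * piPost (K := 0) z i) := hφ.comp (hE0.comp (by fun_prop))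
    have hm' : Measurable fun p : Fin 1 → ℝ => ∫⁻ w, φ (eEntropy fun i => t * piPost (K := 0) (p, w) i)
        ∂pitmanYor d (α + (0 : ℕ) * d) := by
      have := isProbabilityMeasure_pitmanYor hd0 hd1 (show -d < α + (0 : ℕ) * d by simpa using hα)
      exact Measurable.lintegral_prod_right' hm
    -- Without observations the Dirichlet law is the point mass at `1`, so `p_* = 1` and the prior
    -- is recovered.
    rw [lintegral_posteriorLaw hd0 hd1 hαK n hm,
      dirichlet_one (pos_posteriorParam hd1 hαK hn), lintegral_dirac' _ hm', one_mul]
    simp only [Nat.cast_zero, zero_mul, add_zero]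
    refine lintegral_congr fun w => ?_
    rw [tsum_eq_single (Fin.elim0 : Fin 0 → ℕ) (fun σ hσ => absurd (Subsingleton.elim _ _) hσ),
      tupleWeight_of_injective _ (Function.injective_of_subsingleton _), eEntropy_sum]
    simp [piPost, pStar, eEntropy]
  | succ K ih =>
    intro α hα hαK n hn
    obtain ⟨m, hm⟩ : ∃ m, n 0 = m + 1 := ⟨n 0 - 1, by have := hn 0; omega⟩
    set n' : Fin K → ℕ := fun k => n k.succ with hn'
    have hcons : n = (Fin.cons (m + 1) n' : Fin (K + 1) → ℕ) := by
      funext k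
      refine Fin.cases ?_ (fun k => ?_) k <;> simp [hm, hn']
    have hα' : -d < α + d := by linarith
    have hKd : α + d + K * d = α + (K + 1 : ℕ) * d := by push_cast; ring
    have hαK' : 0 < α + d + K * d := by rw [hKd]; exact hαK
    obtain ⟨C, hC⟩ := ih hα' hαK' n' fun k => hn _
    have ha : 0 < 1 - d := by linarith
    have hb : 0 < α + d := by linarith
    -- The bias `v ^ m (1 - v) ^ ∑ n'` turns the first stick into `Beta(n₀ - d, α + d + ∑ n')`, the
    -- first stick of the posterior Dirichlet vector; the ratio of beta functions is its
    -- normalisation.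
    refine ⟨C * ENNReal.ofReal (beta (1 - d + m) (α + d + (∑ k, n' k : ℕ)) / beta (1 - d) (α + d)),
      fun t φ hφ => ?_⟩
    have hP := isProbabilityMeasure_pitmanYor hd0 hd1 (show -d < α + (K + 1 : ℕ) * d by linarith)
    have hEK := measurable_eEntropy (ι := Fin K ⊕ ℕ)
    have hEK1 := measurable_eEntropy (ι := Fin (K + 1) ⊕ ℕ)
    have hD := isProbabilityMeasure_dirichlet (pos_posteriorParam hd1 hαK' (n := n') fun k => hn _)
    have hmz : Measurable fun z : (Fin (K + 2) → ℝ) × (ℕ → ℝ) =>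
        φ (eEntropy fun i => t * piPost (K := K + 1) z i) := hφ.comp (hEK1.comp (by fun_prop))
    have hQ : SFinite (posteriorLaw d (α + d) n') := by
      unfold posteriorLaw
      rw [hKd] at hD ⊢
      infer_instance
    have hmv : Measurable fun v : ℝ => ∫⁻ z, φ (ENNReal.ofReal (negMulLog (t * v)) +
        eEntropy fun i => t * (1 - v) * piPost z i) ∂posteriorLaw d (α + d) n' :=
      Measurable.lintegral_prod_right'
        (f := fun z : ℝ × (Fin (K + 1) → ℝ) × (ℕ → ℝ) =>
          φ (ENNReal.ofReal (negMulLog (t * z.1)) +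
            eEntropy fun i => t * (1 - z.1) * piPost z.2 i))
        (hφ.comp (Measurable.add (by fun_prop) (hEK.comp (by fun_prop))))
    -- The other Dirichlet parameters are those of the problem with `K` values and `α + d`, since
    -- `(α + d) + K d = α + (K + 1) d`.
    have hpar : (fun j : Fin (K + 1) =>
        (Fin.snoc (fun k => (n k : ℝ) - d) (α + (K + 1 : ℕ) * d) : Fin (K + 2) → ℝ)
          (Fin.succAbove 0 j)) =
        (Fin.snoc (fun k => (n' k : ℝ) - d) (α + d + K * d) : Fin (K + 1) → ℝ) := by
      funext j
      refine Fin.lastCases ?_ (fun k => ?_) j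
      · rw [Fin.zero_succAbove, Fin.succ_last, Fin.snoc_last, Fin.snoc_last, hKd]
      · rw [Fin.zero_succAbove, Fin.succ_castSucc, Fin.snoc_castSucc, Fin.snoc_castSucc]
    have h0 : (Fin.snoc (fun k => (n k : ℝ) - d) (α + (K + 1 : ℕ) * d) : Fin (K + 2) → ℝ) 0 =
        1 - d + m := by
      rw [← Fin.castSucc_zero, Fin.snoc_castSucc, hm]
      push_cast
      ring
    rw [hcons, lintegral_tsum_tupleWeight_succ hd0 hd1 hα m n' t hφ, ← hcons]
    have e : ∀ v, ∫⁻ w, (∑' ρ, tupleWeight n' ρ w) *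
        φ (ENNReal.ofReal (negMulLog (t * v)) + eEntropy fun i => t * (1 - v) * w i)
          ∂pitmanYor d (α + d) = C * ∫⁻ z, φ (ENNReal.ofReal (negMulLog (t * v)) +
        eEntropy fun i => t * (1 - v) * piPost z i) ∂posteriorLaw d (α + d) n' := fun v =>
      hC (t * (1 - v)) (fun x => φ (ENNReal.ofReal (negMulLog (t * v)) + x))
        (hφ.comp (measurable_const_add _))
    simp only [e, mul_left_comm _ C]
    rw [lintegral_const_mul _ (Measurable.fun_mul (by fun_prop) hmv),
      lintegral_betaMeasure_pow_mul ha hb _ _ hmv, ← mul_assoc, lintegral_posteriorLaw hd0 hd1 hαK n hmz,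
      lintegral_dirichlet_split (pos_posteriorParam hd1 hαK hn) 0
        (Measurable.lintegral_prod_right' hmz), hpar, sum_posteriorParam, h0]
    congr 1
    rw [show α + d + (∑ k, n' k : ℕ) = α + d + ∑ k, (n' k : ℝ) by push_cast; rfl]
    refine lintegral_congr fun v => ?_
    rw [lintegral_posteriorLaw hd0 hd1 hαK', hKd]
    · simp only [eEntropy_piPost_insertNth]
    · exact hφ.comp (Measurable.const_add (hEK.comp (by fun_prop)) _)

/-! ### Sampling from a Pitman–Yor process -/

theorem prod_tsum_eq_tsum_prod {N : ℕ} (a : Fin N → ℕ → ENNReal) :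
    ∏ j, ∑' i, a j i = ∑' i : Fin N → ℕ, ∏ j, a j (i j) := by
  induction N with
  | zero => simp [tsum_fintype]
  | succ N ih =>
    rw [← (Fin.consEquiv fun _ : Fin (N + 1) => ℕ).tsum_eq]
    change _ = ∑' c : ℕ × (Fin N → ℕ), ∏ j, a j ((Fin.cons c.1 c.2 : Fin (N + 1) → ℕ) j)
    rw [ENNReal.tsum_prod (f := fun i (ρ : Fin N → ℕ) =>
      ∏ j, a j ((Fin.cons i ρ : Fin (N + 1) → ℕ) j)), Fin.prod_univ_succ, ih,
      ← ENNReal.tsum_mul_right]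
    simp only [Fin.prod_univ_succ, Fin.cons_zero, Fin.cons_succ, ENNReal.tsum_mul_left]

theorem discreteMeasure_apply {𝒳 : Type*} [MeasurableSpace 𝒳] (w : ℕ → ℝ) (φ : ℕ → 𝒳)
    {B : Set 𝒳} (hB : MeasurableSet B) :
    discreteMeasure w φ B = ∑' i, ENNReal.ofReal (w i) * B.indicator 1 (φ i) := by
  simp [discreteMeasure, Measure.sum_apply _ hB, Measure.dirac_apply' _ hB]

theorem prod_discreteMeasure {𝒳 : Type*} [MeasurableSpace 𝒳] (w : ℕ → ℝ) (φ : ℕ → 𝒳)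
    {N : ℕ} {B : Fin N → Set 𝒳} (hB : ∀ j, MeasurableSet (B j)) :
    ∏ j, discreteMeasure w φ (B j) =
      ∑' i : Fin N → ℕ, {i : Fin N → ℕ | φ ∘ i ∈ Set.univ.pi B}.indicator
        (fun i => ∏ j, ENNReal.ofReal (w (i j))) i := by
  simp only [discreteMeasure_apply w φ (hB _), prod_tsum_eq_tsum_prod]
  refine tsum_congr fun i => ?_
  by_cases h : φ ∘ i ∈ Set.univ.pi B
  · rw [Set.indicator_of_mem (by exact h)]
    refine Finset.prod_congr rfl fun j _ => ?_
    rw [Set.indicator_of_mem (by exact h j trivial), Pi.one_apply, mul_one]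
  · rw [Set.indicator_of_notMem (by exact h)]
    simp only [Set.mem_pi, Set.mem_univ, true_imp_iff, not_forall] at h
    obtain ⟨j, hj⟩ := h
    refine Finset.prod_eq_zero (Finset.mem_univ j) ?_
    rw [Set.indicator_of_notMem (by exact hj), mul_zero]

/-- The joint law of the weights, the atoms and the sample, as a sum over the indices of the
sampled atoms. -/
noncomputable def sampleLaw {𝒳 : Type*} [MeasurableSpace 𝒳]
    (ν : Measure ((ℕ → ℝ) × (ℕ → 𝒳))) (N : ℕ) :
    Measure (((ℕ → ℝ) × (ℕ → 𝒳)) × (Fin N → 𝒳)) :=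
  Measure.sum fun i : Fin N → ℕ =>
    (ν.withDensity fun p => ∏ j, ENNReal.ofReal (p.1 (i j))).map fun p => (p, fun j => p.2 (i j))

theorem lintegral_sampleLaw {𝒳 : Type*} [MeasurableSpace 𝒳]
    (ν : Measure ((ℕ → ℝ) × (ℕ → 𝒳))) (N : ℕ)
    {F : ((ℕ → ℝ) × (ℕ → 𝒳)) × (Fin N → 𝒳) → ENNReal} (hF : Measurable F) :
    ∫⁻ z, F z ∂sampleLaw ν N = ∑' i : Fin N → ℕ,
      ∫⁻ p, (∏ j, ENNReal.ofReal (p.1 (i j))) * F (p, fun j => p.2 (i j)) ∂ν := by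
  rw [sampleLaw, lintegral_sum_measure]
  refine tsum_congr fun i => ?_
  have hm : Measurable fun p : (ℕ → ℝ) × (ℕ → 𝒳) => (p, fun j => p.2 (i j)) := by fun_prop
  rw [lintegral_map hF hm]
  exact lintegral_withDensity_eq_lintegral_mul _ (by fun_prop) (hF.comp hm)

/-- It suffices to compare on rectangles, a generating π-system. There conditional independence
gives `∏ P(Bⱼ)`, and expanding each factor over the atoms gives a sum over index tuples. The latent
indices are thus summed over without being random variables of the model. -/
theorem IsPitmanYorSample.map_eq {Ω 𝒳 : Type*} [MeasurableSpace Ω] [MeasurableSpace 𝒳]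
    {μ : Measure Ω} [IsProbabilityMeasure μ] {G : Measure 𝒳} {d α : ℝ} {N : ℕ}
    {w : Ω → ℕ → ℝ} {φ : Ω → ℕ → 𝒳} {x : Ω → Fin N → 𝒳}
    (h : IsPitmanYorSample μ G d α w φ x) :
    μ.map (fun ω => ((w ω, φ ω), x ω)) =
      sampleLaw ((pitmanYor d α).prod (Measure.infinitePi fun _ : ℕ => G)) N := by
  have hw := h.measurable_w
  have hφ := h.measurable_φ
  have hx := h.measurable_x
  set ν := (pitmanYor d α).prod (Measure.infinitePi fun _ : ℕ => G) with hν
  have key : ∀ (E : Set ((ℕ → ℝ) × (ℕ → 𝒳))) (B : Fin N → Set 𝒳),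
      MeasurableSet E → (∀ j, MeasurableSet (B j)) →
      μ.map (fun ω => ((w ω, φ ω), x ω)) (E ×ˢ Set.univ.pi B) =
        sampleLaw ν N (E ×ˢ Set.univ.pi B) := by
    intro E B hE hB
    have hEB : MeasurableSet (E ×ˢ Set.univ.pi B) := hE.prod (MeasurableSet.univ_pi hB)
    rw [Measure.map_apply (by fun_prop) hEB, ← lintegral_indicator_one hEB,
      lintegral_sampleLaw _ _ (measurable_one.indicator hEB)]
    have e : (fun ω => ((w ω, φ ω), x ω)) ⁻¹' (E ×ˢ Set.univ.pi B) =
        {ω | (w ω, φ ω) ∈ E ∧ ∀ j, x ω j ∈ B j} := by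
      ext ω
      simp
    have hT : ∀ i : Fin N → ℕ, MeasurableSet
        {p : (ℕ → ℝ) × (ℕ → 𝒳) | p ∈ E ∧ (fun j => p.2 (i j)) ∈ Set.univ.pi B} := fun i =>
      hE.inter ((MeasurableSet.univ_pi hB).preimage
        (f := fun p : (ℕ → ℝ) × (ℕ → 𝒳) => fun j => p.2 (i j)) (by fun_prop))
    rw [e, h.sampling E B hE hB]
    have e2 : ∀ (i : Fin N → ℕ) (p : (ℕ → ℝ) × (ℕ → 𝒳)), (∏ j, ENNReal.ofReal (p.1 (i j))) *
        (E ×ˢ Set.univ.pi B).indicator (1 : ((ℕ → ℝ) × (ℕ → 𝒳)) × (Fin N → 𝒳) → ENNReal)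
          (p, fun j => p.2 (i j)) =
        {p : (ℕ → ℝ) × (ℕ → 𝒳) | p ∈ E ∧ (fun j => p.2 (i j)) ∈ Set.univ.pi B}.indicator
          (fun p => ∏ j, ENNReal.ofReal (p.1 (i j))) p := by
      intro i p
      by_cases hp : p ∈ E ∧ (fun j => p.2 (i j)) ∈ Set.univ.pi B
      · rw [Set.indicator_of_mem (by exact hp), Set.indicator_of_mem (by exact hp)]
        simp
      · rw [Set.indicator_of_notMem (by exact hp), Set.indicator_of_notMem (by exact hp), mul_zero]
    have hm : ∀ i : Fin N → ℕ, Measurable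
        ({p : (ℕ → ℝ) × (ℕ → 𝒳) | p ∈ E ∧ (fun j => p.2 (i j)) ∈ Set.univ.pi B}.indicator
          (fun p => ∏ j, ENNReal.ofReal (p.1 (i j)))) := fun i =>
      Measurable.indicator (by fun_prop) (hT i)
    simp only [e2]
    have hE' : MeasurableSet {ω | (w ω, φ ω) ∈ E} :=
      hE.preimage (f := fun ω => (w ω, φ ω)) (by fun_prop)
    rw [← lintegral_tsum fun i => (hm i).aemeasurable, hν, ← h.prior,
      lintegral_map (Measurable.tsum hm) (by fun_prop), ← lintegral_indicator hE']
    refine lintegral_congr fun ω => ?_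
    by_cases hω : (w ω, φ ω) ∈ E
    · rw [Set.indicator_of_mem (by exact hω), prod_discreteMeasure _ _ hB]
      refine tsum_congr fun i => ?_
      by_cases hi : φ ω ∘ i ∈ Set.univ.pi B
      · rw [Set.indicator_of_mem (by exact hi), Set.indicator_of_mem (by exact ⟨hω, hi⟩)]
      · rw [Set.indicator_of_notMem (by exact hi),
          Set.indicator_of_notMem (by exact fun hc => hi hc.2)]
    · rw [Set.indicator_of_notMem (by exact hω)]
      refine (ENNReal.tsum_eq_zero.2 fun i => ?_).symm
      rw [Set.indicator_of_notMem (by exact fun hc => hω hc.1)]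
  have := Measure.isProbabilityMeasure_map (μ := μ) (f := fun ω => ((w ω, φ ω), x ω)) (by fun_prop)
  refine ext_of_generate_finite
    (Set.image2 (· ×ˢ ·) {E : Set ((ℕ → ℝ) × (ℕ → 𝒳)) | MeasurableSet E}
      (Set.univ.pi '' Set.univ.pi fun _ : Fin N => {B : Set 𝒳 | MeasurableSet B})) ?_ ?_ ?_ ?_
  · exact (generateFrom_eq_prod MeasurableSpace.generateFrom_measurableSet generateFrom_pi
      isCountablySpanning_measurableSet
      (IsCountablySpanning.pi fun _ => isCountablySpanning_measurableSet)).symm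
  · exact MeasurableSpace.isPiSystem_measurableSet.prod isPiSystem_pi
  · rintro _ ⟨E, hE, _, ⟨B, hB, rfl⟩, rfl⟩
    exact key E B hE fun j => hB j trivial
  · have := key Set.univ (fun _ => Set.univ) MeasurableSet.univ fun _ => MeasurableSet.univ
    simpa using this

theorem IsPitmanYorSample.lintegral_eq {Ω 𝒳 : Type*} [MeasurableSpace Ω] [MeasurableSpace 𝒳]
    {μ : Measure Ω} [IsProbabilityMeasure μ] {G : Measure 𝒳} {d α : ℝ} {N : ℕ}
    {w : Ω → ℕ → ℝ} {φ : Ω → ℕ → 𝒳} {x : Ω → Fin N → 𝒳}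
    (h : IsPitmanYorSample μ G d α w φ x)
    {F : ((ℕ → ℝ) × (ℕ → 𝒳)) × (Fin N → 𝒳) → ENNReal} (hF : Measurable F) :
    ∫⁻ ω, F ((w ω, φ ω), x ω) ∂μ = ∑' i : Fin N → ℕ,
      ∫⁻ p, (∏ j, ENNReal.ofReal (p.1 (i j))) * F (p, fun j => p.2 (i j))
        ∂(pitmanYor d α).prod (Measure.infinitePi fun _ : ℕ => G) := by
  have hw := h.measurable_w
  have hφ := h.measurable_φ
  have hx := h.measurable_x
  rw [← lintegral_sampleLaw _ _ hF, ← h.map_eq, lintegral_map hF (by fun_prop)]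

/-! ### Distinct atoms and patterns of ties -/

section Atoms

variable {𝒳 : Type*} [MeasurableSpace 𝒳] (G : Measure 𝒳) [IsProbabilityMeasure G]

theorem ae_injective_infinitePi [MeasurableEq 𝒳] [NullSingletonClass G] :
    ∀ᵐ φ ∂Measure.infinitePi fun _ : ℕ => G, Function.Injective φ := by
  have h : ∀ i j : ℕ, i ≠ j → ∀ᵐ φ ∂Measure.infinitePi fun _ : ℕ => G, φ i ≠ φ j := by
    intro i j hij
    have h1 : ∀ᵐ p ∂G.prod G, p ∉ Set.diagonal 𝒳 := by
      refine measure_eq_zero_iff_ae_notMem.1 ?_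
      rw [Measure.prod_apply measurableSet_diagonal]
      have : ∀ x : 𝒳, Prod.mk x ⁻¹' Set.diagonal 𝒳 = {x} := fun x => by
        ext y
        simp [eq_comm]
      simp [this]
    rw [← Measure.infinitePi_map_eval_prod (P := fun _ : ℕ => G) hij] at h1
    exact ae_of_ae_map (f := fun φ : ℕ → 𝒳 => (φ i, φ j)) (by fun_prop) h1
  have h' : ∀ᵐ φ ∂Measure.infinitePi fun _ : ℕ => G, ∀ i j, i ≠ j → φ i ≠ φ j := by
    simp only [ae_all_iff]
    exact h
  filter_upwards [h'] with φ hφ i j hij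
  by_contra hne
  exact hφ i j hne hij

theorem map_comp_infinitePi {K : ℕ} {σ : Fin K → ℕ} (hσ : Function.Injective σ) :
    (Measure.infinitePi fun _ : ℕ => G).map (fun φ k => φ (σ k)) = Measure.pi fun _ => G := by
  have h := (iIndepFun_infinitePi (P := fun _ : ℕ => G) (X := fun _ x => x)
    fun _ => measurable_id).precomp hσ
  rw [iIndepFun_iff_map_fun_eq_pi_map (fun i => (measurable_pi_apply (σ i)).aemeasurable)] at h
  rw [h]
  simp only [Measure.infinitePi_map_eval]

/-- Distinct atoms make the ties of the sample those of the index tuple `i`; the distinct values are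
then `K` independent draws from `G`. For compatible `i` the probability does not depend on `i`,
which separates the values from the weights. -/
theorem measure_infinitePi_pattern [MeasurableEq 𝒳] [NullSingletonClass G] {K N : ℕ}
    {f : Fin N → Fin K} (hf : Function.Surjective f) {S : Set (Fin N → 𝒳)} (hS : MeasurableSet S)
    (i : Fin N → ℕ) :
    (Measure.infinitePi fun _ : ℕ => G)
        {φ | (fun j => φ (i j)) ∈ S ∩ {y | ∀ a b, y a = y b ↔ f a = f b}} =
      {i : Fin N → ℕ | ∀ a b, i a = i b ↔ f a = f b}.indicator
        (fun _ => (Measure.pi fun _ : Fin K => G) {y | (fun j => y (f j)) ∈ S}) i := by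
  by_cases hi : ∀ a b, i a = i b ↔ f a = f b
  · rw [Set.indicator_of_mem (by exact hi)]
    -- The index attached to the block `k` is read off at a chosen position of that block.
    have hσ : Function.Injective fun k => i (Function.surjInv hf k) := fun k l hkl => by
      have := (hi _ _).1 hkl
      rwa [Function.surjInv_eq hf, Function.surjInv_eq hf] at this
    have hiσ : ∀ j, i j = i (Function.surjInv hf (f j)) := fun j =>
      (hi _ _).2 (Function.surjInv_eq hf (f j)).symm
    have hS' : MeasurableSet {y : Fin K → 𝒳 | (fun j => y (f j)) ∈ S} :=
      hS.preimage (f := fun (y : Fin K → 𝒳) j => y (f j)) (by fun_prop)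
    rw [← map_comp_infinitePi G hσ, Measure.map_apply (by fun_prop) hS']
    refine measure_congr ?_
    filter_upwards [ae_injective_infinitePi G] with φ hφ
    apply propext
    change ((fun j => φ (i j)) ∈ S ∧ ∀ a b, φ (i a) = φ (i b) ↔ f a = f b) ↔
      (fun j => φ (i (Function.surjInv hf (f j)))) ∈ S
    simp only [hφ.eq_iff, hi, implies_true, and_true, ← hiσ]
  · rw [Set.indicator_of_notMem (by exact hi)]
    refine measure_mono_null_ae ?_ measure_empty
    filter_upwards [ae_injective_infinitePi G] with φ hφ hc
    exact hi fun a b => by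
      have := hc.2 a b
      simpa only [hφ.eq_iff] using this

end Atoms

theorem measurableSet_pattern {𝒳 : Type*} [MeasurableSpace 𝒳] [MeasurableEq 𝒳] {K N : ℕ}
    (f : Fin N → Fin K) : MeasurableSet {y : Fin N → 𝒳 | ∀ a b, y a = y b ↔ f a = f b} := by
  simp only [Set.ofPred_forall]
  refine MeasurableSet.iInter fun a => MeasurableSet.iInter fun b => ?_
  by_cases h : f a = f b
  · simp only [h, iff_true]
    exact measurableSet_eq_fun (by fun_prop) (by fun_prop)
  · simp only [h, iff_false]
    exact (measurableSet_eq_fun (f := fun y : Fin N → 𝒳 => y a) (g := fun y => y b)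
      (by fun_prop) (by fun_prop)).compl

theorem prod_comp_eq_prod_pow {M : Type*} [CommMonoid M] {K N : ℕ} {f : Fin N → Fin K}
    {n : Fin K → ℕ}
    (hf : ∀ k, (Finset.univ.filter fun j => f j = k).card = n k) (g : Fin K → M) :
    ∏ j, g (f j) = ∏ k, g k ^ n k := by
  rw [← Finset.prod_fiberwise' Finset.univ f g]
  refine Finset.prod_congr rfl fun k _ => ?_
  rw [Finset.prod_const, hf]

/-- The joint law of the weights and the sample, on the event that the pattern of ties of the sample
is given by `f`. -/
theorem IsPitmanYorSample.lintegral_pattern {Ω 𝒳 : Type*} [MeasurableSpace Ω] [MeasurableSpace 𝒳]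
    [MeasurableEq 𝒳] {μ : Measure Ω} [IsProbabilityMeasure μ] {G : Measure 𝒳}
    [IsProbabilityMeasure G] [NullSingletonClass G] {d α : ℝ} (hd0 : 0 ≤ d) (hd1 : d < 1)
    (hα : -d < α) {N : ℕ} {w : Ω → ℕ → ℝ} {φ : Ω → ℕ → 𝒳} {x : Ω → Fin N → 𝒳}
    (h : IsPitmanYorSample μ G d α w φ x) {K : ℕ} {n : Fin K → ℕ} (hn : ∀ k, 1 ≤ n k)
    {f : Fin N → Fin K} (hf : ∀ k, (Finset.univ.filter fun j => f j = k).card = n k)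
    {S : Set (Fin N → 𝒳)} (hS : MeasurableSet S) {g : ENNReal → ENNReal} (hg : Measurable g) :
    ∫⁻ ω in x ⁻¹' (S ∩ {y | ∀ a b, y a = y b ↔ f a = f b}), g (eEntropy (w ω)) ∂μ =
      (Measure.pi fun _ : Fin K => G) {y | (fun j => y (f j)) ∈ S} *
        ∫⁻ w, (∑' σ, tupleWeight n σ w) * g (eEntropy w) ∂pitmanYor d α := by
  have hP := isProbabilityMeasure_pitmanYor hd0 hd1 hα
  have hE := measurable_eEntropy (ι := ℕ)
  have hx := h.measurable_x
  have hsurj : Function.Surjective f := fun k => by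
    have : 0 < (Finset.univ.filter fun j => f j = k).card := by rw [hf]; exact hn k
    obtain ⟨j, hj⟩ := Finset.card_pos.1 this
    exact ⟨j, by simpa using hj⟩
  set T := S ∩ {y : Fin N → 𝒳 | ∀ a b, y a = y b ↔ f a = f b} with hTdef
  have hT : MeasurableSet T := hS.inter (measurableSet_pattern f)
  set c := (Measure.pi fun _ : Fin K => G) {y | (fun j => y (f j)) ∈ S} with hc
  have hgE : Measurable fun w : ℕ → ℝ => g (eEntropy w) := hg.comp hE
  have hI : Measurable (T.indicator (1 : (Fin N → 𝒳) → ENNReal)) := measurable_one.indicator hT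
  have hF : Measurable fun z : ((ℕ → ℝ) × (ℕ → 𝒳)) × (Fin N → 𝒳) =>
      g (eEntropy z.1.1) * T.indicator 1 z.2 := by
    refine Measurable.mul ?_ (hI.comp measurable_snd)
    exact hgE.comp (measurable_fst.comp measurable_fst)
  have h1 := h.lintegral_eq hF
  rw [← lintegral_indicator (hT.preimage hx)]
  have e1 : ∀ ω, (x ⁻¹' T).indicator (fun ω => g (eEntropy (w ω))) ω =
      g (eEntropy (w ω)) * T.indicator 1 (x ω) := fun ω => by
    by_cases hω : x ω ∈ T
    · rw [Set.indicator_of_mem (by exact hω), Set.indicator_of_mem hω]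
      simp
    · rw [Set.indicator_of_notMem (by exact hω), Set.indicator_of_notMem hω, mul_zero]
  simp only [e1]
  rw [h1]
  -- Weights and atoms are independent, so each term is a weight integral times an atom probability.
  have e2 : ∀ i : Fin N → ℕ,
      ∫⁻ p, (∏ j, ENNReal.ofReal (p.1 (i j))) * (g (eEntropy p.1) *
          T.indicator 1 (fun j => p.2 (i j)))
        ∂(pitmanYor d α).prod (Measure.infinitePi fun _ : ℕ => G) =
      (∫⁻ w, (∏ j, ENNReal.ofReal (w (i j))) * g (eEntropy w) ∂pitmanYor d α) *
        {i : Fin N → ℕ | ∀ a b, i a = i b ↔ f a = f b}.indicator (fun _ => c) i := by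
    intro i
    rw [← measure_infinitePi_pattern G hsurj hS i]
    have hTi : MeasurableSet {φ : ℕ → 𝒳 | (fun j => φ (i j)) ∈ T} :=
      hT.preimage (f := fun (φ : ℕ → 𝒳) j => φ (i j)) (by fun_prop)
    rw [← lintegral_indicator_one hTi, ← lintegral_prod_mul]
    · refine lintegral_congr fun p => ?_
      rw [mul_assoc]
      rfl
    · exact (Measurable.fun_mul (by fun_prop) hgE).aemeasurable
    · exact (measurable_one.indicator hTi).aemeasurable
  simp only [e2]
  -- Index tuples with the ties of `f` are exactly `σ ∘ f` with `σ` injective, so the sum is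
  -- reindexed by `σ`.
  have hinj : Function.Injective fun (σ : Fin K → ℕ) j => σ (f j) := hsurj.injective_comp_right
  have hmem : ∀ σ : Fin K → ℕ, (∀ a b, σ (f a) = σ (f b) ↔ f a = f b) ↔ Function.Injective σ :=
    fun σ => by
      constructor
      · intro hσ k l hkl
        obtain ⟨a, rfl⟩ := hsurj k
        obtain ⟨b, rfl⟩ := hsurj l
        exact (hσ a b).1 hkl
      · exact fun hσ a b => hσ.eq_iff
  rw [← hinj.tsum_eq]
  · have hWm := fun σ => measurable_tupleWeight n σ
    simp only [← ENNReal.tsum_mul_right]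
    rw [lintegral_tsum fun σ => (Measurable.fun_mul (hWm σ) hgE).aemeasurable,
      ← ENNReal.tsum_mul_left]
    refine tsum_congr fun σ => ?_
    by_cases hσ : Function.Injective σ
    · rw [Set.indicator_of_mem (by exact (hmem σ).2 hσ), mul_comm]
      congr 1
      refine lintegral_congr fun w => ?_
      rw [tupleWeight_of_injective n hσ,
        prod_comp_eq_prod_pow hf fun k => ENNReal.ofReal (w (σ k))]
    · rw [Set.indicator_of_notMem (by exact fun hc => hσ ((hmem σ).1 hc))]
      simp [tupleWeight_of_not_injective n hσ]
  · intro i hi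
    have hi' : ∀ a b, i a = i b ↔ f a = f b := by
      by_contra hne
      exact hi (by simp only [Set.indicator_of_notMem (s := {i : Fin N → ℕ |
        ∀ a b, i a = i b ↔ f a = f b}) hne, mul_zero])
    exact ⟨fun k => i (Function.surjInv hsurj k), funext fun j =>
      (hi' _ _).2 (Function.surjInv_eq hsurj (f j))⟩

/-! ### The components of the posterior vector -/

@[fun_prop]
theorem measurable_pStar {K : ℕ} : Measurable (pStar (K := K)) :=
  (measurable_pi_apply (Fin.last K)).comp measurable_fst

@[fun_prop]
theorem measurable_pObs {K : ℕ} : Measurable (pObs (K := K)) := by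
  refine measurable_pi_iff.2 fun k => ?_
  change Measurable fun z : (Fin (K + 1) → ℝ) × (ℕ → ℝ) => z.1 k.castSucc / (1 - pStar z)
  fun_prop

theorem isProbabilityMeasure_posteriorLaw {d α : ℝ} (hd0 : 0 ≤ d) (hd1 : d < 1) {K : ℕ}
    (hαK : 0 < α + K * d) {n : Fin K → ℕ} (hn : ∀ k, 1 ≤ n k) :
    IsProbabilityMeasure (posteriorLaw d α n) := by
  have := isProbabilityMeasure_pitmanYor hd0 hd1 (show -d < α + K * d by linarith)
  have := isProbabilityMeasure_dirichlet (pos_posteriorParam hd1 hαK hn)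
  unfold posteriorLaw
  infer_instance

theorem sub_pos_of_one_le_multiplicity {d : ℝ} (hd1 : d < 1) {K : ℕ} {n : Fin K → ℕ} (hn : ∀ k, 1 ≤ n k)
    (k : Fin K) : 0 < (n k : ℝ) - d := by
  have : (1 : ℝ) ≤ n k := by exact_mod_cast hn k
  linarith

/-- `p_*`, `𝐩` and `π` are independent, with Beta, Dirichlet and Pitman–Yor laws. -/
theorem measurePreserving_posteriorLaw {d α : ℝ} (hd0 : 0 ≤ d) (hd1 : d < 1) {m : ℕ}
    (hαK : 0 < α + (m + 1 : ℕ) * d) {n : Fin (m + 1) → ℕ} (hn : ∀ k, 1 ≤ n k) :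
    MeasurePreserving (fun z => (pStar z, pObs z, z.2)) (posteriorLaw d α n)
      ((betaMeasure (α + (m + 1 : ℕ) * d) (∑ k, ((n k : ℝ) - d))).prod
        ((dirichlet fun k => (n k : ℝ) - d).prod (pitmanYor d (α + (m + 1 : ℕ) * d)))) := by
  have hP := isProbabilityMeasure_pitmanYor hd0 hd1
    (show -d < α + (m + 1 : ℕ) * d by linarith)
  have hD := isProbabilityMeasure_dirichlet (sub_pos_of_one_le_multiplicity hd1 hn)
  have hT : Measurable fun z : (Fin (m + 2) → ℝ) × (ℕ → ℝ) => (pStar z, pObs z, z.2) := by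
    fun_prop
  refine ⟨hT, Measure.ext_of_lintegral _ fun F hF => ?_⟩
  have hFT : Measurable fun z : (Fin (m + 2) → ℝ) × (ℕ → ℝ) => F (pStar z, pObs z, z.2) :=
    hF.comp hT
  -- Splitting the Dirichlet vector at its last coordinate gives `p_*` as the stick, and division by
  -- `1 - p_*` recovers the independent remainder.
  rw [lintegral_map hF hT, lintegral_posteriorLaw hd0 hd1 hαK n hFT,
    lintegral_dirichlet_split (pos_posteriorParam hd1 hαK hn) (Fin.last _)
      (Measurable.lintegral_prod_right' hFT), lintegral_prod _ hF.aemeasurable]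
  simp only [Fin.succAbove_last, Fin.snoc_castSucc, Fin.snoc_last]
  refine lintegral_congr_ae ?_
  filter_upwards [ae_betaMeasure_mem (α + (m + 1 : ℕ) * d) (∑ k, ((n k : ℝ) - d))] with u hu
  have hFu : Measurable fun q : (Fin (m + 1) → ℝ) × (ℕ → ℝ) => F (u, q) := by fun_prop
  rw [lintegral_prod _ hFu.aemeasurable]
  refine lintegral_congr fun p => lintegral_congr fun w => ?_
  have hu1 : 1 - u ≠ 0 := by linarith [hu.2]
  congr 3
  · simp [pStar]
  · funext k
    have : (Fin.insertNth (Fin.last (m + 1)) u ((1 - u) • p) : Fin (m + 2) → ℝ) k.castSucc =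
        (1 - u) * p k := by
      rw [← Fin.succAbove_last_apply, Fin.insertNth_apply_succAbove]
      rfl
    simp only [pObs, pStar, this, Fin.insertNth_apply_same]
    field_simp

theorem hasSum_of_tsum_ofReal_eq_one {w : ℕ → ℝ} (hw : ∀ i, 0 ≤ w i)
    (h : ∑' i, ENNReal.ofReal (w i) = 1) : HasSum w 1 := by
  have h1 := ENNReal.hasSum_toReal (f := fun i => ENNReal.ofReal (w i)) (by simp [h])
  rw [← ENNReal.tsum_toReal_eq fun i => ENNReal.ofReal_ne_top, h] at h1
  simpa only [ENNReal.toReal_ofReal (hw _), ENNReal.toReal_one] using h1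

/-- The chain rule for the entropy of `π_post`. -/
theorem hasSum_negMulLog_piPost {K : ℕ} {z : (Fin (K + 1) → ℝ) × (ℕ → ℝ)} (h1 : pStar z < 1)
    (hp : ∑ k, pObs z k = 1) (hw : HasSum z.2 1) (hs : Summable fun i => negMulLog (z.2 i)) :
    HasSum (fun i => negMulLog (piPost z i))
      ((1 - pStar z) * entropy (pObs z) + pStar z * entropy z.2 + binEntropy (pStar z)) := by
  have h1' : 1 - pStar z ≠ 0 := by linarith
  have hl : HasSum ((fun i => negMulLog (piPost z i)) ∘ Sum.inl)
      (negMulLog (1 - pStar z) + (1 - pStar z) * entropy (pObs z)) := by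
    have e : ((fun i => negMulLog (piPost z i)) ∘ Sum.inl) = fun k =>
        pObs z k * negMulLog (1 - pStar z) + (1 - pStar z) * negMulLog (pObs z k) := by
      funext k
      rw [← negMulLog_mul]
      simp only [Function.comp, piPost, Sum.elim_inl, pObs]
      congr 1
      field_simp
    rw [e, entropy, tsum_fintype]
    convert hasSum_fintype _ using 1
    rw [Finset.sum_add_distrib, ← Finset.sum_mul, hp, one_mul, Finset.mul_sum]
  have hr : HasSum ((fun i => negMulLog (piPost z i)) ∘ Sum.inr)
      (1 * negMulLog (pStar z) + pStar z * entropy z.2) := by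
    have e : ((fun i => negMulLog (piPost z i)) ∘ Sum.inr) = fun i =>
        z.2 i * negMulLog (pStar z) + pStar z * negMulLog (z.2 i) := by
      funext i
      rw [← negMulLog_mul]
      rfl
    rw [e]
    exact (hw.mul_right _).add (hs.hasSum.mul_left _)
  convert hl.sum hr using 1
  rw [binEntropy_eq_negMulLog_add_negMulLog_one_sub]
  ring

/-! ### The variance of a random convex combination -/

theorem integrable_prod_mul_mul {S T U : Type*} [MeasurableSpace S] [MeasurableSpace T]
    [MeasurableSpace U] {β : Measure S} {ρ : Measure T} {τ : Measure U} {f : S → ℝ} {g : T → ℝ}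
    {h : U → ℝ} (hf : Integrable f β) (hg : Integrable g ρ) (hh : Integrable h τ) :
    Integrable (fun q => f q.1 * (g q.2.1 * h q.2.2)) (β.prod (ρ.prod τ)) :=
  hf.mul_prod (hg.mul_prod hh)

section Mixture

variable {S T U : Type*} [MeasurableSpace S] [MeasurableSpace T] [MeasurableSpace U]
  {β : Measure S} {ρ : Measure T} {τ : Measure U} [IsProbabilityMeasure β] [IsProbabilityMeasure ρ]
  [IsProbabilityMeasure τ] {F₁ F₂ F₃ : S → ℝ} {X : T → ℝ} {Y : U → ℝ}

theorem integral_prod_mul_mul (f : S → ℝ) (g : T → ℝ) (h : U → ℝ) :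
    ∫ q, f q.1 * (g q.2.1 * h q.2.2) ∂β.prod (ρ.prod τ) =
      (∫ s, f s ∂β) * ((∫ t, g t ∂ρ) * ∫ u, h u ∂τ) := by
  rw [integral_prod_mul f fun q : T × U => g q.1 * h q.2, integral_prod_mul]

/-- The square expands into six products of functions of separate variables; each of the three cross
terms contains a centred factor `X` or `Y`. -/
theorem integral_mixture_sq (h₁ : MemLp F₁ 2 β) (h₂ : MemLp F₂ 2 β) (h₃ : MemLp F₃ 2 β)
    (hX : MemLp X 2 ρ) (hY : MemLp Y 2 τ) (hX0 : ∫ t, X t ∂ρ = 0) (hY0 : ∫ u, Y u ∂τ = 0) :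
    Integrable (fun q => (F₁ q.1 * X q.2.1 + F₂ q.1 * Y q.2.2 + F₃ q.1) ^ 2)
      (β.prod (ρ.prod τ)) ∧
    ∫ q, (F₁ q.1 * X q.2.1 + F₂ q.1 * Y q.2.2 + F₃ q.1) ^ 2 ∂β.prod (ρ.prod τ) =
      (∫ s, F₁ s ^ 2 ∂β) * (∫ t, X t ^ 2 ∂ρ) + (∫ s, F₂ s ^ 2 ∂β) * (∫ u, Y u ^ 2 ∂τ) +
        ∫ s, F₃ s ^ 2 ∂β := by
  have iX := hX.integrable (by norm_num)
  have iY := hY.integrable (by norm_num)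
  have icρ : Integrable (fun _ : T => (1 : ℝ)) ρ := integrable_const 1
  have icτ : Integrable (fun _ : U => (1 : ℝ)) τ := integrable_const 1
  have j1 := integrable_prod_mul_mul h₁.integrable_sq hX.integrable_sq icτ
  have j2 := integrable_prod_mul_mul h₂.integrable_sq icρ hY.integrable_sq
  have j3 := integrable_prod_mul_mul h₃.integrable_sq icρ icτ
  have j4 := integrable_prod_mul_mul (h₁.integrable_mul h₂) iX iY
  have j5 := integrable_prod_mul_mul (h₁.integrable_mul h₃) iX icτ
  have j6 := integrable_prod_mul_mul (h₂.integrable_mul h₃) icρ iY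
  have e1 := integral_prod_mul_mul (β := β) (ρ := ρ) (τ := τ) (fun s => F₁ s ^ 2)
    (fun t => X t ^ 2) fun _ => 1
  have e2 := integral_prod_mul_mul (β := β) (ρ := ρ) (τ := τ) (fun s => F₂ s ^ 2)
    (fun _ => 1) fun u => Y u ^ 2
  have e3 := integral_prod_mul_mul (β := β) (ρ := ρ) (τ := τ) (fun s => F₃ s ^ 2)
    (fun _ => 1) fun _ => 1
  have e4 := integral_prod_mul_mul (β := β) (ρ := ρ) (τ := τ) (F₁ * F₂) X Y
  have e5 := integral_prod_mul_mul (β := β) (ρ := ρ) (τ := τ) (F₁ * F₃) X fun _ => 1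
  have e6 := integral_prod_mul_mul (β := β) (ρ := ρ) (τ := τ) (F₂ * F₃) (fun _ => 1) Y
  have e : (fun q : S × T × U => (F₁ q.1 * X q.2.1 + F₂ q.1 * Y q.2.2 + F₃ q.1) ^ 2) = fun q =>
      F₁ q.1 ^ 2 * (X q.2.1 ^ 2 * 1) + F₂ q.1 ^ 2 * (1 * Y q.2.2 ^ 2) + F₃ q.1 ^ 2 * (1 * 1) +
        2 * ((F₁ * F₂) q.1 * (X q.2.1 * Y q.2.2)) + 2 * ((F₁ * F₃) q.1 * (X q.2.1 * 1)) +
        2 * ((F₂ * F₃) q.1 * (1 * Y q.2.2)) := by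
    funext q
    simp only [Pi.mul_apply]
    ring
  rw [e]
  have i2 := j1.fun_add j2
  have i3 := i2.fun_add j3
  have i4 := i3.fun_add (j4.const_mul 2)
  have i5 := i4.fun_add (j5.const_mul 2)
  refine ⟨i5.fun_add (j6.const_mul 2), ?_⟩
  rw [integral_add i5 (j6.const_mul 2), integral_add i4 (j5.const_mul 2),
    integral_add i3 (j4.const_mul 2), integral_add i2 j3, integral_add j1 j2,
    integral_const_mul, integral_const_mul, integral_const_mul, e1, e2, e3, e4, e5, e6, hX0, hY0]
  simp

theorem integral_mixture (h₁ : MemLp F₁ 2 β) (h₂ : MemLp F₂ 2 β) (h₃ : MemLp F₃ 2 β)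
    (hX : MemLp X 2 ρ) (hY : MemLp Y 2 τ) (hX0 : ∫ t, X t ∂ρ = 0) (hY0 : ∫ u, Y u ∂τ = 0) :
    ∫ q, (F₁ q.1 * X q.2.1 + F₂ q.1 * Y q.2.2 + F₃ q.1) ∂β.prod (ρ.prod τ) = ∫ s, F₃ s ∂β := by
  have icρ : Integrable (fun _ : T => (1 : ℝ)) ρ := integrable_const 1
  have icτ : Integrable (fun _ : U => (1 : ℝ)) τ := integrable_const 1
  have j1 := integrable_prod_mul_mul (h₁.integrable (by norm_num)) (hX.integrable (by norm_num))
    icτ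
  have j2 := integrable_prod_mul_mul (h₂.integrable (by norm_num)) icρ
    (hY.integrable (by norm_num))
  have j3 := integrable_prod_mul_mul (h₃.integrable (by norm_num)) icρ icτ
  have e1 := integral_prod_mul_mul (β := β) (ρ := ρ) (τ := τ) F₁ X fun _ => 1
  have e2 := integral_prod_mul_mul (β := β) (ρ := ρ) (τ := τ) F₂ (fun _ => 1) Y
  have e3 := integral_prod_mul_mul (β := β) (ρ := ρ) (τ := τ) F₃ (fun _ => 1) fun _ => 1
  have e : (fun q : S × T × U => F₁ q.1 * X q.2.1 + F₂ q.1 * Y q.2.2 + F₃ q.1) = fun q =>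
      F₁ q.1 * (X q.2.1 * 1) + F₂ q.1 * (1 * Y q.2.2) + F₃ q.1 * (1 * 1) := by
    funext q
    ring
  rw [e, integral_add (j1.fun_add j2) j3, integral_add j1 j2, e1, e2, e3, hX0, hY0]
  simp

theorem memLp_mixture (h₁ : MemLp F₁ 2 β) (h₂ : MemLp F₂ 2 β) (h₃ : MemLp F₃ 2 β)
    (hX : MemLp X 2 ρ) (hY : MemLp Y 2 τ) (hX0 : ∫ t, X t ∂ρ = 0) (hY0 : ∫ u, Y u ∂τ = 0) :
    MemLp (fun q => F₁ q.1 * X q.2.1 + F₂ q.1 * Y q.2.2 + F₃ q.1) 2 (β.prod (ρ.prod τ)) := by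
  refine (memLp_two_iff_integrable_sq ?_).2 (integral_mixture_sq h₁ h₂ h₃ hX hY hX0 hY0).1
  have m1 := h₁.aestronglyMeasurable.comp_fst (ν := ρ.prod τ)
  have m2 := h₂.aestronglyMeasurable.comp_fst (ν := ρ.prod τ)
  have m3 := h₃.aestronglyMeasurable.comp_fst (ν := ρ.prod τ)
  have mX := (hX.aestronglyMeasurable.comp_fst (ν := τ)).comp_snd (μ := β)
  have mY := (hY.aestronglyMeasurable.comp_snd (μ := ρ)).comp_snd (μ := β)
  exact ((m1.mul mX).add (m2.mul mY)).add m3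

theorem variance_mixture (h₁ : MemLp F₁ 2 β) (h₂ : MemLp F₂ 2 β) (h₃ : MemLp F₃ 2 β)
    (hX : MemLp X 2 ρ) (hY : MemLp Y 2 τ) (hX0 : ∫ t, X t ∂ρ = 0) (hY0 : ∫ u, Y u ∂τ = 0) :
    Var[fun q => F₁ q.1 * X q.2.1 + F₂ q.1 * Y q.2.2 + F₃ q.1; β.prod (ρ.prod τ)] =
      (∫ s, F₁ s ^ 2 ∂β) * (∫ t, X t ^ 2 ∂ρ) + (∫ s, F₂ s ^ 2 ∂β) * (∫ u, Y u ^ 2 ∂τ) +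
        Var[F₃; β] := by
  rw [variance_eq_sub (memLp_mixture h₁ h₂ h₃ hX hY hX0 hY0), variance_eq_sub h₃,
    integral_mixture h₁ h₂ h₃ hX hY hX0 hY0]
  simp only [Pi.pow_apply]
  rw [(integral_mixture_sq h₁ h₂ h₃ hX hY hX0 hY0).2]
  ring

end Mixture

/-! ### The posterior variance -/

theorem ae_posteriorLaw {d α : ℝ} (hd0 : 0 ≤ d) (hd1 : d < 1) {m : ℕ}
    (hαK : 0 < α + (m + 1 : ℕ) * d) {n : Fin (m + 1) → ℕ} (hn : ∀ k, 1 ≤ n k) :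
    ∀ᵐ z ∂posteriorLaw d α n, (0 < pStar z ∧ pStar z < 1) ∧ ∑ k, pObs z k = 1 ∧
      (∀ i, 0 ≤ piPost z i ∧ piPost z i ≤ 1) ∧ HasSum z.2 1 ∧
      Summable fun i => negMulLog (z.2 i) := by
  have hα : -d < α + (m + 1 : ℕ) * d := by linarith
  have hP := isProbabilityMeasure_pitmanYor hd0 hd1 hα
  have hD := isProbabilityMeasure_dirichlet (sub_pos_of_one_le_multiplicity hd1 hn)
  have hD' := isProbabilityMeasure_dirichlet (pos_posteriorParam hd1 hαK hn)
  have hT := (measurePreserving_posteriorLaw hd0 hd1 hαK hn).quasiMeasurePreserving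
  have h1 := (Measure.quasiMeasurePreserving_fst.comp hT).ae
    (ae_betaMeasure_mem (α + (m + 1 : ℕ) * d) (∑ k, ((n k : ℝ) - d)))
  have h2 := ((Measure.quasiMeasurePreserving_fst.comp Measure.quasiMeasurePreserving_snd).comp
    hT).ae (ae_dirichlet_sum (sub_pos_of_one_le_multiplicity hd1 hn))
  have h3 : ∀ᵐ z ∂posteriorLaw d α n, ∀ i, 0 < z.1 i ∧ z.1 i ≤ 1 :=
    Measure.quasiMeasurePreserving_fst.ae (ae_dirichlet_mem_Icc (pos_posteriorParam hd1 hαK hn))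
  have h4 : ∀ᵐ z ∂posteriorLaw d α n, (∀ i, 0 < z.2 i ∧ z.2 i ≤ 1) ∧
      ∑' i, ENNReal.ofReal (z.2 i) = 1 :=
    Measure.quasiMeasurePreserving_snd.ae (ae_pitmanYor hd0 hd1 hα)
  have h5 : ∀ᵐ z ∂posteriorLaw d α n, Summable fun i => negMulLog (z.2 i) :=
    Measure.quasiMeasurePreserving_snd.ae (ae_pitmanYor_summable hd0 hd1 hα)
  filter_upwards [h1, h2, h3, h4, h5] with z h1 h2 h3 h4 h5
  refine ⟨h1, h2, ?_, hasSum_of_tsum_ofReal_eq_one (fun i => (h4.1 i).1.le) h4.2, h5⟩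
  rintro (k | i)
  · exact ⟨(h3 k.castSucc).1.le, (h3 k.castSucc).2⟩
  · exact ⟨mul_nonneg h1.1.le (h4.1 i).1.le, mul_le_one₀ h1.2.le (h4.1 i).1.le (h4.1 i).2⟩

/-- The function equal to `q` on `T` and `0` elsewhere has the set integrals of `T.indicator X`, so
it is its conditional expectation; on `T` the indicator can be dropped. -/
theorem condExp_eq_const_of_setIntegral {Ω : Type*} {m m₀ : MeasurableSpace Ω} {μ : Measure Ω}
    [IsFiniteMeasure μ] (hm : m ≤ m₀) {X : Ω → ℝ} (hX : Integrable X μ) {T : Set Ω}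
    (hT : MeasurableSet[m] T) {q : ℝ}
    (h : ∀ s, MeasurableSet[m] s → ∫ ω in s ∩ T, X ω ∂μ = μ.real (s ∩ T) * q) :
    ∀ᵐ ω ∂μ, ω ∈ T → (μ[X | m]) ω = q := by
  have hg : T.indicator (fun _ => q) =ᵐ[μ] μ[T.indicator X | m] := by
    refine ae_eq_condExp_of_forall_setIntegral_eq hm (hX.indicator (hm _ hT)) ?_ ?_ ?_
    · exact fun s _ _ => ((integrable_const q).indicator (hm _ hT)).integrableOn
    · intro s hs _
      rw [setIntegral_indicator (hm _ hT), setIntegral_indicator (hm _ hT), h s hs,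
        setIntegral_const, smul_eq_mul]
    · exact ((@measurable_const _ _ _ m q).indicator hT).stronglyMeasurable.aestronglyMeasurable
  filter_upwards [hg, condExp_indicator hX hT] with ω h1 h2 hω
  rw [h2, Set.indicator_of_mem hω, Set.indicator_of_mem hω] at h1
  exact h1.symm

/-! ### Conditional moments of the entropy given the sample -/

section Sample

variable {Ω 𝒳 : Type*} [MeasurableSpace Ω] [MeasurableSpace 𝒳] {μ : Measure Ω}
  {G : Measure 𝒳} [IsProbabilityMeasure G] {d α : ℝ} {N : ℕ}
  {w : Ω → ℕ → ℝ} {φ : Ω → ℕ → 𝒳} {x : Ω → Fin N → 𝒳}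

theorem IsPitmanYorSample.measurePreserving_w (h : IsPitmanYorSample μ G d α w φ x)
    (hd0 : 0 ≤ d) (hd1 : d < 1) (hα : -d < α) : MeasurePreserving w μ (pitmanYor d α) := by
  have hP := isProbabilityMeasure_pitmanYor hd0 hd1 hα
  have hw := h.measurable_w
  have hφ := h.measurable_φ
  have h1 : MeasurePreserving (fun ω => (w ω, φ ω)) μ
      ((pitmanYor d α).prod (Measure.infinitePi fun _ : ℕ => G)) := ⟨by fun_prop, h.prior⟩
  exact measurePreserving_fst.comp h1

variable [IsProbabilityMeasure μ] [MeasurableEq 𝒳] [NullSingletonClass G] {m : ℕ} {n : Fin (m + 1) → ℕ}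
  {f : Fin N → Fin (m + 1)}

/-- Both the probability of the event and the integral of the entropy power carry the same factor,
the probability of `S` under `G` times the constant `C`, so `C` need not be computed. -/
theorem IsPitmanYorSample.setIntegral_pattern (h : IsPitmanYorSample μ G d α w φ x)
    (hd0 : 0 ≤ d) (hd1 : d < 1) (hα : -d < α) (hαK : 0 < α + (m + 1 : ℕ) * d)
    (hn : ∀ k, 1 ≤ n k) (hf : ∀ k, (Finset.univ.filter fun j => f j = k).card = n k)
    {S : Set (Fin N → 𝒳)} (hS : MeasurableSet S) (r : ℕ) :
    ∫ ω in x ⁻¹' (S ∩ {y | ∀ a b, y a = y b ↔ f a = f b}), entropy (w ω) ^ r ∂μ =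
      μ.real (x ⁻¹' (S ∩ {y | ∀ a b, y a = y b ↔ f a = f b})) *
        ∫ z, entropy (piPost z) ^ r ∂posteriorLaw d α n := by
  obtain ⟨C, hC⟩ := exists_lintegral_tupleWeight_eq hd0 hd1 (m + 1) hα hαK n hn
  have hQ := isProbabilityMeasure_posteriorLaw hd0 hd1 hαK hn
  have hMP := h.measurePreserving_w hd0 hd1 hα
  have hw := h.measurable_w
  have hE : Measurable fun ω => eEntropy (w ω) ^ r := (measurable_eEntropy.comp hw).pow_const r
  have hE' : Measurable fun z : (Fin (m + 2) → ℝ) × (ℕ → ℝ) =>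
      eEntropy (piPost (K := m + 1) z) ^ r :=
    (measurable_eEntropy.comp measurable_piPost).pow_const r
  have key : ∀ g : ENNReal → ENNReal, Measurable g →
      ∫⁻ ω in x ⁻¹' (S ∩ {y | ∀ a b, y a = y b ↔ f a = f b}), g (eEntropy (w ω)) ∂μ =
        (Measure.pi fun _ : Fin (m + 1) => G) {y | (fun j => y (f j)) ∈ S} *
          (C * ∫⁻ z, g (eEntropy (piPost z)) ∂posteriorLaw d α n) := by
    intro g hg
    have := hC 1 g hg
    simp only [one_mul] at this
    rw [h.lintegral_pattern hd0 hd1 hα hn hf hS hg, this]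
  -- The constant test function identifies the common factor with the probability of the event.
  have k1 := key (fun _ => 1) measurable_const
  have kr := key (fun e => e ^ r) (by fun_prop)
  simp only [lintegral_const, Measure.restrict_apply MeasurableSet.univ, Set.univ_inter,
    measure_univ, one_mul, mul_one] at k1
  have e1 : ∀ᵐ ω ∂μ, entropy (w ω) ^ r = (eEntropy (w ω) ^ r).toReal ∧
      eEntropy (w ω) ^ r < ⊤ := by
    filter_upwards [hMP.quasiMeasurePreserving.ae (entropy_ae_eq_toReal_pitmanYor hd0 hd1 hα),
      hMP.quasiMeasurePreserving.ae (ae_pitmanYor_eEntropy_ne_top hd0 hd1 hα)] with ω h1 h2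
    exact ⟨by rw [h1, ENNReal.toReal_pow], ENNReal.pow_lt_top h2.lt_top⟩
  have e2 : ∀ᵐ z ∂posteriorLaw d α n, entropy (piPost z) ^ r = (eEntropy (piPost z) ^ r).toReal ∧
      eEntropy (piPost z) ^ r < ⊤ := by
    filter_upwards [ae_posteriorLaw hd0 hd1 hαK hn] with z hz
    have hs := (hasSum_negMulLog_piPost hz.1.2 hz.2.1 hz.2.2.2.1 hz.2.2.2.2).summable
    exact ⟨by rw [entropy_eq_toReal hz.2.2.1, ENNReal.toReal_pow],
      ENNReal.pow_lt_top (eEntropy_ne_top_of_summable hs).lt_top⟩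
  rw [integral_congr_ae (ae_restrict_of_ae (e1.mono fun ω hω => hω.1)),
    integral_toReal hE.aemeasurable (ae_restrict_of_ae (e1.mono fun ω hω => hω.2)), kr,
    integral_congr_ae (e2.mono fun z hz => hz.1),
    integral_toReal hE'.aemeasurable (e2.mono fun z hz => hz.2), measureReal_def, k1, ← mul_assoc,
    ENNReal.toReal_mul]

/-- On the tie event the first two conditional moments are the constants given by the posterior law;
the conditional variance is the second minus the square of the first. -/
theorem IsPitmanYorSample.condVar_entropy (h : IsPitmanYorSample μ G d α w φ x)
    (hd0 : 0 ≤ d) (hd1 : d < 1) (hα : -d < α) (hαK : 0 < α + (m + 1 : ℕ) * d)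
    (hn : ∀ k, 1 ≤ n k) (hf : ∀ k, (Finset.univ.filter fun j => f j = k).card = n k)
    (hpost : MemLp (fun z => entropy (piPost z)) 2 (posteriorLaw d α n)) :
    ∀ᵐ ω ∂μ, (∀ i j, x ω i = x ω j ↔ f i = f j) →
      Var[fun ω => entropy (w ω); μ | MeasurableSpace.comap x inferInstance] ω =
        Var[fun z => entropy (piPost z); posteriorLaw d α n] := by
  have hQ := isProbabilityMeasure_posteriorLaw hd0 hd1 hαK hn
  have hm : MeasurableSpace.comap x inferInstance ≤ _ := h.measurable_x.comap_le
  have hL : MemLp (fun ω => entropy (w ω)) 2 μ :=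
    (memLp_entropy_pitmanYor hd0 hd1 hα).comp_measurePreserving
      (h.measurePreserving_w hd0 hd1 hα)
  have hT : MeasurableSet[MeasurableSpace.comap x inferInstance]
      (x ⁻¹' {y | ∀ a b, y a = y b ↔ f a = f b}) := ⟨_, measurableSet_pattern f, rfl⟩
  have key : ∀ r : ℕ, ∀ s, MeasurableSet[MeasurableSpace.comap x inferInstance] s →
      ∫ ω in s ∩ x ⁻¹' {y | ∀ a b, y a = y b ↔ f a = f b}, entropy (w ω) ^ r ∂μ =
        μ.real (s ∩ x ⁻¹' {y | ∀ a b, y a = y b ↔ f a = f b}) *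
          ∫ z, entropy (piPost z) ^ r ∂posteriorLaw d α n := by
    rintro r _ ⟨S, hS, rfl⟩
    exact h.setIntegral_pattern hd0 hd1 hα hαK hn hf hS r
  have c1 := condExp_eq_const_of_setIntegral hm (hL.integrable (by norm_num)) hT
    (q := ∫ z, entropy (piPost z) ∂posteriorLaw d α n)
    fun s hs => by simpa only [pow_one] using key 1 s hs
  have c2 := condExp_eq_const_of_setIntegral hm hL.integrable_sq hT (key 2)
  filter_upwards [c1, c2, condVar_ae_eq_condExp_sq_sub_sq_condExp hm hL] with ω h1 h2 h3 hω
  rw [h3, variance_eq_sub hpost, Pi.sub_apply, Pi.pow_apply, h1 hω]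
  exact congrArg (· - _) (h2 hω)

end Sample

/-! ### Moments of the mass of the unobserved symbols -/

section Beta

variable {b c : ℝ}

theorem integral_id_betaMeasure (hb : 0 < b) (hc : 0 < c) :
    ∫ u, u ∂betaMeasure b c = b / (b + c) := by
  have hD' := isProbabilityMeasure_dirichlet (a := Function.update ![b, c] 0 (b + 1)) fun i => by
    fin_cases i <;> simp <;> linarith
  have := integral_dirichlet_coord_mul (pos_vecCons_two hb hc) 0 fun _ => 1
  rw [integral_betaMeasure hb hc (f := fun u => u) (by fun_prop)]
  simp only [mul_one, sum_vecCons_two, Matrix.cons_val_zero, integral_const] at this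
  rw [this, probReal_univ, smul_eq_mul, mul_one, mul_one]

theorem integral_sq_betaMeasure (hb : 0 < b) (hc : 0 < c) :
    ∫ u, u ^ 2 ∂betaMeasure b c = b * (b + 1) / ((b + c) * (b + c + 1)) := by
  have hD' := isProbabilityMeasure_dirichlet (a := Function.update ![b, c] 0 (b + 2)) fun i => by
    fin_cases i <;> simp <;> linarith
  have := integral_dirichlet_sq_mul (pos_vecCons_two hb hc) 0 fun _ => 1
  rw [integral_betaMeasure hb hc (by fun_prop)]
  simp only [mul_one, ← pow_two, sum_vecCons_two, Matrix.cons_val_zero, integral_const] at this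
  rw [this, probReal_univ, smul_eq_mul, mul_one]
  ring

theorem entropy_two {p : Fin 2 → ℝ} (hp : p 1 = 1 - p 0) : entropy p = binEntropy (p 0) := by
  rw [entropy, tsum_fintype, Fin.sum_univ_two, hp, binEntropy_eq_negMulLog_add_negMulLog_one_sub]

theorem integral_binEntropy_betaMeasure (hb : 0 < b) (hc : 0 < c) :
    ∫ u, binEntropy u ∂betaMeasure b c = dirichletEntropyMean ![b, c] := by
  rw [integral_betaMeasure hb hc (by fun_prop),
    ← integral_entropy_dirichlet (pos_vecCons_two hb hc)]
  refine integral_congr_ae ?_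
  filter_upwards [ae_dirichlet_two hb hc] with p hp
  exact (entropy_two hp.2.2).symm

theorem integral_binEntropy_sq_betaMeasure (hb : 0 < b) (hc : 0 < c) :
    ∫ u, binEntropy u ^ 2 ∂betaMeasure b c = dirichletEntropySecondMoment ![b, c] := by
  rw [integral_betaMeasure hb hc (by fun_prop),
    ← integral_entropy_sq_dirichlet (pos_vecCons_two hb hc)]
  refine integral_congr_ae ?_
  filter_upwards [ae_dirichlet_two hb hc] with p hp
  simp only [entropy_two hp.2.2]

theorem integral_mul_binEntropy_betaMeasure (hb : 0 < b) (hc : 0 < c) :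
    ∫ u, u * binEntropy u ∂betaMeasure b c =
      b * (b + 1) / ((b + c) * (b + c + 1)) * (psi0 (b + c + 2) - psi0 (b + 2)) +
        b * c / ((b + c) * (b + c + 1)) * (psi0 (b + c + 2) - psi0 (c + 1)) := by
  have ha := pos_vecCons_two hb hc
  have hD := isProbabilityMeasure_dirichlet ha
  have h1 := integral_sq_mul_log_dirichlet ha 0
  have h2 := integral_mul_mul_log_dirichlet ha (i := 0) (k := 1) (by simp)
  have hint : ∀ k, Integrable (fun p : Fin 2 → ℝ => p 0 * (p k * log (p k)))
      (dirichlet ![b, c]) := fun k => by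
    refine Integrable.of_bound (Measurable.aestronglyMeasurable (by fun_prop)) 1 ?_
    filter_upwards [ae_dirichlet_mem_Icc ha] with p hp
    have h := negMulLog_mem_Icc (hp k).1.le (hp k).2
    have e : p k * log (p k) = -negMulLog (p k) := by rw [negMulLog]; ring
    rw [e, mul_neg, norm_neg, norm_mul, norm_of_nonneg h.1, norm_of_nonneg (hp 0).1.le]
    exact mul_le_one₀ (hp 0).2 h.1 h.2
  rw [integral_betaMeasure hb hc (by fun_prop)]
  have e : ∫ p, p 0 * binEntropy (p 0) ∂dirichlet ![b, c] =
      ∫ p, -(p 0 * (p 0 * log (p 0))) - p 0 * (p 1 * log (p 1)) ∂dirichlet ![b, c] := by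
    refine integral_congr_ae ?_
    filter_upwards [ae_dirichlet_two hb hc] with p hp
    rw [binEntropy_eq_negMulLog_add_negMulLog_one_sub, ← hp.2.2, negMulLog, negMulLog]
    ring
  rw [e, integral_sub (hint 0).fun_neg (hint 1), integral_neg, h1, h2]
  simp only [sum_vecCons_two, Matrix.cons_val_zero, Matrix.cons_val_one]
  ring

theorem memLp_betaMeasure_of_continuous (hb : 0 < b) (hc : 0 < c) {f : ℝ → ℝ} (hf : Continuous f) :
    MemLp f 2 (betaMeasure b c) := by
  obtain ⟨C, hC⟩ := (isCompact_Icc (a := (0 : ℝ)) (b := 1)).exists_bound_of_continuousOn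
    hf.continuousOn
  have := isProbabilityMeasureBeta hb hc
  refine MemLp.of_bound hf.aestronglyMeasurable C ?_
  filter_upwards [ae_betaMeasure_mem b c] with u hu
  exact hC u ⟨hu.1.le, hu.2.le⟩

end Beta

theorem continuous_bigOmega (A B : ℝ) : Continuous (bigOmega A B) := by
  unfold bigOmega
  fun_prop

/-- The law of total variance for the entropy of `π_post`. -/
theorem variance_entropy_piPost {d α : ℝ} (hd0 : 0 ≤ d) (hd1 : d < 1) {m : ℕ}
    (hαK : 0 < α + (m + 1 : ℕ) * d) {n : Fin (m + 1) → ℕ} (hn : ∀ k, 1 ≤ n k) :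
    MemLp (fun z => entropy (piPost z)) 2 (posteriorLaw d α n) ∧
    Var[fun z => entropy (piPost z); posteriorLaw d α n] =
      (∫ u, (1 - u) ^ 2 ∂betaMeasure (α + (m + 1 : ℕ) * d) (∑ k, ((n k : ℝ) - d))) *
          Var[fun p => entropy p; dirichlet fun k => (n k : ℝ) - d] +
        (∫ u, u ^ 2 ∂betaMeasure (α + (m + 1 : ℕ) * d) (∑ k, ((n k : ℝ) - d))) *
          Var[fun w => entropy w; pitmanYor d (α + (m + 1 : ℕ) * d)] +
        Var[bigOmega (∫ p, entropy p ∂dirichlet fun k => (n k : ℝ) - d)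
            (∫ w, entropy w ∂pitmanYor d (α + (m + 1 : ℕ) * d));
          betaMeasure (α + (m + 1 : ℕ) * d) (∑ k, ((n k : ℝ) - d))] := by
  have hα : -d < α + (m + 1 : ℕ) * d := by linarith
  have hpos := sub_pos_of_one_le_multiplicity hd1 hn
  have hc : 0 < ∑ k, ((n k : ℝ) - d) := Finset.sum_pos (fun k _ => hpos k) Finset.univ_nonempty
  have hP := isProbabilityMeasure_pitmanYor hd0 hd1 hα
  have hD := isProbabilityMeasure_dirichlet hpos
  have hβ := isProbabilityMeasureBeta hαK hc
  have hMP := measurePreserving_posteriorLaw hd0 hd1 hαK hn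
  have hX := memLp_entropy_dirichlet hpos
  have hY := memLp_entropy_pitmanYor hd0 hd1 hα
  have hL := fun {f : ℝ → ℝ} (hf : Continuous f) => memLp_betaMeasure_of_continuous hαK hc hf
  set b := α + (m + 1 : ℕ) * d
  set A := ∫ p, entropy p ∂dirichlet fun k => (n k : ℝ) - d with hA
  set B := ∫ w, entropy w ∂pitmanYor d b with hB
  have h1 : MemLp (fun u : ℝ => 1 - u) 2 (betaMeasure b (∑ k, ((n k : ℝ) - d))) :=
    hL (by fun_prop)
  have h2 : MemLp (fun u : ℝ => u) 2 (betaMeasure b (∑ k, ((n k : ℝ) - d))) := hL (by fun_prop)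
  have h3 := hL (continuous_bigOmega A B)
  -- Centring moves the means `A` and `B` into `Ω`, which makes the cross terms vanish.
  have hX' : MemLp (fun p : Fin (m + 1) → ℝ => entropy p - A) 2 (dirichlet fun k => (n k : ℝ) - d) :=
    hX.sub (memLp_const A)
  have hY' : MemLp (fun w : ℕ → ℝ => entropy w - B) 2 (pitmanYor d b) := hY.sub (memLp_const B)
  have hX0 : ∫ p, (entropy p - A) ∂dirichlet (fun k => (n k : ℝ) - d) = 0 := by
    rw [integral_sub (hX.integrable (by norm_num)) (integrable_const A)]
    simp [hA]
  have hY0 : ∫ w, (entropy w - B) ∂pitmanYor d b = 0 := by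
    rw [integral_sub (hY.integrable (by norm_num)) (integrable_const B)]
    simp [hB]
  have hM := memLp_mixture h1 h2 h3 hX' hY' hX0 hY0
  have hV := variance_mixture h1 h2 h3 hX' hY' hX0 hY0
  have hae : (fun z => entropy (piPost z)) =ᵐ[posteriorLaw d α n]
      (fun q : ℝ × (Fin (m + 1) → ℝ) × (ℕ → ℝ) =>
        (1 - q.1) * (entropy q.2.1 - A) + q.1 * (entropy q.2.2 - B) + bigOmega A B q.1) ∘
        fun z => (pStar z, pObs z, z.2) := by
    filter_upwards [ae_posteriorLaw hd0 hd1 hαK hn] with z hz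
    rw [entropy, (hasSum_negMulLog_piPost hz.1.2 hz.2.1 hz.2.2.2.1 hz.2.2.2.2).tsum_eq]
    simp only [Function.comp, bigOmega]
    ring
  refine ⟨(memLp_congr_ae hae).2 (hM.comp_measurePreserving hMP), ?_⟩
  rw [variance_congr hae, Function.comp_def,
    hMP.variance_fun_comp hM.aestronglyMeasurable.aemeasurable, hV,
    variance_eq_integral hX.aestronglyMeasurable.aemeasurable,
    variance_eq_integral hY.aestronglyMeasurable.aemeasurable]

/-- A sample with `K` distinct values of multiplicities `n` follows one of the finitely many tie
patterns `f`, so quantifying over `f` covers the conditioning on all such samples. The other moments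
under `Q` are carried to the beta, Dirichlet and Pitman–Yor laws along the maps to `p_*`, `𝐩` and
`π`. -/
theorem mainTheorem8
    (d α : ℝ) (hd0 : 0 ≤ d) (hd1 : d < 1) (hα : -d < α)
    (K N : ℕ) (hK : 1 ≤ K) (n : Fin K → ℕ) (hn : ∀ k, 1 ≤ n k) (hN : ∑ k, n k = N)
    (Q : Measure ((Fin (K + 1) → ℝ) × (ℕ → ℝ))) (hQ : Q = posteriorLaw d α n)
    (A B : ℝ) (hA : A = ∫ z, entropy (pObs z) ∂Q) (hB : B = ∫ z, entropy z.2 ∂Q)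
    (b c : ℝ) (hb : b = α + K * d) (hc : c = N - K * d) :
    -- the posterior variance given the observed data is the variance of `H(π_post)`
    (∀ (X : Type*) (𝒳 : Type*) [MeasurableSpace X] [MeasurableSpace 𝒳] [MeasurableEq 𝒳]
      (μ : Measure X) [IsProbabilityMeasure μ] (G : Measure 𝒳) [IsProbabilityMeasure G]
      [NullSingletonClass G] (w : X → ℕ → ℝ) (φ : X → ℕ → 𝒳) (x : X → Fin N → 𝒳),
      IsPitmanYorSample μ G d α w φ x →
        (∀ᵐ ω ∂μ, Summable fun i => negMulLog (w ω i)) ∧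
        MemLp (fun ω => entropy (w ω)) 2 μ ∧
        ∀ f : Fin N → Fin K, (∀ k, (Finset.univ.filter fun j => f j = k).card = n k) →
          ∀ᵐ ω ∂μ, (∀ i j, x ω i = x ω j ↔ f i = f j) →
            Var[fun ω => entropy (w ω); μ | MeasurableSpace.comap x inferInstance] ω =
              Var[fun z => entropy (piPost z); Q]) ∧
    -- all quantities in the decomposition are well defined
    IsProbabilityMeasure Q ∧
    (∀ᵐ z ∂Q, 0 < pStar z ∧ pStar z < 1 ∧
      (Summable fun i => negMulLog (z.2 i)) ∧ (Summable fun i => negMulLog (piPost z i))) ∧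
    MemLp (fun z => entropy (piPost z)) 2 Q ∧
    MemLp (fun z => entropy (pObs z)) 2 Q ∧
    MemLp (fun z => entropy z.2) 2 Q ∧
    MemLp (fun z => bigOmega A B (pStar z)) 2 Q ∧
    -- the decomposition of the variance
    Var[fun z => entropy (piPost z); Q] =
      (∫ z, (1 - pStar z) ^ 2 ∂Q) * Var[fun z => entropy (pObs z); Q] +
        (∫ z, pStar z ^ 2 ∂Q) * Var[fun z => entropy z.2; Q] +
        Var[fun z => bigOmega A B (pStar z); Q] ∧
    Var[fun z => bigOmega A B (pStar z); Q] =
      (∫ z, bigOmega A B (pStar z) ^ 2 ∂Q) - (∫ z, bigOmega A B (pStar z) ∂Q) ^ 2 ∧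
    -- the moments of `Ω(p_*)` in terms of those of `p_*` and `h(p_*)`
    ∫ z, bigOmega A B (pStar z) ∂Q =
      (∫ z, (1 - pStar z) ∂Q) * A + (∫ z, pStar z ∂Q) * B + ∫ z, binEntropy (pStar z) ∂Q ∧
    ∫ z, bigOmega A B (pStar z) ^ 2 ∂Q =
      2 * (∫ z, pStar z * binEntropy (pStar z) ∂Q) * (B - A) +
        2 * A * (∫ z, binEntropy (pStar z) ∂Q) + (∫ z, binEntropy (pStar z) ^ 2 ∂Q) +
        (∫ z, pStar z ^ 2 ∂Q) * (B ^ 2 - 2 * A * B) +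
        2 * (∫ z, pStar z ∂Q) * A * B + (∫ z, (1 - pStar z) ^ 2 ∂Q) * A ^ 2 ∧
    -- closed forms of the components
    ∫ z, pStar z ∂Q = b / (α + N) ∧
    ∫ z, (1 - pStar z) ∂Q = c / (α + N) ∧
    ∫ z, pStar z ^ 2 ∂Q = b * (b + 1) / ((α + N) * (α + N + 1)) ∧
    ∫ z, (1 - pStar z) ^ 2 ∂Q = c * (c + 1) / ((α + N) * (α + N + 1)) ∧
    A = dirichletEntropyMean (fun k => (n k : ℝ) - d) ∧
    Var[fun z => entropy (pObs z); Q] =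
      dirichletEntropySecondMoment (fun k => (n k : ℝ) - d) -
        dirichletEntropyMean (fun k => (n k : ℝ) - d) ^ 2 ∧
    B = pitmanYorEntropyMean d b ∧
    Var[fun z => entropy z.2; Q] = pitmanYorEntropyVariance d b ∧
    ∫ z, binEntropy (pStar z) ∂Q = dirichletEntropyMean ![b, c] ∧
    ∫ z, binEntropy (pStar z) ^ 2 ∂Q = dirichletEntropySecondMoment ![b, c] ∧
    ∫ z, pStar z * binEntropy (pStar z) ∂Q =
      b * (b + 1) / ((α + N) * (α + N + 1)) * (psi0 (α + N + 2) - psi0 (b + 2)) +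
        b * c / ((α + N) * (α + N + 1)) * (psi0 (α + N + 2) - psi0 (c + 1)) := by
  obtain ⟨m, rfl⟩ : ∃ m, K = m + 1 := ⟨K - 1, by omega⟩
  -- At least one observed value is what makes this positive: `α + d > 0` and the other `m` terms
  -- `d` are nonnegative.
  have hαK : 0 < α + (m + 1 : ℕ) * d := by
    push_cast
    nlinarith [mul_nonneg (Nat.cast_nonneg (α := ℝ) m) hd0]
  have hα' : -d < α + (m + 1 : ℕ) * d := by linarith
  have hpos := sub_pos_of_one_le_multiplicity hd1 hn
  have hsum : ∑ k, ((n k : ℝ) - d) = c := by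
    rw [hc, ← hN, Finset.sum_sub_distrib]
    simp
  have hc0 : 0 < c := by
    rw [← hsum]
    exact Finset.sum_pos (fun k _ => hpos k) Finset.univ_nonempty
  have hbc : α + N = b + c := by rw [hb, hc]; ring
  have hP := isProbabilityMeasure_pitmanYor hd0 hd1 hα'
  have hD := isProbabilityMeasure_dirichlet hpos
  have hMP := measurePreserving_posteriorLaw hd0 hd1 hαK hn
  have hX := memLp_entropy_dirichlet hpos
  have hY := memLp_entropy_pitmanYor hd0 hd1 hα'
  obtain ⟨hpost, hvar⟩ := variance_entropy_piPost hd0 hd1 hαK hn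
  have hae := ae_posteriorLaw hd0 hd1 hαK hn
  have hQP := isProbabilityMeasure_posteriorLaw hd0 hd1 hαK hn
  rw [← hb, hsum] at hMP hvar
  rw [← hb] at hαK hα' hP hY
  rw [← hQ] at hMP hpost hvar hae hQP
  have hβ := isProbabilityMeasureBeta hαK hc0
  have hS : MeasurePreserving pStar Q (betaMeasure b c) := measurePreserving_fst.comp hMP
  have hOW : MeasurePreserving (fun z => (pObs z, z.2)) Q
      ((dirichlet fun k => (n k : ℝ) - d).prod (pitmanYor d b)) := measurePreserving_snd.comp hMP
  have hO : MeasurePreserving pObs Q (dirichlet fun k => (n k : ℝ) - d) :=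
    measurePreserving_fst.comp hOW
  have hW : MeasurePreserving (fun z => z.2) Q (pitmanYor d b) := by
    have h := measurePreserving_snd.comp hOW
    exact h
  have hA' : A = ∫ p, entropy p ∂dirichlet fun k => (n k : ℝ) - d := by
    rw [hA, ← hO.map_eq, integral_map hO.aemeasurable (by
      rw [hO.map_eq]
      exact hX.aestronglyMeasurable)]
  have hB' : B = ∫ w, entropy w ∂pitmanYor d b := by
    rw [hB, ← hW.map_eq, integral_map hW.aemeasurable (by
      rw [hW.map_eq]
      exact hY.aestronglyMeasurable)]
  have hVX : Var[fun z => entropy (pObs z); Q] =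
      Var[fun p => entropy p; dirichlet fun k => (n k : ℝ) - d] :=
    hO.variance_fun_comp hX.aestronglyMeasurable.aemeasurable
  have hVY : Var[fun z => entropy z.2; Q] = Var[fun w => entropy w; pitmanYor d b] :=
    hW.variance_fun_comp hY.aestronglyMeasurable.aemeasurable
  have hcS : ∀ {g : ℝ → ℝ}, Continuous g →
      ∫ z, g (pStar z) ∂Q = ∫ u, g u ∂betaMeasure b c := fun {g} hg => by
    rw [← hS.map_eq, integral_map hS.aemeasurable hg.aestronglyMeasurable]
  have hL : ∀ {g : ℝ → ℝ}, Continuous g → MemLp g 2 (betaMeasure b c) := fun hg =>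
    memLp_betaMeasure_of_continuous hαK hc0 hg
  have hI : ∀ {g : ℝ → ℝ}, Continuous g → Integrable g (betaMeasure b c) := fun hg =>
    (hL hg).integrable (by norm_num)
  have hΩ := continuous_bigOmega A B
  have hΩL : MemLp (fun z => bigOmega A B (pStar z)) 2 Q := (hL hΩ).comp_measurePreserving hS
  have hVΩ : Var[fun z => bigOmega A B (pStar z); Q] = Var[bigOmega A B; betaMeasure b c] :=
    hS.variance_fun_comp hΩ.measurable.aemeasurable
  have e1 := hcS (g := fun u => u) (by fun_prop)
  have e2 := hcS (g := fun u => 1 - u) (by fun_prop)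
  have e3 := hcS (g := fun u => u ^ 2) (by fun_prop)
  have e4 := hcS (g := fun u => (1 - u) ^ 2) (by fun_prop)
  have e5 := hcS (g := fun u => binEntropy u) (by fun_prop)
  have e6 := hcS (g := fun u => binEntropy u ^ 2) (by fun_prop)
  have e7 := hcS (g := fun u => u * binEntropy u) (by fun_prop)
  have e8 := hcS (g := fun u => bigOmega A B u) hΩ
  have e9 := hcS (g := fun u => bigOmega A B u ^ 2) (by fun_prop)
  have i1 := hI (g := fun u => u) (by fun_prop)
  have i3 := hI (g := fun u => u ^ 2) (by fun_prop)
  have i4 := hI (g := fun u => (1 - u) ^ 2) (by fun_prop)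
  have i5 := hI (g := fun u => binEntropy u) (by fun_prop)
  have i6 := hI (g := fun u => binEntropy u ^ 2) (by fun_prop)
  have i7 := hI (g := fun u => u * binEntropy u) (by fun_prop)
  have m1 := integral_id_betaMeasure hαK hc0
  have m3 := integral_sq_betaMeasure hαK hc0
  have m2 : ∫ u, (1 - u) ∂betaMeasure b c = 1 - ∫ u, u ∂betaMeasure b c := by
    rw [integral_sub (integrable_const 1) i1]
    simp
  have m4 : ∫ u, (1 - u) ^ 2 ∂betaMeasure b c =
      1 - 2 * ∫ u, u ∂betaMeasure b c + ∫ u, u ^ 2 ∂betaMeasure b c := by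
    have : (fun u : ℝ => (1 - u) ^ 2) = fun u => 1 - 2 * u + u ^ 2 := by
      funext u
      ring
    rw [this, integral_add (hI (by fun_prop)) i3,
      integral_sub (integrable_const 1) (i1.const_mul 2), integral_const_mul]
    simp
  have hbc1 : b + c ≠ 0 := by positivity
  have hbc2 : b + c + 1 ≠ 0 := by positivity
  refine ⟨?_, hQP, ?_, hpost, hX.comp_measurePreserving hO, hY.comp_measurePreserving hW, hΩL,
    ?_, variance_eq_sub hΩL, ?_, ?_, ?_, ?_, ?_, ?_, ?_, ?_, ?_, ?_, ?_, ?_, ?_⟩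
  · intro X 𝒳 _ _ _ μ _ G _ _ w φ x h
    have hw := h.measurePreserving_w hd0 hd1 hα
    refine ⟨hw.quasiMeasurePreserving.ae (ae_pitmanYor_summable hd0 hd1 hα),
      (memLp_entropy_pitmanYor hd0 hd1 hα).comp_measurePreserving hw, fun f hf => ?_⟩
    rw [hQ] at hpost ⊢
    exact h.condVar_entropy hd0 hd1 hα (hb ▸ hαK) hn hf hpost
  · filter_upwards [hae] with z hz
    exact ⟨hz.1.1, hz.1.2, hz.2.2.2.2,
      (hasSum_negMulLog_piPost hz.1.2 hz.2.1 hz.2.2.2.1 hz.2.2.2.2).summable⟩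
  · rw [hvar, ← hA', ← hB', hVX, hVY, hVΩ, e3, e4]
  · rw [e8, e2, e1, e5, ← integral_mul_const, ← integral_mul_const,
      ← integral_add (hI (by fun_prop)) (hI (by fun_prop)),
      ← integral_add (hI (by fun_prop)) (hI (by fun_prop))]
    rfl
  -- The terms `A B u (1 - u)` are expanded into `u` and `u ^ 2`, while `(1 - u) ^ 2` is kept, so
  -- that only the listed moments occur.
  · have : (fun u => bigOmega A B u ^ 2) = fun u => (2 * (B - A)) * (u * binEntropy u) +
        2 * A * binEntropy u + binEntropy u ^ 2 + (B ^ 2 - 2 * A * B) * u ^ 2 +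
        2 * A * B * u + A ^ 2 * (1 - u) ^ 2 := by
      funext u
      unfold bigOmega
      ring
    have j2 := (i7.const_mul (2 * (B - A))).fun_add (i5.const_mul (2 * A))
    have j3 := j2.fun_add i6
    have j4 := j3.fun_add (i3.const_mul (B ^ 2 - 2 * A * B))
    have j5 := j4.fun_add (i1.const_mul (2 * A * B))
    rw [e9, e7, e5, e6, e3, e1, e4, this, integral_add j5 (i4.const_mul _),
      integral_add j4 (i1.const_mul _), integral_add j3 (i3.const_mul _), integral_add j2 i6,
      integral_add (i7.const_mul _) (i5.const_mul _)]
    have t := integral_const_mul (μ := betaMeasure b c) (2 * A * B) fun u : ℝ => u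
    simp only [integral_const_mul, t]
    ring
  · rw [e1, m1, hbc]
  · rw [e2, m2, m1, hbc]
    field_simp
    ring
  · rw [e3, m3, hbc]
  · rw [e4, m4, m3, m1, hbc]
    field_simp
    ring
  · rw [hA', integral_entropy_dirichlet hpos]
  · rw [hVX, variance_eq_sub hX, ← integral_entropy_dirichlet hpos,
      ← integral_entropy_sq_dirichlet hpos]
    rfl
  · rw [hB', integral_entropy_pitmanYor hd0 hd1 hα']
  · rw [hVY, variance_entropy_pitmanYor hd0 hd1 hα']
  · rw [e5, integral_binEntropy_betaMeasure hαK hc0]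
  · rw [e6, integral_binEntropy_sq_betaMeasure hαK hc0]
  · rw [e7, integral_mul_binEntropy_betaMeasure hαK hc0, hbc]
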